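/- Let $0 \le \nu < 3$ and $\gamma \ge (3-\nu)/4$. There is a constant $C = C(\nu,\gamma) > 0$ such that the following holds for every non-negative function $V$ on $(0,\infty)$ for which $V(x)^{\gamma + (1+\nu)/4}\, x^{\nu}$ is integrable on $(0,\infty)$. The quadratic form $$u \mapsto \int_0^\infty \Big( |u''(x)|^2 - \frac{9}{16}\,\frac{|u(x)|^2}{x^4} - V(x)\,|u(x)|^2 \Big)\, dx$$ is well defined and lower semi-bounded on $C_0^\infty(0,\infty)$ (complex-valued functions, with respect to the norm of $L^2(0,\infty)$), and it is closable in $L^2(0,\infty)$. Let $H_0 - V$ be the self-adjoint operator in $L^2(0,\infty)$ associated with the closure of this form. Then the negative spectrum of $H_0 - V$ is discrete, that is, it consists of isolated points of the spectrum that are eigenvalues of finite multiplicity, and $$\operatorname{tr}\,(H_0 - V)_-^{\gamma} \le C \int_0^\infty V(x)^{\gamma + \frac{1+\nu}{4}}\, x^{\nu}\, dx,$$ where $\operatorname{tr}\,(H_0 - V)_-^{\gamma} = \sum_j |\lambda_j|^{\gamma}$ is the sum over the negative eigenvalues $\lambda_j$ of $H_0 - V$, repeated according to multiplicity. -/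

import Mathlib

open MeasureTheory Set Filter Topology TopologicalSpace
open scoped ENNReal InnerProductSpace Distributions

noncomputable section

namespace LiebThirring

/-! ### Sesquilinear forms and unbounded operators in a complex Hilbert space -/

section Abstract

variable {H : Type*} [NormedAddCommGroup H] [InnerProductSpace ℂ H]

/-- A (possibly unbounded) sesquilinear form in `H`: a linear subspace of `H` and a sesquilinear
form on it, conjugate-linear in the first argument like Mathlib's inner product. -/
structure Form (H : Type*) [NormedAddCommGroup H] [InnerProductSpace ℂ H] where
  /-- the form domain -/
  domain : Submodule ℂ H
  /-- the sesquilinear form -/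
  sesq : domain →ₗ⋆[ℂ] domain →ₗ[ℂ] ℂ

/-- The quadratic form `h[u] = h[u, u]`. -/
def Form.quad (h : Form H) (u : h.domain) : ℂ := h.sesq u u

/-- `h` is Hermitian. -/
def Form.IsHermitian (h : Form H) : Prop :=
  ∀ u v : h.domain, h.sesq u v = starRingEnd ℂ (h.sesq v u)

/-- `h` is lower semi-bounded. -/
def Form.IsSemibounded (h : Form H) : Prop :=
  ∃ c : ℝ, ∀ u : h.domain, c * ‖(u : H)‖ ^ 2 ≤ (h.quad u).re

/-- `h` is closed: if `φ n ∈ dom h` converges to `u` in `H` and `h[φ m - φ n] → 0`, then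
`u ∈ dom h` and `h[φ n - u] → 0`. -/
def Form.IsClosed (h : Form H) : Prop :=
  ∀ (φ : ℕ → h.domain) (u : H), Tendsto (fun n => (φ n : H)) atTop (𝓝 u) →
    Tendsto (fun p : ℕ × ℕ => h.quad (φ p.1 - φ p.2)) atTop (𝓝 0) →
    ∃ hu : u ∈ h.domain, Tendsto (fun n => h.quad (φ n - ⟨u, hu⟩)) atTop (𝓝 0)

/-- `h` is the closure of the quadratic form `q`, initially given on the subspace `j(E)` of `H`:
`h` is a closed semi-bounded Hermitian form that extends `q`, and `j(E)` is a core of `h`.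
There is at most one such `h`, and there is one only if `q` is closable. -/
structure Form.IsClosureOf {E : Type*} [AddCommGroup E] [Module ℂ E]
    (h : Form H) (j : E →ₗ[ℂ] H) (q : E → ℝ) : Prop where
  hermitian : h.IsHermitian
  semibounded : h.IsSemibounded
  closed : h.IsClosed
  extends_core : ∀ u : E, ∃ hu : j u ∈ h.domain, h.quad ⟨j u, hu⟩ = q u
  core_dense : ∀ u : h.domain, ∃ φ : ℕ → E, ∃ hφ : ∀ n, j (φ n) ∈ h.domain,
    Tendsto (fun n => j (φ n)) atTop (𝓝 (u : H)) ∧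
    Tendsto (fun n => h.quad (⟨j (φ n), hφ n⟩ - u)) atTop (𝓝 0)

/-- `T` is the operator associated with the form `h`: `u ∈ dom T` and `T u = f` if and only if
`u ∈ dom h` and `h[v, u] = ⟪v, f⟫` for all `v ∈ dom h`. -/
def IsAssociated (T : H →ₗ.[ℂ] H) (h : Form H) : Prop :=
  ∀ u f : H, (u, f) ∈ T.graph ↔
    ∃ hu : u ∈ h.domain, ∀ v : h.domain, h.sesq v ⟨u, hu⟩ = ⟪(v : H), f⟫_ℂ

/-- The resolvent set of `T`: those `z` for which `T - z` is a bijection of `dom T` onto `H` with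
bounded inverse. -/
def resolventSet (T : H →ₗ.[ℂ] H) : Set ℂ :=
  {z | ∃ R : H →L[ℂ] H,
    (∀ f : H, ∃ hf : R f ∈ T.domain, T ⟨R f, hf⟩ - z • R f = f) ∧
    ∀ u : T.domain, R (T u - z • (u : H)) = u}

/-- The spectrum of `T`. -/
def spec (T : H →ₗ.[ℂ] H) : Set ℂ := (resolventSet T)ᶜ

/-- The eigenspace `ker (T - z)`. -/
def eigenspace (T : H →ₗ.[ℂ] H) (z : ℂ) : Submodule ℂ T.domain :=
  LinearMap.ker (T.toFun - z • T.domain.subtype)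

/-- The negative spectrum of `T` is discrete: every negative point of the spectrum is isolated in
the spectrum and is an eigenvalue of finite multiplicity. -/
def HasDiscreteNegSpectrum (T : H →ₗ.[ℂ] H) : Prop :=
  ∀ r : ℝ, r < 0 → (r : ℂ) ∈ spec T →
    (∃ ε > 0, ∀ z ∈ spec T, ‖z - r‖ < ε → z = r) ∧
    eigenspace T r ≠ ⊥ ∧ FiniteDimensional ℂ (eigenspace T r)

/-- `tr T_-^γ` for an operator with discrete negative spectrum: the sum of `|r|^γ` over the negative
eigenvalues `r` of `T`, each counted with its multiplicity. (Points `r` that are not eigenvalues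
have multiplicity `0`.) -/
def negTrace (T : H →ₗ.[ℂ] H) (γ : ℝ) : ℝ≥0∞ :=
  ∑' r : {r : ℝ // r < 0},
    ((Cardinal.toENat (Module.rank ℂ (eigenspace T (r : ℝ)))) : ℝ≥0∞) *
      ENNReal.ofReal (|(r : ℝ)| ^ γ)

end Abstract

/-! ### The fourth-order operator on the half-line -/

/-- The open half-line `(0, ∞)`. -/
def halfLine : Opens ℝ := ⟨Ioi 0, isOpen_Ioi⟩

/-- The Hilbert space `L²(0, ∞)`. -/
abbrev L2 : Type := Lp ℂ 2 ((volume : Measure ℝ).restrict (Ioi 0))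

theorem memLp_test (u : 𝓓(halfLine, ℂ)) :
    MemLp u 2 ((volume : Measure ℝ).restrict (Ioi 0)) :=
  u.continuous.memLp_of_hasCompactSupport u.hasCompactSupport

/-- The inclusion of `C₀^∞(0, ∞)` into `L²(0, ∞)`. -/
def toL2 : 𝓓(halfLine, ℂ) →ₗ[ℂ] L2 where
  toFun u := (memLp_test u).toLp u
  map_add' _ _ := rfl
  map_smul' _ _ := rfl

/-- The sharp constant in the Hardy–Rellich inequality
`∫ |u''|² ≥ C ∫ |u|² / x⁴` for `u ∈ C₀^∞(0, ∞)`. -/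
def hardyRellichConst : ℝ := 9 / 16

/-- The integrand `|u''|² - (9/16) |u|² / x⁴ - V |u|²`. -/
def energyDensity (V : ℝ → ℝ) (u : ℝ → ℂ) (x : ℝ) : ℝ :=
  ‖deriv (deriv u) x‖ ^ 2 - hardyRellichConst * (‖u x‖ ^ 2 / x ^ 4) - V x * ‖u x‖ ^ 2

/-- The quadratic form `∫₀^∞ (|u''|² - (9/16) |u|² / x⁴ - V |u|²) dx` on `C₀^∞(0, ∞)`. -/
def energy (V : ℝ → ℝ) (u : 𝓓(halfLine, ℂ)) : ℝ :=
  ∫ x in Ioi (0 : ℝ), energyDensity V u x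

end LiebThirring

end

/-!
Put `w = x ^ (-3/2) u` and `D = x d/dx`. The Hardy–Rellich form `∫ |u''|² - (9/16) |u|² / x⁴`
equals `∫ (|D² w|² + (5/2) |D w|²) dx / x`, so it is the square of a closable operator. In the
variable `log x` it bounds `u` on an interval of length `ℓ`: for `p`, `q` in the outer thirds,
`x ^ (-ν) |u x|²` is at most `C ℓ ^ (3 - ν)` times the sum of the energy of `u` on the interval and
`ℓ⁻³ (|u p|² + |u q|²)`. Averaging over `p` and `q` turns the last term into `6 ℓ⁻⁴ ∫ |u|²`.

Cut the half-line into intervals of lengths `ℓ` with `C ℓ ^ (3 - ν) ∫ V x ^ ν = 1` on each of them.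
The number of intervals with `6 ℓ⁻⁴ > τ` is then at most `C' τ ^ (-(3 - ν) / 4) ∫ V x ^ ν`, and on
the longer ones the energy together with `τ |u|²` absorbs `V |u|²`. So the form is bounded below by
`-τ` up to a correction of rank two per short interval, and by Glazman's lemma the same number
controls the eigenvalues below `-τ`. This also gives the relative form bound and the discreteness
of the negative spectrum.

Finally `tr (H₀ - V)_-^γ = ∫ γ τ ^ (γ - 1) N(-τ) dτ`. For `γ = (3 - ν) / 4` one fixed partition
serves all `τ`, and the integral is a sum over its intervals; for larger `γ` the bound on `N(-τ)` is
applied to `(V - τ / 2)₊` and integrated in `τ`.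
-/

namespace LiebThirring

noncomputable section

/-! ### Symmetric operators and the counting function of their eigenvalues -/

section SymmetricOperator

variable {H : Type*} [NormedAddCommGroup H] [InnerProductSpace ℂ H] {T : H →ₗ.[ℂ] H}

theorem mem_eigenspace_iff {z : ℂ} {u : T.domain} : u ∈ eigenspace T z ↔ T u = z • (u : H) := by
  rw [eigenspace, LinearMap.mem_ker]
  exact sub_eq_zero

theorem inner_sub_smul_eq_of_isFormalAdjoint (hT : T.IsFormalAdjoint T) (s : ℝ) (u v : T.domain) :
    ⟪T u - (s : ℂ) • (u : H), (v : H)⟫_ℂ = ⟪(u : H), T v - (s : ℂ) • (v : H)⟫_ℂ := by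
  rw [inner_sub_left, inner_sub_right, inner_smul_left, inner_smul_right, Complex.conj_ofReal,
    hT u v]

section SelfAdjoint

variable [CompleteSpace H]

theorem dense_domain_of_surjective_sub_smul (hT : T.IsFormalAdjoint T) {s : ℝ}
    (hs : ∀ f : H, ∃ u : T.domain, T u - (s : ℂ) • (u : H) = f) : Dense (T.domain : Set H) := by
  rw [Submodule.dense_iff_topologicalClosure_eq_top, Submodule.topologicalClosure_eq_top_iff,
    Submodule.eq_bot_iff]
  intro y hy
  obtain ⟨u, rfl⟩ := hs y
  have hu : (u : H) = 0 := by
    refine ext_inner_right ℂ fun f => ?_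
    obtain ⟨v, rfl⟩ := hs f
    rw [← inner_sub_smul_eq_of_isFormalAdjoint hT, inner_zero_left, ← inner_conj_symm,
      hy v v.2, map_zero]
  obtain rfl : u = 0 := Subtype.ext hu
  simp

theorem isSelfAdjoint_of_surjective_sub_smul (hT : T.IsFormalAdjoint T) {s : ℝ}
    (hs : ∀ f : H, ∃ u : T.domain, T u - (s : ℂ) • (u : H) = f) : IsSelfAdjoint T := by
  have hdense := dense_domain_of_surjective_sub_smul hT hs
  rw [LinearPMap.isSelfAdjoint_def]
  refine le_antisymm (LinearPMap.le_of_le_graph ?_) (hT.le_adjoint hdense)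
  rintro ⟨y, g⟩ hyg
  obtain ⟨y, rfl, rfl⟩ := (LinearPMap.mem_graph_iff _).1 hyg
  obtain ⟨u, hu⟩ := hs (T.adjoint y - (s : ℂ) • (y : H))
  have huy : (u : H) = y := by
    refine ext_inner_right ℂ fun f => ?_
    obtain ⟨v, rfl⟩ := hs f
    rw [← inner_sub_smul_eq_of_isFormalAdjoint hT, hu, inner_sub_left, inner_sub_right,
      inner_smul_left, inner_smul_right, Complex.conj_ofReal,
      LinearPMap.adjoint_isFormalAdjoint hdense y v]
  rw [huy] at hu
  exact (LinearPMap.mem_graph_iff _).2 ⟨u, huy, sub_left_injective hu⟩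

end SelfAdjoint

theorem orthogonalFamily_eigenspace (hT : T.IsFormalAdjoint T) :
    OrthogonalFamily ℂ (fun r : ℝ => eigenspace T r) fun r => (eigenspace T r).subtypeₗᵢ := by
  intro r s hrs u v
  have huv := inner_sub_smul_eq_of_isFormalAdjoint hT r u v
  rw [mem_eigenspace_iff.1 u.2, mem_eigenspace_iff.1 v.2, sub_self, inner_zero_left, ← sub_smul,
    inner_smul_right, zero_eq_mul, sub_eq_zero, Complex.ofReal_inj] at huv
  exact huv.resolve_left hrs.symm

section FiniteFamily

variable {ι : Type*} [Fintype ι] {r : ι → ℝ}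

theorem norm_sq_sum_eigenspace (hT : T.IsFormalAdjoint T) (hr : Function.Injective r)
    (v : ∀ i, eigenspace T (r i)) : ‖∑ i, (v i : T.domain)‖ ^ 2 = ∑ i, ‖v i‖ ^ 2 :=
  ((orthogonalFamily_eigenspace hT).comp hr).norm_sum v Finset.univ

theorem inner_sum_eigenspace_apply (hT : T.IsFormalAdjoint T) (hr : Function.Injective r)
    (v : ∀ i, eigenspace T (r i)) :
    ⟪((∑ i, (v i : T.domain) : T.domain) : H), T (∑ i, (v i : T.domain))⟫_ℂ
      = ((∑ i, r i * ‖v i‖ ^ 2 : ℝ) : ℂ) := by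
  have hTsum : T (∑ i, (v i : T.domain))
      = ((∑ i, (((r i : ℂ) • v i : eigenspace T (r i)) : T.domain) : T.domain) : H) := by
    rw [← LinearPMap.toFun_eq_coe, map_sum, AddSubmonoidClass.coe_finsetSum]
    exact Finset.sum_congr rfl fun i _ => mem_eigenspace_iff.1 (v i).2
  rw [hTsum, ← Submodule.coe_inner, Complex.ofReal_sum]
  refine (((orthogonalFamily_eigenspace hT).comp hr).inner_sum v (fun i => (r i : ℂ) • v i)
    Finset.univ).trans (Finset.sum_congr rfl fun i _ => ?_)
  refine (inner_smul_right (𝕜 := ℂ) (v i) (v i) _).trans ?_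
  rw [inner_self_eq_norm_sq_to_K]
  simp

-- On a sum of eigenvectors below `-τ` the form is smaller than `-τ‖u‖²`, so such a sum is zero as
-- soon as `ℓ` annihilates it.
theorem injective_comp_sum_eigenspace {F : Type*} [AddCommGroup F] [Module ℂ F] {τ : ℝ}
    (hT : T.IsFormalAdjoint T) {ℓ : T.domain →ₗ[ℂ] F}
    (hℓ : ∀ u, ℓ u = 0 → -τ * ‖u‖ ^ 2 ≤ (⟪(u : H), T u⟫_ℂ).re)
    (hr : Function.Injective r) (hrτ : ∀ i, r i < -τ) :
    Function.Injective
      (ℓ ∘ₗ ∑ i, (eigenspace T (r i)).subtype ∘ₗ LinearMap.proj i) := by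
  rw [injective_iff_map_eq_zero]
  intro v hv
  have hform := hℓ (∑ i, (v i : T.domain)) (by simpa using hv)
  rw [inner_sum_eigenspace_apply hT hr, norm_sq_sum_eigenspace hT hr, Complex.ofReal_re,
    Finset.mul_sum, ← sub_nonneg, ← Finset.sum_sub_distrib] at hform
  simp_rw [← sub_mul] at hform
  have hterm : ∀ i ∈ Finset.univ, (r i - -τ) * ‖v i‖ ^ 2 ≤ 0 := fun i _ =>
    mul_nonpos_of_nonpos_of_nonneg (sub_nonpos.2 (hrτ i).le) (sq_nonneg _)
  have hzero := (Finset.sum_eq_zero_iff_of_nonpos hterm).1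
    (le_antisymm (Finset.sum_nonpos hterm) hform)
  funext i
  simpa using (mul_eq_zero.1 (hzero i (Finset.mem_univ i))).resolve_left (sub_neg.2 (hrτ i)).ne

end FiniteFamily

/-- The multiplicity of `r` as an eigenvalue of `T`; it is `0` if `r` is not an eigenvalue and `∞`
if the eigenspace is infinite-dimensional. -/
def eigenMultiplicity (T : H →ₗ.[ℂ] H) (r : ℝ) : ℝ≥0∞ :=
  (Cardinal.toENat (Module.rank ℂ (eigenspace T r)) : ℝ≥0∞)

/-- The counting function `N(a)`: the number of eigenvalues of `T` below `a`, with multiplicity. -/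
def eigenvalueCount (T : H →ₗ.[ℂ] H) (a : ℝ) : ℝ≥0∞ :=
  ∑' r : Iio a, eigenMultiplicity T r

theorem eigenMultiplicity_eq_finrank {r : ℝ} [FiniteDimensional ℂ (eigenspace T (r : ℂ))] :
    eigenMultiplicity T r = Module.finrank ℂ (eigenspace T (r : ℂ)) := by
  rw [eigenMultiplicity, ← Module.finrank_eq_rank, Cardinal.toENat_nat, ENat.toENNReal_coe]

theorem finiteDimensional_eigenspace_iff {r : ℝ} :
    FiniteDimensional ℂ (eigenspace T (r : ℂ)) ↔ eigenMultiplicity T r ≠ ⊤ := by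
  rw [eigenMultiplicity, Ne, ENat.toENNReal_eq_top, Cardinal.toENat_eq_top, not_le,
    Module.rank_lt_aleph0_iff]

theorem one_le_eigenMultiplicity {r : ℝ} (hr : eigenspace T (r : ℂ) ≠ ⊥) :
    1 ≤ eigenMultiplicity T r := by
  rw [eigenMultiplicity, ← ENat.toENNReal_one, ENat.toENNReal_le, Order.one_le_iff_ne_zero, Ne,
    Cardinal.toENat_eq_zero]
  exact fun h => hr (Submodule.rank_eq_zero.1 h)

/-- Glazman's lemma. -/
theorem eigenvalueCount_le_finrank {F : Type*} [AddCommGroup F] [Module ℂ F]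
    [FiniteDimensional ℂ F] {τ : ℝ} (hT : T.IsFormalAdjoint T) {ℓ : T.domain →ₗ[ℂ] F}
    (hℓ : ∀ u, ℓ u = 0 → -τ * ‖u‖ ^ 2 ≤ (⟪(u : H), T u⟫_ℂ).re) :
    eigenvalueCount T (-τ) ≤ Module.finrank ℂ F := by
  rw [eigenvalueCount, ENNReal.tsum_eq_iSup_sum]
  refine iSup_le fun s => ?_
  have hinj := injective_comp_sum_eigenspace (r := fun i : s => ((i : Iio (-τ)) : ℝ)) hT hℓ
    (Subtype.val_injective.comp Subtype.val_injective) fun i => (i : Iio (-τ)).2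
  have hfin_pi := FiniteDimensional.of_injective _ hinj
  have hfin (i : s) : FiniteDimensional ℂ (eigenspace T (((i : Iio (-τ)) : ℝ) : ℂ)) :=
    Module.Finite.of_surjective (LinearMap.proj (R := ℂ)
      (φ := fun i : s => eigenspace T (((i : Iio (-τ)) : ℝ) : ℂ)) i) (LinearMap.proj_surjective i)
  have hrank := LinearMap.finrank_le_finrank_of_injective hinj
  rw [Module.finrank_pi_fintype] at hrank
  rw [← Finset.sum_coe_sort]
  calc ∑ i : s, eigenMultiplicity T (i : Iio (-τ))
      = ∑ i : s, (Module.finrank ℂ (eigenspace T (((i : Iio (-τ)) : ℝ) : ℂ)) : ℝ≥0∞) :=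
        Finset.sum_congr rfl fun i _ => eigenMultiplicity_eq_finrank
    _ ≤ Module.finrank ℂ F := mod_cast hrank

theorem eigenMultiplicity_le_eigenvalueCount {r a : ℝ} (hr : r < a) :
    eigenMultiplicity T r ≤ eigenvalueCount T a :=
  ENNReal.le_tsum (f := fun r : Iio a => eigenMultiplicity T r) ⟨r, hr⟩

theorem finite_setOf_eigenvalue_lt {a : ℝ} (ha : eigenvalueCount T a ≠ ⊤) :
    {r : ℝ | r < a ∧ eigenspace T (r : ℂ) ≠ ⊥}.Finite := by
  refine ((ENNReal.finite_const_le_of_tsum_ne_top ha one_ne_zero).image Subtype.val).subset ?_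
  exact fun r hr => ⟨⟨r, hr.1⟩, one_le_eigenMultiplicity hr.2, rfl⟩

theorem hasDiscreteNegSpectrum_of_eigenvalueCount_ne_top (hreal : ∀ z ∈ spec T, z.im = 0)
    (heigen : ∀ r : ℝ, r < 0 → (r : ℂ) ∈ spec T → eigenspace T (r : ℂ) ≠ ⊥)
    (hcount : ∀ a < 0, eigenvalueCount T a ≠ ⊤) : HasDiscreteNegSpectrum T := by
  intro r hr hspec
  refine ⟨?_, heigen r hr hspec, finiteDimensional_eigenspace_iff.2 <|
    ne_top_of_le_ne_top (hcount (r / 2) (by linarith))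
      (eigenMultiplicity_le_eigenvalueCount (by linarith))⟩
  have hisolated : Iio (r / 2) ∩ ({s | s < r / 2 ∧ eigenspace T (s : ℂ) ≠ ⊥} \ {r})ᶜ ∈ 𝓝 r :=
    inter_mem (Iio_mem_nhds (by linarith)) <|
      ((finite_setOf_eigenvalue_lt (hcount _ (by linarith))).subset
        sdiff_subset).isClosed.isOpen_compl.mem_nhds (by simp)
  obtain ⟨ε, hε, hball⟩ := Metric.mem_nhds_iff.1 hisolated
  refine ⟨ε, hε, fun z hz hzr => ?_⟩
  lift z to ℝ using hreal z hz
  rw [← Complex.ofReal_sub, Complex.norm_real, ← dist_eq_norm] at hzr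
  obtain ⟨hz_lt : z < r / 2, hz_notMem⟩ := hball hzr
  by_contra hne
  exact hz_notMem ⟨⟨hz_lt, heigen z (by linarith) hz⟩, fun h => hne (congrArg _ h)⟩

end SymmetricOperator

/-! ### The moments of the negative eigenvalues as integrals of the counting function -/

section LayerCake

variable {γ : ℝ}

theorem measurable_ofReal_mul_rpow (c p : ℝ) :
    Measurable fun τ : ℝ => ENNReal.ofReal (c * τ ^ p) :=
  ((measurable_id.pow_const p).const_mul c).ennreal_ofReal

theorem lintegral_Ioo_mul_rpow (hγ : 0 < γ) {R : ℝ} (hR : 0 ≤ R) :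
    ∫⁻ τ in Ioo 0 R, ENNReal.ofReal (γ * τ ^ (γ - 1)) = ENNReal.ofReal (R ^ γ) := by
  rw [restrict_Ioo_eq_restrict_Ioc, ← ofReal_integral_eq_lintegral_ofReal]
  · rw [← intervalIntegral.integral_of_le hR, intervalIntegral.integral_const_mul,
      integral_rpow (Or.inl (by linarith)), sub_add_cancel, Real.zero_rpow hγ.ne', sub_zero,
      mul_div_cancel₀ _ hγ.ne']
  · exact ((intervalIntegrable_iff_integrableOn_Ioc_of_le hR).1
      (intervalIntegral.intervalIntegrable_rpow' (by linarith))).const_mul γ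
  · filter_upwards [ae_restrict_mem measurableSet_Ioc] with τ hτ
    have := hτ.1
    positivity

theorem lintegral_Ioi_mul_rpow_mul_indicator (hγ : 0 < γ) {R : ℝ} (hR : 0 ≤ R) (c : ℝ≥0∞) :
    ∫⁻ τ in Ioi (0 : ℝ), ENNReal.ofReal (γ * τ ^ (γ - 1)) * (Iio R).indicator (fun _ => c) τ
      = c * ENNReal.ofReal (R ^ γ) := by
  have hcongr (τ : ℝ) : ENNReal.ofReal (γ * τ ^ (γ - 1)) * (Iio R).indicator (fun _ => c) τ
      = (Iio R).indicator (fun τ => ENNReal.ofReal (γ * τ ^ (γ - 1)) * c) τ := by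
    rw [indicator_mul_right]
  simp_rw [hcongr]
  rw [lintegral_indicator measurableSet_Iio, Measure.restrict_restrict measurableSet_Iio,
    Iio_inter_Ioi, lintegral_mul_const _ (measurable_ofReal_mul_rpow _ _),
    lintegral_Ioo_mul_rpow hγ hR, mul_comm]

variable {H : Type*} [NormedAddCommGroup H] [InnerProductSpace ℂ H] {T : H →ₗ.[ℂ] H}

theorem sum_indicator_eigenMultiplicity_le (s : Finset {r : ℝ // r < 0}) (τ : ℝ) :
    ∑ r ∈ s, (Iio |(r : ℝ)|).indicator (fun _ => eigenMultiplicity T r) τ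
      ≤ eigenvalueCount T (-τ) := by
  have hindicator (r : {r : ℝ // r < 0}) :
      (Iio |(r : ℝ)|).indicator (fun _ => eigenMultiplicity T r) τ
        = (Iio (-τ)).indicator (eigenMultiplicity T) r := by
    simp only [indicator_apply, mem_Iio, abs_of_neg r.2, lt_neg (a := τ)]
  rw [Finset.sum_congr rfl fun r _ => hindicator r, eigenvalueCount, tsum_subtype (Iio (-τ))]
  exact (ENNReal.sum_le_tsum s).trans
    (ENNReal.tsum_comp_le_tsum_of_injective Subtype.val_injective _)

theorem negTrace_le_lintegral_eigenvalueCount (T : H →ₗ.[ℂ] H) (hγ : 0 < γ) :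
    negTrace T γ
      ≤ ∫⁻ τ in Ioi (0 : ℝ), ENNReal.ofReal (γ * τ ^ (γ - 1)) * eigenvalueCount T (-τ) := by
  rw [negTrace, ENNReal.tsum_eq_iSup_sum]
  refine iSup_le fun s => ?_
  have hmeas := measurable_ofReal_mul_rpow γ (γ - 1)
  calc ∑ r ∈ s, eigenMultiplicity T r * ENNReal.ofReal (|(r : ℝ)| ^ γ)
      = ∑ r ∈ s, ∫⁻ τ in Ioi (0 : ℝ), ENNReal.ofReal (γ * τ ^ (γ - 1)) *
          (Iio |(r : ℝ)|).indicator (fun _ => eigenMultiplicity T r) τ :=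
        Finset.sum_congr rfl fun r _ =>
          (lintegral_Ioi_mul_rpow_mul_indicator hγ (abs_nonneg _) _).symm
    _ = ∫⁻ τ in Ioi (0 : ℝ), ENNReal.ofReal (γ * τ ^ (γ - 1)) *
          ∑ r ∈ s, (Iio |(r : ℝ)|).indicator (fun _ => eigenMultiplicity T r) τ := by
        simp_rw [Finset.mul_sum]
        exact (lintegral_finsetSum _ fun r _ =>
          hmeas.mul (measurable_const.indicator measurableSet_Iio)).symm
    _ ≤ _ := by
        gcongr
        exact sum_indicator_eigenMultiplicity_le s _

end LayerCake

/-! ### Invertibility of coercive operators and of their compact perturbations -/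

section Coercive

variable {G : Type*} [NormedAddCommGroup G] [InnerProductSpace ℂ G] [CompleteSpace G]

theorem isUnit_of_le_norm_inner_add {L : G →L[ℂ] G} {κ a d : ℝ} (hκ : 0 < κ) (ha : 0 ≤ a)
    (hd : 0 < d) (p : G → ℝ) (hcoercive : ∀ x, κ * ‖x‖ ^ 2 ≤ ‖⟪x, L x⟫_ℂ‖ + a * p x)
    (hp : ∀ x, d * p x ≤ ‖⟪x, L x⟫_ℂ‖) : IsUnit L := by
  have hθ : 0 < κ * d / (d + a) := by positivity
  refine ContinuousLinearMap.isUnit_of_forall_le_norm_inner_map L (c := .mk _ hθ.le) hθ fun x => ?_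
  rw [norm_inner_symm, NNReal.coe_mk, ← mul_div_assoc, div_le_iff₀ (by positivity)]
  linarith [mul_le_mul_of_nonneg_left (hcoercive x) hd.le, mul_le_mul_of_nonneg_left (hp x) ha]

theorem isUnit_of_isUnit_add_isCompactOperator {L K : G →L[ℂ] G} (hLK : IsUnit (L + K))
    (hK : IsCompactOperator K) (hL : Function.Injective L) : IsUnit L := by
  obtain ⟨M, hM⟩ := hLK
  have hfactor : L = M * (1 - ↑M⁻¹ * K) := by
    rw [mul_sub, Units.mul_inv_cancel_left, mul_one, hM, add_sub_cancel_right]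
  have hcompact : IsCompactOperator (↑M⁻¹ * K : G →L[ℂ] G) := hK.clm_comp (↑M⁻¹ : G →L[ℂ] G)
  have hone : (1 : ℂ) ∈ _root_.resolventSet ℂ (↑M⁻¹ * K : G →L[ℂ] G) := by
    refine (hcompact.hasEigenvalue_or_mem_resolventSet one_ne_zero).resolve_left fun heigen => ?_
    obtain ⟨x, hx⟩ := heigen.exists_hasEigenvector
    have hx_fixed : (↑M⁻¹ * K : G →L[ℂ] G) x = x := by simpa using hx.apply_eq_smul
    refine hx.2 (hL ?_)
    rw [hfactor, mul_apply_eq_comp, sub_apply, hx_fixed,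
      one_apply_eq_self, sub_self, map_zero, map_zero]
  rw [spectrum.mem_resolventSet_iff, map_one] at hone
  rw [hfactor]
  exact M.isUnit.mul hone

end Coercive

/-! ### The operator of a closed form represented on a Hilbert space of its own -/

/-- A closed semi-bounded Hermitian form in `H`, represented as the pull-back to a Hilbert space `G`
(the form domain with the form norm) along the dense embedding `emb`: the form is
`(emb x, emb y) ↦ ⟪x, gram y⟫`, and Gårding's inequality says that the norm of `G` is a form
norm. -/
structure RepresentedForm (H G : Type*) [NormedAddCommGroup H] [InnerProductSpace ℂ H]
    [NormedAddCommGroup G] [InnerProductSpace ℂ G] [CompleteSpace G] where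
  emb : G →L[ℂ] H
  emb_injective : Function.Injective emb
  denseRange_emb : DenseRange emb
  gram : G →L[ℂ] G
  isSelfAdjoint_gram : IsSelfAdjoint gram
  garding : ∃ κ > 0, ∃ c : ℝ, ∀ x, κ * ‖x‖ ^ 2 ≤ (⟪x, gram x⟫_ℂ).re + c * ‖emb x‖ ^ 2

namespace RepresentedForm

variable {H G : Type*} [NormedAddCommGroup H] [InnerProductSpace ℂ H]
  [NormedAddCommGroup G] [InnerProductSpace ℂ G] [CompleteSpace G] (a : RepresentedForm H G)

theorem inner_gram_comm (x y : G) : ⟪a.gram x, y⟫_ℂ = ⟪x, a.gram y⟫_ℂ :=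
  a.isSelfAdjoint_gram.isSymmetric x y

theorem im_inner_gram_self (x : G) : (⟪x, a.gram x⟫_ℂ).im = 0 := by
  rw [← Complex.conj_eq_iff_im, inner_conj_symm, inner_gram_comm]

theorem tendsto_inner_gram_self {α : Type*} {l : Filter α} {x : α → G}
    (hx : Tendsto x l (𝓝 0)) : Tendsto (fun n => ⟪x n, a.gram (x n)⟫_ℂ) l (𝓝 0) := by
  have hgram := (a.gram.continuous.tendsto 0).comp hx
  simpa only [map_zero, inner_zero_left, Function.comp_apply] using hx.inner (𝕜 := ℂ) hgram

/-- The embedding of `G` as a linear equivalence onto its range. -/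
def embEquiv : G ≃ₗ[ℂ] LinearMap.range a.emb.toLinearMap :=
  LinearEquiv.ofInjective a.emb.toLinearMap a.emb_injective

/-- The form in `H` that is represented: its domain is the range of `emb`. -/
def form : Form H where
  domain := LinearMap.range a.emb.toLinearMap
  sesq := LinearMap.mk₂'ₛₗ (starRingEnd ℂ) (RingHom.id ℂ)
    (fun u v => ⟪a.embEquiv.symm u, a.gram (a.embEquiv.symm v)⟫_ℂ)
    (fun u u' v => by simp)
    (fun c u v => by simp [mul_comm])
    (fun u v v' => by simp)
    (fun c u v => by simp)

/-- `embEquiv` as a map to the form domain. -/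
def toDomain : G ≃ₗ[ℂ] a.form.domain := a.embEquiv

theorem coe_toDomain (x : G) : (a.toDomain x : H) = a.emb x := rfl

theorem sesq_toDomain (x y : G) :
    a.form.sesq (a.toDomain x) (a.toDomain y) = ⟪x, a.gram y⟫_ℂ :=
  congrArg₂ (fun x y => ⟪x, a.gram y⟫_ℂ) (a.embEquiv.symm_apply_apply x)
    (a.embEquiv.symm_apply_apply y)

theorem quad_toDomain (x : G) : a.form.quad (a.toDomain x) = ⟪x, a.gram x⟫_ℂ :=
  a.sesq_toDomain x x

theorem form_isHermitian : a.form.IsHermitian := by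
  intro u v
  obtain ⟨x, rfl⟩ := a.toDomain.surjective u
  obtain ⟨y, rfl⟩ := a.toDomain.surjective v
  rw [sesq_toDomain, sesq_toDomain, inner_conj_symm, inner_gram_comm]

theorem form_isSemibounded : a.form.IsSemibounded := by
  obtain ⟨κ, hκ, c, hc⟩ := a.garding
  refine ⟨-c, fun u => ?_⟩
  obtain ⟨x, rfl⟩ := a.toDomain.surjective u
  rw [quad_toDomain, coe_toDomain]
  have : 0 ≤ κ * ‖x‖ ^ 2 := by positivity
  linarith [hc x]

theorem cauchySeq_of_tendsto {x : ℕ → G} (hemb : CauchySeq fun n => a.emb (x n))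
    (hquad : Tendsto (fun p : ℕ × ℕ => ⟪x p.1 - x p.2, a.gram (x p.1 - x p.2)⟫_ℂ) atTop (𝓝 0)) :
    CauchySeq x := by
  obtain ⟨κ, hκ, c, hc⟩ := a.garding
  have hbound : Tendsto (fun p : ℕ × ℕ => ((⟪x p.1 - x p.2, a.gram (x p.1 - x p.2)⟫_ℂ).re
      + c * ‖a.emb (x p.1 - x p.2)‖ ^ 2) / κ) atTop (𝓝 0) := by
    have hre := (Complex.continuous_re.tendsto _).comp hquad
    have hemb' := cauchySeq_iff_tendsto_dist_atTop_0.1 hemb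
    simp_rw [dist_eq_norm, ← map_sub] at hemb'
    simpa using (hre.add ((hemb'.pow 2).const_mul c)).div_const κ
  have hsq : Tendsto (fun p : ℕ × ℕ => ‖x p.1 - x p.2‖ ^ 2) atTop (𝓝 0) := by
    refine squeeze_zero (fun _ => by positivity) (fun p => ?_) hbound
    rw [le_div_iff₀ hκ, mul_comm]
    exact hc _
  rw [cauchySeq_iff_tendsto_dist_atTop_0]
  simpa [Real.sqrt_sq, dist_eq_norm] using hsq.sqrt

theorem form_isClosed : a.form.IsClosed := by
  intro φ u hφu hφ
  obtain ⟨x, rfl⟩ : ∃ x : ℕ → G, φ = fun n => a.toDomain (x n) :=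
    ⟨fun n => a.toDomain.symm (φ n), by simp⟩
  simp_rw [← map_sub, quad_toDomain] at hφ
  obtain ⟨y, hy⟩ := cauchySeq_tendsto_of_complete (a.cauchySeq_of_tendsto hφu.cauchySeq hφ)
  obtain rfl : a.emb y = u := tendsto_nhds_unique ((a.emb.continuous.tendsto y).comp hy) hφu
  refine ⟨⟨y, rfl⟩, (a.tendsto_inner_gram_self (tendsto_sub_nhds_zero_iff.2 hy)).congr fun n => ?_⟩
  rw [← quad_toDomain, map_sub]
  rfl

variable [CompleteSpace H]

theorem adjoint_emb_injective : Function.Injective a.emb.adjoint := by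
  rw [injective_iff_map_eq_zero]
  intro f hf
  refine a.denseRange_emb.eq_zero_of_inner_left ℂ fun x => ?_
  rw [← ContinuousLinearMap.adjoint_inner_left, hf, inner_zero_left]

/-- The graph of the operator associated with the form: `(emb x, f)` belongs to it if
`⟪y, gram x⟫ = ⟪emb y, f⟫` for all `y`. -/
def opGraph : Submodule ℂ (H × H) where
  carrier := {p | ∃ x, a.emb x = p.1 ∧ a.gram x = a.emb.adjoint p.2}
  add_mem' := by
    rintro ⟨_, f⟩ ⟨_, g⟩ ⟨x, rfl, hx⟩ ⟨y, rfl, hy⟩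
    exact ⟨x + y, by simp, by simp_all⟩
  zero_mem' := ⟨0, by simp, by simp⟩
  smul_mem' := by
    rintro a ⟨_, f⟩ ⟨x, rfl, hx⟩
    exact ⟨a • x, by simp, by simp_all⟩

/-- The operator associated with the form. -/
def op : H →ₗ.[ℂ] H := a.opGraph.toLinearPMap

theorem mem_graph_op_iff {u f : H} :
    (u, f) ∈ a.op.graph ↔ ∃ x, a.emb x = u ∧ a.gram x = a.emb.adjoint f := by
  rw [op, Submodule.toLinearPMap_graph_eq]
  · rfl
  · rintro ⟨u, f⟩ ⟨x, hx, hf⟩ (rfl : u = 0)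
    obtain rfl : x = 0 := a.emb_injective (by simpa using hx)
    exact a.adjoint_emb_injective (by simpa using hf.symm)

theorem op_isAssociated : IsAssociated a.op a.form := by
  intro u f
  rw [mem_graph_op_iff]
  constructor
  · rintro ⟨x, rfl, hx⟩
    refine ⟨⟨x, rfl⟩, fun v => ?_⟩
    obtain ⟨y, rfl⟩ := a.toDomain.surjective v
    rw [coe_toDomain, ← ContinuousLinearMap.adjoint_inner_right, ← hx]
    exact a.sesq_toDomain y x
  · rintro ⟨⟨x, rfl⟩, hf⟩
    refine ⟨x, rfl, ext_inner_left ℂ fun y => ?_⟩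
    rw [ContinuousLinearMap.adjoint_inner_right, ← sesq_toDomain]
    exact hf (a.toDomain y)

/-- The element of `G` that represents an element of the operator domain. -/
def lift : a.op.domain →ₗ[ℂ] G :=
  a.embEquiv.symm.toLinearMap ∘ₗ Submodule.inclusion fun u hu => by
    obtain ⟨x, hx, -⟩ := a.mem_graph_op_iff.1 (a.op.mem_graph ⟨u, hu⟩)
    exact ⟨x, hx⟩

theorem emb_lift (u : a.op.domain) : a.emb (a.lift u) = u :=
  congrArg Subtype.val (a.embEquiv.apply_symm_apply (Submodule.inclusion _ u))

theorem gram_lift (u : a.op.domain) : a.gram (a.lift u) = a.emb.adjoint (a.op u) := by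
  obtain ⟨x, hx, hgram⟩ := a.mem_graph_op_iff.1 (a.op.mem_graph u)
  rwa [a.emb_injective (hx.trans (a.emb_lift u).symm)] at hgram

theorem exists_op_eq {x : G} {f : H} (h : a.gram x = a.emb.adjoint f) :
    ∃ hx : a.emb x ∈ a.op.domain, a.op ⟨a.emb x, hx⟩ = f := by
  have hgraph := a.mem_graph_op_iff.2 ⟨x, rfl, h⟩
  have hdom := LinearPMap.mem_domain_of_mem_graph hgraph
  exact ⟨hdom, ((LinearPMap.image_iff hdom).2 hgraph).symm⟩

theorem inner_op (u v : a.op.domain) :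
    ⟪(u : H), a.op v⟫_ℂ = ⟪a.lift u, a.gram (a.lift v)⟫_ℂ := by
  rw [gram_lift, ContinuousLinearMap.adjoint_inner_right, emb_lift]

theorem op_isFormalAdjoint : a.op.IsFormalAdjoint a.op := fun u v => by
  rw [inner_op, ← inner_conj_symm, inner_op, inner_conj_symm, inner_gram_comm]

/-- The operator pencil that represents `op - z` on `G`. -/
def pencil (z : ℂ) : G →L[ℂ] G := a.gram - z • (a.emb.adjoint ∘L a.emb)

theorem pencil_apply (z : ℂ) (x : G) :
    a.pencil z x = a.gram x - a.emb.adjoint (z • a.emb x) := by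
  rw [map_smul]
  rfl

theorem inner_pencil_self (z : ℂ) (x : G) :
    ⟪x, a.pencil z x⟫_ℂ = ⟪x, a.gram x⟫_ℂ - z * (‖a.emb x‖ ^ 2 : ℝ) := by
  rw [pencil_apply, inner_sub_right, ContinuousLinearMap.adjoint_inner_right, inner_smul_right,
    inner_self_eq_norm_sq_to_K]
  norm_cast

theorem re_inner_pencil_self (z : ℂ) (x : G) :
    (⟪x, a.pencil z x⟫_ℂ).re = (⟪x, a.gram x⟫_ℂ).re - z.re * ‖a.emb x‖ ^ 2 := by
  rw [inner_pencil_self, Complex.sub_re, Complex.re_mul_ofReal]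

theorem mem_resolventSet_of_isUnit_pencil {z : ℂ} (hz : IsUnit (a.pencil z)) :
    z ∈ resolventSet a.op := by
  obtain ⟨L, hL⟩ := hz
  refine ⟨a.emb ∘L (↑L⁻¹ : G →L[ℂ] G) ∘L a.emb.adjoint, fun f => ?_, fun u => ?_⟩
  · have hsolve : a.pencil z ((↑L⁻¹ : G →L[ℂ] G) (a.emb.adjoint f)) = a.emb.adjoint f := by
      rw [← hL, ← mul_apply_eq_comp, Units.mul_inv, one_apply_eq_self]
    rw [pencil_apply, sub_eq_iff_eq_add, ← map_add] at hsolve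
    obtain ⟨hdom, hop⟩ := a.exists_op_eq hsolve
    exact ⟨hdom, sub_eq_iff_eq_add.2 hop⟩
  · have hlift : a.emb.adjoint (a.op u - z • (u : H)) = (L : G →L[ℂ] G) (a.lift u) := by
      rw [hL, pencil_apply, gram_lift, emb_lift, map_sub]
    rw [ContinuousLinearMap.comp_apply, ContinuousLinearMap.comp_apply, hlift,
      ← mul_apply_eq_comp, Units.inv_mul, one_apply_eq_self, emb_lift]

theorem exists_isUnit_pencil_ofReal : ∃ s : ℝ, IsUnit (a.pencil s) := by
  obtain ⟨κ, hκ, c, hc⟩ := a.garding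
  refine ⟨-c, isUnit_of_le_norm_inner_add hκ le_rfl one_pos 0 (fun x => ?_) fun x => by simp⟩
  have hre := (a.re_inner_pencil_self (-c : ℝ) x).symm.trans_le (Complex.re_le_norm _)
  rw [Complex.ofReal_re] at hre
  linarith [hc x]

theorem op_isSelfAdjoint : IsSelfAdjoint a.op := by
  obtain ⟨s, hs⟩ := a.exists_isUnit_pencil_ofReal
  obtain ⟨R, hR, -⟩ := a.mem_resolventSet_of_isUnit_pencil hs
  exact isSelfAdjoint_of_surjective_sub_smul a.op_isFormalAdjoint fun f =>
    let ⟨hf, hfR⟩ := hR f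
    ⟨⟨R f, hf⟩, hfR⟩

theorem isUnit_pencil_of_im_ne_zero {z : ℂ} (hz : z.im ≠ 0) : IsUnit (a.pencil z) := by
  obtain ⟨κ, hκ, c, hc⟩ := a.garding
  refine isUnit_of_le_norm_inner_add hκ (abs_nonneg (c + z.re)) (abs_pos.2 hz)
    (fun x => ‖a.emb x‖ ^ 2) (fun x => ?_) fun x => ?_
  · have hre := (a.re_inner_pencil_self z x).symm.trans_le (Complex.re_le_norm _)
    linarith [hc x, mul_le_mul_of_nonneg_right (le_abs_self (c + z.re)) (sq_nonneg ‖a.emb x‖)]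
  · refine le_trans (le_of_eq ?_) (Complex.abs_im_le_norm _)
    rw [inner_pencil_self, Complex.sub_im, im_inner_gram_self, Complex.im_mul_ofReal, zero_sub,
      abs_neg, abs_mul, abs_of_nonneg (sq_nonneg ‖a.emb x‖)]

theorem im_eq_zero_of_mem_spec {z : ℂ} (hz : z ∈ spec a.op) : z.im = 0 := by
  contrapose! hz
  exact not_not.2 (a.mem_resolventSet_of_isUnit_pencil (a.isUnit_pencil_of_im_ne_zero hz))

theorem eigenspace_op_ne_bot {z : ℂ} {x : G} (hx : x ≠ 0) (hpencil : a.pencil z x = 0) :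
    eigenspace a.op z ≠ ⊥ := by
  rw [pencil_apply, sub_eq_zero] at hpencil
  obtain ⟨hdom, hop⟩ := a.exists_op_eq hpencil
  rw [Submodule.ne_bot_iff]
  refine ⟨⟨a.emb x, hdom⟩, mem_eigenspace_iff.2 hop, fun h0 => hx (a.emb_injective ?_)⟩
  simpa using congrArg Subtype.val h0

/-- The form is bounded below by `-τ` after a correction of rank at most `n`. -/
def BoundedBelowUpToRank (τ : ℝ) (n : ℕ) : Prop :=
  ∃ Λ : G →L[ℂ] EuclideanSpace ℂ (Fin n),
    ∀ x, 0 ≤ (⟪x, a.gram x⟫_ℂ).re + τ * ‖a.emb x‖ ^ 2 + ‖Λ x‖ ^ 2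

variable {a} {τ : ℝ} {n : ℕ}

theorem isUnit_pencil_add_of_lt {Λ : G →L[ℂ] EuclideanSpace ℂ (Fin n)}
    (hΛ : ∀ x, 0 ≤ (⟪x, a.gram x⟫_ℂ).re + τ * ‖a.emb x‖ ^ 2 + ‖Λ x‖ ^ 2) {r : ℝ} (hr : r < -τ) :
    IsUnit (a.pencil r + Λ.adjoint ∘L Λ) := by
  obtain ⟨κ, hκ, c, hc⟩ := a.garding
  have hre (x : G) : (⟪x, a.gram x⟫_ℂ).re - r * ‖a.emb x‖ ^ 2 + ‖Λ x‖ ^ 2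
      ≤ ‖⟪x, (a.pencil r + Λ.adjoint ∘L Λ) x⟫_ℂ‖ := by
    refine le_trans (le_of_eq ?_) (Complex.re_le_norm _)
    rw [add_apply, inner_add_right, Complex.add_re, re_inner_pencil_self,
      ContinuousLinearMap.comp_apply, ContinuousLinearMap.adjoint_inner_right, Complex.ofReal_re,
      inner_self_eq_norm_sq_to_K]
    norm_cast
  refine isUnit_of_le_norm_inner_add hκ (abs_nonneg (c + r)) (d := -r - τ) (by linarith)
    (fun x => ‖a.emb x‖ ^ 2) (fun x => ?_) fun x => ?_
  · linarith [hre x, hc x, sq_nonneg ‖Λ x‖,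
      mul_le_mul_of_nonneg_right (le_abs_self (c + r)) (sq_nonneg ‖a.emb x‖)]
  · linarith [hre x, hΛ x]

theorem BoundedBelowUpToRank.eigenspace_ne_bot (h : a.BoundedBelowUpToRank τ n) {r : ℝ}
    (hr : r < -τ) (hspec : (r : ℂ) ∈ spec a.op) : eigenspace a.op (r : ℂ) ≠ ⊥ := by
  obtain ⟨Λ, hΛ⟩ := h
  have hcompact : IsCompactOperator (Λ.adjoint ∘L Λ) :=
    (isCompactOperator_of_locallyCompactSpace_dom Λ).clm_comp Λ.adjoint
  contrapose! hspec
  refine not_not.2 (a.mem_resolventSet_of_isUnit_pencil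
    (isUnit_of_isUnit_add_isCompactOperator (isUnit_pencil_add_of_lt hΛ hr) hcompact ?_))
  rw [injective_iff_map_eq_zero]
  intro x hx
  by_contra hx0
  exact a.eigenspace_op_ne_bot hx0 hx hspec

theorem BoundedBelowUpToRank.eigenvalueCount_le (h : a.BoundedBelowUpToRank τ n) :
    eigenvalueCount a.op (-τ) ≤ n := by
  obtain ⟨Λ, hΛ⟩ := h
  have hcount := eigenvalueCount_le_finrank a.op_isFormalAdjoint (ℓ := Λ.toLinearMap ∘ₗ a.lift)
    (τ := τ) fun u hu => ?_
  · simpa using hcount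
  · have hΛu : Λ (a.lift u) = 0 := hu
    have := hΛ (a.lift u)
    rw [hΛu, norm_zero, zero_pow two_ne_zero, add_zero, emb_lift] at this
    rw [inner_op, Submodule.coe_norm]
    linarith

theorem op_hasDiscreteNegSpectrum (h : ∀ τ > 0, ∃ n, a.BoundedBelowUpToRank τ n) :
    HasDiscreteNegSpectrum a.op := by
  refine hasDiscreteNegSpectrum_of_eigenvalueCount_ne_top (fun z => a.im_eq_zero_of_mem_spec)
    (fun r hr hspec => ?_) fun s hs => ?_
  · obtain ⟨n, hn⟩ := h (-r / 2) (by linarith)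
    exact hn.eigenspace_ne_bot (by linarith) hspec
  · obtain ⟨n, hn⟩ := h (-s) (by linarith)
    have hcount := hn.eigenvalueCount_le
    rw [neg_neg] at hcount
    exact ne_top_of_le_ne_top (ENNReal.natCast_ne_top n) hcount

end RepresentedForm

/-! ### The closure of a form `‖A u‖² - ‖B u‖²` -/

section GraphSpace

variable {E H K F : Type*} [NormedAddCommGroup H] [InnerProductSpace ℂ H]
  [NormedAddCommGroup K] [InnerProductSpace ℂ K] [NormedAddCommGroup F] [NormedSpace ℂ F]
  [AddCommGroup E] [Module ℂ E]

/-- The map `u ↦ (j u, A u)`. -/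
def graphMap (j : E →ₗ[ℂ] H) (A : E →ₗ[ℂ] K) : E →ₗ[ℂ] WithLp 2 (H × K) :=
  (WithLp.linearEquiv 2 ℂ (H × K)).symm.toLinearMap ∘ₗ (j.prod A)

/-- The closure of the graph of `j u ↦ A u`. -/
abbrev GraphSpace (j : E →ₗ[ℂ] H) (A : E →ₗ[ℂ] K) : Submodule ℂ (WithLp 2 (H × K)) :=
  (LinearMap.range (graphMap j A)).topologicalClosure

/-- The map `u ↦ (j u, A u)` into the closed graph. -/
def toGraphSpace (j : E →ₗ[ℂ] H) (A : E →ₗ[ℂ] K) : E →ₗ[ℂ] GraphSpace j A :=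
  (graphMap j A).codRestrict _ fun u => Submodule.le_topologicalClosure _ ⟨u, rfl⟩

/-- The first coordinate on the closed graph, the continuous extension of `j`. -/
def graphFst (j : E →ₗ[ℂ] H) (A : E →ₗ[ℂ] K) : GraphSpace j A →L[ℂ] H :=
  WithLp.fstL 2 ℂ H K ∘L (GraphSpace j A).subtypeL

/-- The second coordinate on the closed graph, the continuous extension of `A`. -/
def graphSnd (j : E →ₗ[ℂ] H) (A : E →ₗ[ℂ] K) : GraphSpace j A →L[ℂ] K :=
  WithLp.sndL 2 ℂ H K ∘L (GraphSpace j A).subtypeL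

variable {j : E →ₗ[ℂ] H} {A : E →ₗ[ℂ] K}

theorem graphFst_toGraphSpace (u : E) : graphFst j A (toGraphSpace j A u) = j u := rfl

theorem graphSnd_toGraphSpace (u : E) : graphSnd j A (toGraphSpace j A u) = A u := rfl

theorem norm_sq_graphSpace (x : GraphSpace j A) :
    ‖x‖ ^ 2 = ‖graphFst j A x‖ ^ 2 + ‖graphSnd j A x‖ ^ 2 :=
  WithLp.prod_norm_sq_eq_of_L2 (x : WithLp 2 (H × K))

theorem denseRange_toGraphSpace : DenseRange (toGraphSpace j A) := by
  rw [DenseRange, Subtype.dense_iff]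
  intro x hx
  refine closure_mono ?_ (show x ∈ closure (LinearMap.range (graphMap j A) : Set _) from hx)
  rintro _ ⟨u, rfl⟩
  exact ⟨toGraphSpace j A u, ⟨u, rfl⟩, rfl⟩

theorem exists_tendsto_toGraphSpace (x : GraphSpace j A) :
    ∃ φ : ℕ → E, Tendsto (fun n => toGraphSpace j A (φ n)) atTop (𝓝 x) := by
  obtain ⟨y, hy, hlim⟩ := mem_closure_iff_seq_limit.1 (denseRange_toGraphSpace x)
  choose φ hφ using hy
  exact ⟨φ, by simpa only [hφ] using hlim⟩

theorem exists_norm_le_mul_norm_toGraphSpace {f : E →ₗ[ℂ] F} {C : ℝ}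
    (hf : ∀ u, ‖f u‖ ^ 2 ≤ C * (‖j u‖ ^ 2 + ‖A u‖ ^ 2)) :
    ∃ C, ∀ u, ‖f u‖ ≤ C * ‖toGraphSpace j A u‖ := by
  refine ⟨√|C|, fun u => le_of_sq_le_sq ?_ (by positivity)⟩
  rw [mul_pow, Real.sq_sqrt (abs_nonneg C), norm_sq_graphSpace]
  exact (hf u).trans (mul_le_mul_of_nonneg_right (le_abs_self C) (by positivity))

theorem extendOfNorm_toGraphSpace [CompleteSpace F] {f : E →ₗ[ℂ] F} {C : ℝ}
    (hf : ∀ u, ‖f u‖ ^ 2 ≤ C * (‖j u‖ ^ 2 + ‖A u‖ ^ 2)) (u : E) :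
    f.extendOfNorm (toGraphSpace j A) (toGraphSpace j A u) = f u := by
  have hbound := exists_norm_le_mul_norm_toGraphSpace hf
  have hdense : DenseRange (toGraphSpace j A) := denseRange_toGraphSpace
  generalize toGraphSpace j A = e at hbound hdense ⊢
  exact LinearMap.extendOfNorm_eq hdense hbound u

theorem isSelfAdjoint_adjoint_comp_sub {G L M : Type*} [NormedAddCommGroup G]
    [InnerProductSpace ℂ G] [NormedAddCommGroup L] [InnerProductSpace ℂ L]
    [NormedAddCommGroup M] [InnerProductSpace ℂ M]
    [CompleteSpace G] [CompleteSpace L] [CompleteSpace M] (S : G →L[ℂ] L) (R : G →L[ℂ] M) :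
    IsSelfAdjoint (S.adjoint ∘L S - R.adjoint ∘L R) := by
  rw [ContinuousLinearMap.isSelfAdjoint_iff']
  simp [map_sub, ContinuousLinearMap.adjoint_comp]

end GraphSpace

theorem norm_sq_sqrt_mul {v : ℝ} (hv : 0 ≤ v) (z : ℂ) : ‖(√v : ℂ) * z‖ ^ 2 = v * ‖z‖ ^ 2 := by
  rw [norm_mul, mul_pow, Complex.norm_real, Real.norm_eq_abs, sq_abs, Real.sq_sqrt hv]

/-- The assumptions under which the form `j u ↦ ‖A u‖² - ‖B u‖²` has a closure: `j u ↦ A u` is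
densely defined and closable, and `B` is a form perturbation of relative bound less than one. -/
structure IsFormPerturbation {E H K K' : Type*} [NormedAddCommGroup H] [InnerProductSpace ℂ H]
    [NormedAddCommGroup K] [InnerProductSpace ℂ K] [NormedAddCommGroup K'] [InnerProductSpace ℂ K']
    [AddCommGroup E] [Module ℂ E] (j : E →ₗ[ℂ] H) (A : E →ₗ[ℂ] K) (B : E →ₗ[ℂ] K') : Prop where
  denseRange : DenseRange j
  closable : ∀ (φ : ℕ → E) (f : K), Tendsto (fun n => j (φ n)) atTop (𝓝 0) →
    Tendsto (fun n => A (φ n)) atTop (𝓝 f) → f = 0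
  relative_bound : ∃ θ < 1, ∃ c, ∀ u, ‖B u‖ ^ 2 ≤ θ * ‖A u‖ ^ 2 + c * ‖j u‖ ^ 2

namespace IsFormPerturbation

variable {E H K K' : Type*} [NormedAddCommGroup H] [InnerProductSpace ℂ H]
  [NormedAddCommGroup K] [InnerProductSpace ℂ K] [NormedAddCommGroup K'] [InnerProductSpace ℂ K']
  [AddCommGroup E] [Module ℂ E] {j : E →ₗ[ℂ] H} {A : E →ₗ[ℂ] K} {B : E →ₗ[ℂ] K'}

theorem graphFst_injective (h : IsFormPerturbation j A B) :
    Function.Injective (graphFst j A) := by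
  rw [injective_iff_map_eq_zero]
  intro x hx
  obtain ⟨φ, hφ⟩ := exists_tendsto_toGraphSpace x
  have hfst := ((graphFst j A).continuous.tendsto x).comp hφ
  rw [hx] at hfst
  have hsnd : graphSnd j A x = 0 :=
    h.closable φ _ hfst (((graphSnd j A).continuous.tendsto x).comp hφ)
  simpa [hx, hsnd] using norm_sq_graphSpace x

variable [CompleteSpace K']

theorem extendOfNorm_eq (h : IsFormPerturbation j A B) (u : E) :
    B.extendOfNorm (toGraphSpace j A) (toGraphSpace j A u) = B u := by
  obtain ⟨θ, hθ, c, hB⟩ := h.relative_bound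
  refine extendOfNorm_toGraphSpace (C := 1 + |c|) (fun u => (hB u).trans ?_) u
  have hA : 0 ≤ (1 - θ + |c|) * ‖A u‖ ^ 2 :=
    mul_nonneg (by linarith [abs_nonneg c]) (by positivity)
  have hj : 0 ≤ (1 + |c| - c) * ‖j u‖ ^ 2 :=
    mul_nonneg (by linarith [le_abs_self c]) (by positivity)
  linarith

theorem norm_sq_extendOfNorm_le (h : IsFormPerturbation j A B) {θ c : ℝ}
    (hB : ∀ u, ‖B u‖ ^ 2 ≤ θ * ‖A u‖ ^ 2 + c * ‖j u‖ ^ 2) (x : GraphSpace j A) :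
    ‖B.extendOfNorm (toGraphSpace j A) x‖ ^ 2
      ≤ θ * ‖graphSnd j A x‖ ^ 2 + c * ‖graphFst j A x‖ ^ 2 := by
  induction x using denseRange_toGraphSpace.induction_on with
  | hp => exact isClosed_le (by fun_prop) (by fun_prop)
  | ih u =>
    rw [h.extendOfNorm_eq, graphSnd_toGraphSpace, graphFst_toGraphSpace]
    exact hB u

variable [CompleteSpace K]

theorem inner_adjoint_comp_sub_self {G : Type*} [NormedAddCommGroup G] [InnerProductSpace ℂ G]
    [CompleteSpace G] (S : G →L[ℂ] K) (R : G →L[ℂ] K') (x : G) :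
    ⟪x, (S.adjoint ∘L S - R.adjoint ∘L R) x⟫_ℂ = ((‖S x‖ ^ 2 - ‖R x‖ ^ 2 : ℝ) : ℂ) := by
  rw [sub_apply, inner_sub_right, ContinuousLinearMap.comp_apply, ContinuousLinearMap.comp_apply,
    ContinuousLinearMap.adjoint_inner_right, ContinuousLinearMap.adjoint_inner_right,
    inner_self_eq_norm_sq_to_K, inner_self_eq_norm_sq_to_K]
  norm_cast

variable [CompleteSpace H]

/-- The closure of the form `j u ↦ ‖A u‖² - ‖B u‖²`, represented on the closed graph of
`j u ↦ A u`. -/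
def closure (h : IsFormPerturbation j A B) : RepresentedForm H (GraphSpace j A) where
  emb := graphFst j A
  emb_injective := h.graphFst_injective
  denseRange_emb := h.denseRange.mono (by rintro _ ⟨u, rfl⟩; exact ⟨toGraphSpace j A u, rfl⟩)
  gram := (graphSnd j A).adjoint ∘L graphSnd j A -
    (B.extendOfNorm (toGraphSpace j A)).adjoint ∘L B.extendOfNorm (toGraphSpace j A)
  isSelfAdjoint_gram := isSelfAdjoint_adjoint_comp_sub _ _
  garding := by
    obtain ⟨θ, hθ, c, hB⟩ := h.relative_bound
    refine ⟨1 - θ, sub_pos.2 hθ, c + (1 - θ), fun x => ?_⟩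
    rw [inner_adjoint_comp_sub_self, Complex.ofReal_re, norm_sq_graphSpace]
    linarith [h.norm_sq_extendOfNorm_le hB x]

theorem inner_closure_gram_self (h : IsFormPerturbation j A B) (x : GraphSpace j A) :
    ⟪x, h.closure.gram x⟫_ℂ
      = ((‖graphSnd j A x‖ ^ 2 - ‖B.extendOfNorm (toGraphSpace j A) x‖ ^ 2 : ℝ) : ℂ) :=
  inner_adjoint_comp_sub_self _ _ x

theorem isClosureOf (h : IsFormPerturbation j A B) :
    h.closure.form.IsClosureOf j fun u => ‖A u‖ ^ 2 - ‖B u‖ ^ 2 where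
  hermitian := h.closure.form_isHermitian
  semibounded := h.closure.form_isSemibounded
  closed := h.closure.form_isClosed
  extends_core u := by
    refine ⟨⟨toGraphSpace j A u, rfl⟩, (h.closure.quad_toDomain (toGraphSpace j A u)).trans ?_⟩
    rw [inner_closure_gram_self, h.extendOfNorm_eq, graphSnd_toGraphSpace]
  core_dense v := by
    obtain ⟨x, rfl⟩ := h.closure.toDomain.surjective v
    obtain ⟨φ, hφ⟩ := exists_tendsto_toGraphSpace x
    refine ⟨φ, fun n => ⟨toGraphSpace j A (φ n), rfl⟩,
      ((graphFst j A).continuous.tendsto x).comp hφ,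
      (h.closure.tendsto_inner_gram_self (tendsto_sub_nhds_zero_iff.2 hφ)).congr fun n => ?_⟩
    rw [← RepresentedForm.quad_toDomain, map_sub]
    rfl

theorem boundedBelowUpToRank_closure (h : IsFormPerturbation j A B) {τ C : ℝ} {n : ℕ}
    {ℓ : E →ₗ[ℂ] EuclideanSpace ℂ (Fin n)}
    (hℓ : ∀ u, ‖ℓ u‖ ^ 2 ≤ C * (‖j u‖ ^ 2 + ‖A u‖ ^ 2))
    (hbound : ∀ u, ‖B u‖ ^ 2 ≤ ‖A u‖ ^ 2 + τ * ‖j u‖ ^ 2 + ‖ℓ u‖ ^ 2) :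
    h.closure.BoundedBelowUpToRank τ n := by
  refine ⟨ℓ.extendOfNorm (toGraphSpace j A), fun x => ?_⟩
  rw [inner_closure_gram_self, Complex.ofReal_re]
  change 0 ≤ _ + τ * ‖graphFst j A x‖ ^ 2 + _
  induction x using denseRange_toGraphSpace.induction_on with
  | hp => exact isClosed_le (by fun_prop) (by fun_prop)
  | ih u =>
    rw [h.extendOfNorm_eq, graphSnd_toGraphSpace, graphFst_toGraphSpace,
      extendOfNorm_toGraphSpace hℓ]
    linarith [hbound u]

theorem boundedBelowUpToRank_closure_of_weighted_sum (h : IsFormPerturbation j A B) {τ : ℝ}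
    {ι : Type*} [Fintype ι] (ℓ : ι → E →ₗ[ℂ] ℂ) {c : ι → ℝ} (hc : ∀ i, 0 ≤ c i)
    (hℓ : ∀ i, ∃ C, ∀ u, ‖ℓ i u‖ ^ 2 ≤ C * (‖j u‖ ^ 2 + ‖A u‖ ^ 2))
    (hbound : ∀ u, ‖B u‖ ^ 2 ≤ ‖A u‖ ^ 2 + τ * ‖j u‖ ^ 2 + ∑ i, c i * ‖ℓ i u‖ ^ 2) :
    h.closure.BoundedBelowUpToRank τ (Fintype.card ι) := by
  let e := Fintype.equivFin ι
  let L : E →ₗ[ℂ] EuclideanSpace ℂ (Fin (Fintype.card ι)) :=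
    (WithLp.linearEquiv 2 ℂ (Fin (Fintype.card ι) → ℂ)).symm.toLinearMap ∘ₗ
      LinearMap.pi fun i => (√(c (e.symm i)) : ℂ) • ℓ (e.symm i)
  have norm_sq_L (u : E) : ‖L u‖ ^ 2 = ∑ i, c i * ‖ℓ i u‖ ^ 2 := by
    rw [EuclideanSpace.norm_sq_eq, ← Equiv.sum_comp e.symm]
    exact Finset.sum_congr rfl fun i _ => norm_sq_sqrt_mul (hc _) _
  choose C hC using hℓ
  refine h.boundedBelowUpToRank_closure (ℓ := L) (C := ∑ i, c i * C i) (fun u => ?_) fun u => ?_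
  · rw [norm_sq_L, Finset.sum_mul]
    refine Finset.sum_le_sum fun i _ => ?_
    rw [mul_assoc]
    exact mul_le_mul_of_nonneg_left (hC i u) (hc i)
  · rw [norm_sq_L]
    exact hbound u

end IsFormPerturbation

/-! ### Test functions on the half-line -/

theorem integral_Ioi_deriv_eq_zero_of_isCompact {F : Type*} [NormedAddCommGroup F]
    [NormedSpace ℝ F] [CompleteSpace F] {a : ℝ} {G G' : ℝ → F} {S : Set ℝ} (hS : IsCompact S)
    (hSa : S ⊆ Ioi a) (hG : ∀ x ∉ S, G x = 0) (hderiv : ∀ x ∈ Ioi a, HasDerivAt G (G' x) x)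
    (hint : IntegrableOn G' (Ioi a)) : ∫ x in Ioi a, G' x = 0 := by
  have ha : a ∉ S := fun h => lt_irrefl a (hSa h)
  have hcont : ContinuousAt G a := by
    refine ContinuousAt.congr (f := fun _ => 0) continuousAt_const ?_
    filter_upwards [hS.isClosed.isOpen_compl.mem_nhds ha] with x hx using (hG x hx).symm
  have htop : Tendsto G atTop (𝓝 0) := by
    refine tendsto_const_nhds.congr' ?_
    filter_upwards [atTop_le_cocompact hS.compl_mem_cocompact] with x hx using (hG x hx).symm
  rw [integral_Ioi_of_hasDerivAt_of_tendsto hcont.continuousWithinAt hderiv hint htop, hG a ha,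
    sub_zero]

theorem continuous_smul_of_tsupport_subset {F : Type*} [NormedAddCommGroup F] [NormedSpace ℝ F]
    {U : Set ℝ} (hU : IsOpen U) {c : ℝ → ℝ} (hc : ContinuousOn c U) {g : ℝ → F}
    (hg : Continuous g) (hs : tsupport g ⊆ U) : Continuous fun x => c x • g x := by
  refine continuous_of_tsupport fun x hx => ?_
  have hxU : x ∈ U := hs (tsupport_smul_subset_right c g hx)
  exact (hc.continuousAt (hU.mem_nhds hxU)).smul hg.continuousAt

/-- The derivative as an operator on `C₀^∞(0, ∞)`. -/
def testDeriv : 𝓓(halfLine, ℂ) →ₗ[ℂ] 𝓓(halfLine, ℂ) where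
  toFun u := ⟨deriv u, (contDiff_infty_iff_deriv.1 u.contDiff).2, u.hasCompactSupport.deriv,
    (tsupport_deriv_subset (𝕜 := ℝ)).trans u.tsupport_subset⟩
  map_add' u v := by
    ext x
    exact deriv_add (contDiff_infty_iff_deriv.1 u.contDiff).1.differentiableAt
      (contDiff_infty_iff_deriv.1 v.contDiff).1.differentiableAt
  map_smul' c u := by
    ext x
    exact deriv_const_smul c (contDiff_infty_iff_deriv.1 u.contDiff).1.differentiableAt

section TestFunctions

variable (u : 𝓓(halfLine, ℂ))

theorem coe_testDeriv : ⇑(testDeriv u) = deriv u := rfl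

theorem hasDerivAt_test (x : ℝ) : HasDerivAt u (testDeriv u x) x :=
  ((contDiff_infty_iff_deriv.1 u.contDiff).1 x).hasDerivAt

theorem continuous_div_pow_smul_test (c : ℝ) (n : ℕ) : Continuous fun x => (c / x ^ n) • u x :=
  continuous_smul_of_tsupport_subset isOpen_Ioi
    (continuousOn_const.div (continuousOn_id.pow n) fun _ hx => pow_ne_zero n (ne_of_gt hx))
    u.continuous u.tsupport_subset

variable {u} in
theorem test_eq_zero {x : ℝ} (hx : x ∉ tsupport u) : u x = 0 := image_eq_zero_of_notMem_tsupport hx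

variable {u} in
theorem testDeriv_eq_zero {x : ℝ} (hx : x ∉ tsupport u) : testDeriv u x = 0 :=
  test_eq_zero fun h => hx (tsupport_deriv_subset (𝕜 := ℝ) h)

end TestFunctions

section LpMap

variable {α : Type*} [MeasurableSpace α] {μ : Measure α}

/-- A linear operator with values in functions, seen as an operator into `L^p`. -/
def lpMap {E : Type*} [AddCommGroup E] [Module ℂ E] {p : ℝ≥0∞} (D : E →ₗ[ℂ] α → ℂ)
    (hD : ∀ u, MemLp (D u) p μ) : E →ₗ[ℂ] Lp ℂ p μ where
  toFun u := (hD u).toLp (D u)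
  map_add' u v := by
    rw [← MemLp.toLp_add]
    exact MemLp.toLp_congr _ _ (by rw [map_add])
  map_smul' c u := by
    rw [RingHom.id_apply, ← MemLp.toLp_const_smul]
    exact MemLp.toLp_congr _ _ (by rw [map_smul])

theorem inner_toLp {f g : α → ℂ} (hf : MemLp f 2 μ) (hg : MemLp g 2 μ) :
    ⟪hf.toLp f, hg.toLp g⟫_ℂ = ∫ x, starRingEnd ℂ (f x) * g x ∂μ := by
  rw [L2.inner_def]
  refine integral_congr_ae ?_
  filter_upwards [hf.coeFn_toLp, hg.coeFn_toLp] with x hfx hgx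
  rw [hfx, hgx, RCLike.inner_apply, mul_comm]

theorem norm_sq_toLp {f : α → ℂ} (hf : MemLp f 2 μ) : ‖hf.toLp f‖ ^ 2 = ∫ x, ‖f x‖ ^ 2 ∂μ := by
  rw [← Complex.ofReal_inj, ← integral_complex_ofReal, Complex.ofReal_pow]
  refine (inner_self_eq_norm_sq_to_K (𝕜 := ℂ) (hf.toLp f)).symm.trans ?_
  rw [inner_toLp]
  refine integral_congr_ae (Eventually.of_forall fun x => ?_)
  beta_reduce
  rw [← Complex.normSq_eq_conj_mul_self, Complex.normSq_eq_norm_sq]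

theorem integrable_norm_sq {f : α → ℂ} (hf : MemLp f 2 μ) : Integrable (fun x => ‖f x‖ ^ 2) μ :=
  (memLp_two_iff_integrable_sq_norm hf.1).1 hf

end LpMap

theorem norm_sq_toL2 (u : 𝓓(halfLine, ℂ)) : ‖toL2 u‖ ^ 2 = ∫ x in Ioi 0, ‖u x‖ ^ 2 :=
  norm_sq_toLp (memLp_test u)

theorem eq_zero_of_inner_toL2 {f : L2} (h : ∀ u, ⟪toL2 u, f⟫_ℂ = 0) : f = 0 := by
  rw [Lp.eq_zero_iff_ae_eq_zero]
  have hloc : LocallyIntegrableOn f (Ioi 0) ((volume : Measure ℝ).restrict (Ioi 0)) :=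
    ((Lp.memLp f).locallyIntegrable (by norm_num)).locallyIntegrableOn _
  have hzero := isOpen_Ioi.ae_eq_zero_of_integral_contDiff_smul_eq_zero hloc
      fun g hg hgc hgs => by
    let φ : 𝓓(halfLine, ℂ) :=
      ⟨fun x => (g x : ℂ), Complex.ofRealCLM.contDiff.comp hg,
        hgc.comp_left (g := fun r : ℝ => (r : ℂ)) Complex.ofReal_zero,
        (closure_mono fun x hx => by simpa using hx).trans hgs⟩
    rw [← h φ, ← Lp.toLp_coeFn f (Lp.memLp f)]
    refine Eq.trans ?_ (inner_toLp (memLp_test φ) (Lp.memLp f)).symm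
    refine integral_congr_ae ?_
    filter_upwards [(Lp.memLp f).coeFn_toLp] with x hx
    change g x • _ = starRingEnd ℂ (g x : ℂ) * f x
    rw [hx, Complex.conj_ofReal, Complex.real_smul]
  filter_upwards [hzero, ae_restrict_mem measurableSet_Ioi] with x hx hpos using hx hpos

theorem denseRange_toL2 : DenseRange toL2 := by
  change Dense (LinearMap.range toL2 : Set L2)
  rw [Submodule.dense_iff_topologicalClosure_eq_top, Submodule.topologicalClosure_eq_top_iff,
    Submodule.eq_bot_iff]
  intro f hf
  exact eq_zero_of_inner_toL2 fun u => (Submodule.mem_orthogonal _ f).1 hf _ ⟨u, rfl⟩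

/-! ### Euler operators -/

/-- The Euler-type operator `a u'' + (b / x) u' + (c / x²) u`. -/
def eulerOp (a b c : ℝ) (u : ℝ → ℂ) (x : ℝ) : ℂ :=
  a • deriv (deriv u) x + (b / x) • deriv u x + (c / x ^ 2) • u x

section EulerOp

variable (a b c : ℝ) (u : 𝓓(halfLine, ℂ))

theorem eulerOp_test (x : ℝ) :
    eulerOp a b c u x = a • testDeriv (testDeriv u) x + (b / x) • testDeriv u x
      + (c / x ^ 2) • u x := rfl

theorem eulerOp_mul_left (k : ℝ) (u : ℝ → ℂ) (x : ℝ) :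
    eulerOp (k * a) (k * b) (k * c) u x = k • eulerOp a b c u x := by
  simp only [eulerOp, smul_add, smul_smul, mul_div_assoc]

theorem continuous_eulerOp : Continuous (eulerOp a b c u) := by
  have hsnd := (testDeriv (testDeriv u)).continuous.const_smul a
  have hfst := continuous_div_pow_smul_test (testDeriv u) b 1
  simp only [pow_one] at hfst
  exact (hsnd.add hfst).add (continuous_div_pow_smul_test u c 2)

variable {u} in
theorem eulerOp_eq_zero {x : ℝ} (hx : x ∉ tsupport u) : eulerOp a b c u x = 0 := by
  have hsnd : testDeriv (testDeriv u) x = 0 :=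
    testDeriv_eq_zero fun h => hx (tsupport_deriv_subset (𝕜 := ℝ) h)
  simp [eulerOp_test, test_eq_zero hx, testDeriv_eq_zero hx, hsnd]

theorem hasCompactSupport_eulerOp : HasCompactSupport (eulerOp a b c u) :=
  HasCompactSupport.intro u.hasCompactSupport fun _ hx => eulerOp_eq_zero a b c hx

theorem memLp_eulerOp : MemLp (eulerOp a b c u) 2 ((volume : Measure ℝ).restrict (Ioi 0)) :=
  (continuous_eulerOp a b c u).memLp_of_hasCompactSupport (hasCompactSupport_eulerOp a b c u)

/-- The Euler-type operator `a u'' + (b / x) u' + (c / x²) u` from `C₀^∞(0, ∞)` to `L²(0, ∞)`. -/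
def eulerL2 : 𝓓(halfLine, ℂ) →ₗ[ℂ] L2 :=
  lpMap
    { toFun := fun u => eulerOp a b c u
      map_add' := fun u v => by
        funext x
        simp only [eulerOp_test, map_add, Pi.add_apply, add_apply, smul_add]
        ring
      map_smul' := fun k u => by
        funext x
        simp only [eulerOp_test, map_smul, Pi.smul_apply, smul_apply, smul_eq_mul,
          Complex.real_smul, RingHom.id_apply]
        ring }
    (memLp_eulerOp a b c)

theorem norm_sq_eulerL2 : ‖eulerL2 a b c u‖ ^ 2 = ∫ x in Ioi 0, ‖eulerOp a b c u x‖ ^ 2 :=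
  norm_sq_toLp (memLp_eulerOp a b c u)

theorem hasDerivAt_conj_mul_sub (φ : 𝓓(halfLine, ℂ)) {x : ℝ} (hx : x ≠ 0) :
    HasDerivAt
      (fun x => a * (starRingEnd ℂ (φ x) * testDeriv u x - starRingEnd ℂ (testDeriv φ x) * u x)
        + b * (starRingEnd ℂ (φ x) * u x) / (x : ℂ))
      (starRingEnd ℂ (φ x) * eulerOp a b c u x
        - starRingEnd ℂ (eulerOp a (-b) (b + c) φ x) * u x) x := by
  have hxℂ : (x : ℂ) ≠ 0 := Complex.ofReal_ne_zero.2 hx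
  have hφ := (hasDerivAt_test φ x).star
  have hφ' := (hasDerivAt_test (testDeriv φ) x).star
  have hu := hasDerivAt_test u x
  have hu' := hasDerivAt_test (testDeriv u) x
  have hofReal : HasDerivAt (fun x : ℝ => (x : ℂ)) 1 x := Complex.ofRealCLM.hasDerivAt
  convert! (((hφ.mul hu').sub (hφ'.mul hu)).const_mul (a : ℂ)).add
    (((hφ.mul hu).const_mul (b : ℂ)).div hofReal hxℂ) using 1
  simp only [eulerOp_test, map_add, Complex.real_smul, map_mul, Complex.conj_ofReal, Pi.mul_apply,
    Complex.star_def]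
  push_cast
  field_simp
  ring

theorem inner_toL2_eulerL2 (φ : 𝓓(halfLine, ℂ)) :
    ⟪toL2 φ, eulerL2 a b c u⟫_ℂ = ⟪eulerL2 a (-b) (b + c) φ, toL2 u⟫_ℂ := by
  refine (inner_toLp (memLp_test φ) (memLp_eulerOp a b c u)).trans
    (Eq.trans ?_ (inner_toLp (memLp_eulerOp a (-b) (b + c) φ) (memLp_test u)).symm)
  have hleft : Integrable fun x => starRingEnd ℂ (φ x) * eulerOp a b c u x :=
    ((Complex.continuous_conj.comp φ.continuous).mul
      (continuous_eulerOp a b c u)).integrable_of_hasCompactSupport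
        (hasCompactSupport_eulerOp a b c u).mul_left
  have hright : Integrable fun x => starRingEnd ℂ (eulerOp a (-b) (b + c) φ x) * u x :=
    ((Complex.continuous_conj.comp (continuous_eulerOp a (-b) (b + c) φ)).mul
      u.continuous).integrable_of_hasCompactSupport u.hasCompactSupport.mul_left
  rw [← sub_eq_zero, ← integral_sub hleft.integrableOn hright.integrableOn]
  refine integral_Ioi_deriv_eq_zero_of_isCompact u.hasCompactSupport u.tsupport_subset
    (fun x hx => ?_) (fun x hx => hasDerivAt_conj_mul_sub a b c u φ (ne_of_gt hx))
    (hleft.sub hright).integrableOn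
  simp [test_eq_zero hx, testDeriv_eq_zero hx]

theorem eq_zero_of_tendsto_eulerL2 {ψ : ℕ → 𝓓(halfLine, ℂ)} {f : L2}
    (hψ : Tendsto (fun n => toL2 (ψ n)) atTop (𝓝 0))
    (hf : Tendsto (fun n => eulerL2 a b c (ψ n)) atTop (𝓝 f)) : f = 0 := by
  refine eq_zero_of_inner_toL2 fun φ => ?_
  have hlim : Tendsto (fun n => ⟪eulerL2 a (-b) (b + c) φ, toL2 (ψ n)⟫_ℂ) atTop (𝓝 0) := by
    simpa only [inner_zero_right] using
      (tendsto_const_nhds (x := eulerL2 a (-b) (b + c) φ)).inner hψ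
  exact tendsto_nhds_unique (tendsto_const_nhds.inner hf)
    (hlim.congr fun n => (inner_toL2_eulerL2 a b c (ψ n) φ).symm)

end EulerOp

/-! ### The ground state representation of the Hardy–Rellich form

With `w = x ^ (-3/2) u` and `D = x d/dx` one has
`∫ (|u''|² - (9/16) |u|² / x⁴) dx = ∫ (|D² w|² + (5/2) |D w|²) dx / x`. -/

/-- `x ^ (-1/2) D² w` with `w = x ^ (-3/2) u` and `D = x d/dx`. -/
def secondOrder : (ℝ → ℂ) → ℝ → ℂ := eulerOp 1 (-2) (9 / 4)

/-- `x ^ (-1/2) D w` with `w = x ^ (-3/2) u` and `D = x d/dx`. -/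
def firstOrder : (ℝ → ℂ) → ℝ → ℂ := eulerOp 0 1 (-(3 / 2))

/-- The density `|x ^ (-1/2) D² w|² + (5/2) |x ^ (-1/2) D w|²`. -/
def hardyDensity (u : ℝ → ℂ) (x : ℝ) : ℝ := ‖secondOrder u x‖ ^ 2 + 5 / 2 * ‖firstOrder u x‖ ^ 2

/-- The operator `u ↦ x ^ (-1/2) (D² w, (5/2) ^ (1/2) D w)`, whose squared norm is the
Hardy–Rellich form. -/
def hardyOp : 𝓓(halfLine, ℂ) →ₗ[ℂ] WithLp 2 (L2 × L2) :=
  graphMap (eulerL2 1 (-2) (9 / 4))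
    (eulerL2 (√(5 / 2) * 0) (√(5 / 2) * 1) (√(5 / 2) * -(3 / 2)))

theorem hardyOp_closable (ψ : ℕ → 𝓓(halfLine, ℂ)) (f : WithLp 2 (L2 × L2))
    (hψ : Tendsto (fun n => toL2 (ψ n)) atTop (𝓝 0))
    (hf : Tendsto (fun n => hardyOp (ψ n)) atTop (𝓝 f)) : f = 0 := by
  have hfst : f.fst = 0 := eq_zero_of_tendsto_eulerL2 _ _ _ hψ
    (((WithLp.fstL 2 ℂ L2 L2).continuous.tendsto f).comp hf)
  have hsnd : f.snd = 0 := eq_zero_of_tendsto_eulerL2 _ _ _ hψ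
    (((WithLp.sndL 2 ℂ L2 L2).continuous.tendsto f).comp hf)
  simpa [hfst, hsnd] using WithLp.prod_norm_sq_eq_of_L2 f

section GroundState

theorem hardyDensity_nonneg (u : ℝ → ℂ) (x : ℝ) : 0 ≤ hardyDensity u x := by
  rw [hardyDensity]; positivity

variable (u : 𝓓(halfLine, ℂ))

theorem continuous_secondOrder : Continuous (secondOrder u) := continuous_eulerOp _ _ _ u

theorem continuous_firstOrder : Continuous (firstOrder u) := continuous_eulerOp _ _ _ u

theorem continuous_hardyDensity : Continuous (hardyDensity u) :=
  ((continuous_secondOrder u).norm.pow 2).add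
    (((continuous_firstOrder u).norm.pow 2).const_mul (5 / 2))

theorem integrable_hardyDensity : Integrable (hardyDensity u) :=
  (continuous_hardyDensity u).integrable_of_hasCompactSupport <|
    HasCompactSupport.intro u.hasCompactSupport fun x hx => by
      simp [hardyDensity, secondOrder, firstOrder, eulerOp_eq_zero _ _ _ hx]

theorem norm_sq_hardyOp : ‖hardyOp u‖ ^ 2 = ∫ x in Ioi 0, hardyDensity u x := by
  have hprod := WithLp.prod_norm_sq_eq_of_L2 (hardyOp u)
  change _ = ‖eulerL2 _ _ _ u‖ ^ 2 + ‖eulerL2 _ _ _ u‖ ^ 2 at hprod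
  rw [hprod, norm_sq_eulerL2, norm_sq_eulerL2, ← integral_add
    (integrable_norm_sq (memLp_eulerOp _ _ _ u)) (integrable_norm_sq (memLp_eulerOp _ _ _ u))]
  refine integral_congr_ae (Eventually.of_forall fun x => ?_)
  simp only [eulerOp_mul_left, norm_smul, mul_pow, Real.norm_eq_abs, sq_abs,
    Real.sq_sqrt (show (0 : ℝ) ≤ 5 / 2 by norm_num), hardyDensity, secondOrder, firstOrder]

theorem integrable_hardyRellich : Integrable fun x : ℝ => ‖deriv (deriv u) x‖ ^ 2
    - hardyRellichConst * (‖u x‖ ^ 2 / x ^ 4) := by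
  simp only [← coe_testDeriv]
  have hsnd : MemLp (testDeriv (testDeriv u)) 2 :=
    (testDeriv (testDeriv u)).continuous.memLp_of_hasCompactSupport
      (testDeriv (testDeriv u)).hasCompactSupport
  have hpot : MemLp (fun x => (1 / x ^ 2) • u x) 2 :=
    (continuous_div_pow_smul_test u 1 2).memLp_of_hasCompactSupport <|
      HasCompactSupport.intro u.hasCompactSupport fun x hx => by simp [test_eq_zero hx]
  have hpot_sq : Integrable fun x => ‖u x‖ ^ 2 / x ^ 4 := by
    refine (integrable_norm_sq hpot).congr (Eventually.of_forall fun x => ?_)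
    simp only [norm_smul, norm_div, norm_one, norm_pow, Real.norm_eq_abs, mul_pow, div_pow, sq_abs]
    ring
  exact (integrable_norm_sq hsnd).sub (hpot_sq.const_mul _)

theorem hasDerivAt_hardyBoundary {F : Type*} [NormedAddCommGroup F] [InnerProductSpace ℝ F]
    {f f₁ : ℝ → F} {f₂ : F} {x : ℝ} (hx : x ≠ 0) (hf : HasDerivAt f (f₁ x) x)
    (hf₁ : HasDerivAt f₁ f₂ x) :
    HasDerivAt (fun x => 2 * ⟪f₁ x, f₁ x⟫_ℝ / x - 9 / 2 * ⟪f₁ x, f x⟫_ℝ / x ^ 2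
        + 15 / 4 * ⟪f x, f x⟫_ℝ / x ^ 3)
      (‖f₂‖ ^ 2 - 9 / 16 * (‖f x‖ ^ 2 / x ^ 4)
        - (‖f₂ + (-2 / x) • f₁ x + (9 / 4 / x ^ 2) • f x‖ ^ 2
          + 5 / 2 * ‖(1 / x) • f₁ x + (-(3 / 2) / x ^ 2) • f x‖ ^ 2)) x := by
  have hfirst := ((hf₁.inner ℝ hf₁).const_mul 2).div (hasDerivAt_id x) hx
  have hmixed := ((hf₁.inner ℝ hf).const_mul (9 / 2)).div ((hasDerivAt_id x).pow 2)
    (pow_ne_zero 2 hx)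
  have hzeroth := ((hf.inner ℝ hf).const_mul (15 / 4)).div ((hasDerivAt_id x).pow 3)
    (pow_ne_zero 3 hx)
  convert! (hfirst.sub hmixed).add hzeroth using 1
  simp only [← real_inner_self_eq_norm_sq, inner_add_left, inner_add_right, real_inner_smul_left,
    real_inner_smul_right, id, Pi.pow_apply]
  rw [real_inner_comm f₂ (f₁ x), real_inner_comm f₂ (f x), real_inner_comm (f₁ x) (f x)]
  field_simp
  ring

theorem integral_hardyRellich :
    ∫ x in Ioi 0, (‖deriv (deriv u) x‖ ^ 2 - hardyRellichConst * (‖u x‖ ^ 2 / x ^ 4)) =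
      ∫ x in Ioi 0, hardyDensity u x := by
  rw [← sub_eq_zero, ← integral_sub (integrable_hardyRellich u).integrableOn
    (integrable_hardyDensity u).integrableOn]
  refine integral_Ioi_deriv_eq_zero_of_isCompact u.hasCompactSupport u.tsupport_subset
    (G := fun x => 2 * ⟪testDeriv u x, testDeriv u x⟫_ℝ / x - 9 / 2 * ⟪testDeriv u x, u x⟫_ℝ / x ^ 2
      + 15 / 4 * ⟪u x, u x⟫_ℝ / x ^ 3) (fun x hx => ?_) (fun x hx => ?_)
    ((integrable_hardyRellich u).sub (integrable_hardyDensity u)).integrableOn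
  · simp [test_eq_zero hx, testDeriv_eq_zero hx]
  · refine (hasDerivAt_hardyBoundary (ne_of_gt hx) (hasDerivAt_test u x)
      (hasDerivAt_test (testDeriv u) x)).congr_deriv ?_
    simp [hardyDensity, secondOrder, firstOrder, eulerOp_test, hardyRellichConst, coe_testDeriv]

end GroundState

/-! ### A Sobolev inequality with two interpolation points -/

theorem sq_intervalIntegral_le {f : ℝ → ℝ} (hf : Continuous f) {α β : ℝ} (hαβ : α ≤ β) :
    (∫ s in α..β, f s) ^ 2 ≤ (β - α) * ∫ s in α..β, f s ^ 2 := by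
  rcases hαβ.eq_or_lt with rfl | hlt
  · simp
  set I := ∫ s in α..β, f s
  set m := I / (β - α)
  have hm : m * (β - α) = I := div_mul_cancel₀ _ (sub_pos.2 hlt).ne'
  have variance_nonneg : 0 ≤ ∫ s in α..β, (f s - m) ^ 2 :=
    intervalIntegral.integral_nonneg hαβ fun s _ => sq_nonneg _
  have variance_eq : ∫ s in α..β, (f s - m) ^ 2 =
      (∫ s in α..β, f s ^ 2) - 2 * m * I + (β - α) * m ^ 2 := by
    simp_rw [fun s => show (f s - m) ^ 2 = f s ^ 2 - 2 * m * f s + m ^ 2 by ring]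
    rw [intervalIntegral.integral_add, intervalIntegral.integral_sub,
      intervalIntegral.integral_const_mul, intervalIntegral.integral_const, smul_eq_mul]
    all_goals exact Continuous.intervalIntegrable (by fun_prop) _ _
  nlinarith

section TwoPoints

variable {F : Type*} [NormedAddCommGroup F] [NormedSpace ℝ F]

theorem norm_smul_slope_le {w : ℝ → F} {K P Q s : ℝ} (hPQ : P < Q) (hs : |s - P| ≤ K * (Q - P)) :
    ‖(s - P) • slope w P Q‖ ≤ K * (‖w P‖ + ‖w Q‖) := by
  have hQP : 0 < Q - P := sub_pos.2 hPQ
  have hK : ‖(s - P) * (Q - P)⁻¹‖ ≤ K := by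
    rwa [Real.norm_eq_abs, abs_mul, abs_inv, abs_of_pos hQP, ← div_eq_mul_inv, div_le_iff₀ hQP]
  rw [slope_def_module, smul_smul, norm_smul, add_comm]
  exact mul_le_mul hK (norm_sub_le _ _) (norm_nonneg _) ((norm_nonneg _).trans hK)

variable [CompleteSpace F] {w w₁ w₂ : ℝ → F} {α β P Q s t : ℝ}

theorem norm_sub_le_intervalIntegral (hw : ∀ s, HasDerivAt w (w₁ s) s) (hw₁ : Continuous w₁)
    (hs : s ∈ Icc α β) (ht : t ∈ Icc α β) : ‖w t - w s‖ ≤ ∫ r in α..β, ‖w₁ r‖ := by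
  wlog hst : s ≤ t generalizing s t
  · rw [norm_sub_rev]
    exact this ht hs (le_of_not_ge hst)
  rw [← intervalIntegral.integral_eq_sub_of_hasDerivAt (fun r _ => hw r)
    (hw₁.intervalIntegrable _ _)]
  exact (intervalIntegral.norm_integral_le_integral_norm hst).trans
    (intervalIntegral.integral_mono_interval hs.1 hst ht.2
      (Eventually.of_forall fun r => norm_nonneg _) (hw₁.norm.intervalIntegrable _ _))

theorem norm_deriv_sub_slope_le (hw : ∀ s, HasDerivAt w (w₁ s) s)
    (hw₁ : ∀ s, HasDerivAt w₁ (w₂ s) s) (hw₂ : Continuous w₂) (hP : P ∈ Icc α β)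
    (hQ : Q ∈ Icc α β) (hPQ : P < Q) (ht : t ∈ Icc α β) :
    ‖w₁ t - slope w P Q‖ ≤ ∫ r in α..β, ‖w₂ r‖ := by
  have hQP : 0 < Q - P := sub_pos.2 hPQ
  have hw₁c : Continuous w₁ := continuous_iff_continuousAt.2 fun s => (hw₁ s).continuousAt
  have average_eq : ∫ r in P..Q, (w₁ t - w₁ r) = (Q - P) • (w₁ t - slope w P Q) := by
    rw [intervalIntegral.integral_sub (by simp) (hw₁c.intervalIntegrable _ _),
      intervalIntegral.integral_const,
      intervalIntegral.integral_eq_sub_of_hasDerivAt (fun r _ => hw r)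
        (hw₁c.intervalIntegrable _ _), smul_sub, slope_def_module, smul_inv_smul₀ hQP.ne']
  have average_le : ‖∫ r in P..Q, (w₁ t - w₁ r)‖ ≤ (∫ r in α..β, ‖w₂ r‖) * |Q - P| := by
    refine intervalIntegral.norm_integral_le_of_norm_le_const fun r hr => ?_
    rw [uIoc_of_le hPQ.le] at hr
    exact norm_sub_le_intervalIntegral hw₁ hw₂ ⟨hP.1.trans hr.1.le, hr.2.trans hQ.2⟩ ht
  rw [average_eq, norm_smul, Real.norm_eq_abs, mul_comm] at average_le
  exact le_of_mul_le_mul_right average_le (abs_pos.2 hQP.ne')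

theorem norm_sub_interpolation_le (hw : ∀ s, HasDerivAt w (w₁ s) s)
    (hw₁ : ∀ s, HasDerivAt w₁ (w₂ s) s) (hw₂ : Continuous w₂) (hP : P ∈ Icc α β)
    (hQ : Q ∈ Icc α β) (hPQ : P < Q) (hs : s ∈ Icc α β) :
    ‖w s - w P - (s - P) • slope w P Q‖ ≤ (∫ r in α..β, ‖w₂ r‖) * (β - α) := by
  have hαβ : α ≤ β := hs.1.trans hs.2
  have hw₁c : Continuous w₁ := continuous_iff_continuousAt.2 fun s => (hw₁ s).continuousAt
  have remainder_eq : w s - w P - (s - P) • slope w P Q = ∫ r in P..s, (w₁ r - slope w P Q) := by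
    rw [intervalIntegral.integral_sub (hw₁c.intervalIntegrable _ _) (by simp),
      intervalIntegral.integral_const,
      intervalIntegral.integral_eq_sub_of_hasDerivAt (fun r _ => hw r)
        (hw₁c.intervalIntegrable _ _)]
  calc ‖w s - w P - (s - P) • slope w P Q‖ ≤ (∫ r in α..β, ‖w₂ r‖) * |s - P| := by
        rw [remainder_eq]
        exact intervalIntegral.norm_integral_le_of_norm_le_const fun r hr =>
          norm_deriv_sub_slope_le hw hw₁ hw₂ hP hQ hPQ
            (uIcc_subset_Icc hP hs (uIoc_subset_uIcc hr))
    _ ≤ (∫ r in α..β, ‖w₂ r‖) * (β - α) := by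
        gcongr
        · exact intervalIntegral.integral_nonneg hαβ fun _ _ => norm_nonneg _
        · exact abs_sub_le_of_le_of_le hs.1 hs.2 hP.1 hP.2

theorem norm_sq_le_of_two_points (hw : ∀ s, HasDerivAt w (w₁ s) s)
    (hw₁ : ∀ s, HasDerivAt w₁ (w₂ s) s) (hw₂ : Continuous w₂) {K : ℝ} (hP : P ∈ Icc α β)
    (hQ : Q ∈ Icc α β) (hPQ : P < Q) (hK : β - α ≤ K * (Q - P)) (hs : s ∈ Icc α β) :
    ‖w s‖ ^ 2 ≤ 3 * (1 + K) ^ 2 * (‖w P‖ ^ 2 + ‖w Q‖ ^ 2) +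
      3 * (β - α) ^ 3 * ∫ r in α..β, ‖w₂ r‖ ^ 2 := by
  have hαβ : α ≤ β := hs.1.trans hs.2
  set I := ∫ r in α..β, ‖w₂ r‖
  have remainder_le : ‖w s - w P - (s - P) • slope w P Q‖ ≤ I * (β - α) :=
    norm_sub_interpolation_le hw hw₁ hw₂ hP hQ hPQ hs
  have interpolation_le : ‖(s - P) • slope w P Q‖ ≤ K * (‖w P‖ + ‖w Q‖) :=
    norm_smul_slope_le hPQ ((abs_sub_le_of_le_of_le hs.1 hs.2 hP.1 hP.2).trans hK)
  have norm_le : ‖w s‖ ≤ (1 + K) * ‖w P‖ + (1 + K) * ‖w Q‖ + I * (β - α) := by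
    have htriangle := norm_add₃_le (a := w s - w P - (s - P) • slope w P Q) (b := w P)
      (c := (s - P) • slope w P Q)
    rw [show w s - w P - (s - P) • slope w P Q + w P + (s - P) • slope w P Q = w s by abel]
      at htriangle
    linarith [norm_nonneg (w Q)]
  calc ‖w s‖ ^ 2 ≤ ((1 + K) * ‖w P‖ + (1 + K) * ‖w Q‖ + I * (β - α)) ^ 2 := by gcongr
    _ ≤ 3 * (((1 + K) * ‖w P‖) ^ 2 + ((1 + K) * ‖w Q‖) ^ 2 + (I * (β - α)) ^ 2) := by
        nlinarith [sq_nonneg ((1 + K) * ‖w P‖ - (1 + K) * ‖w Q‖),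
          sq_nonneg ((1 + K) * ‖w P‖ - I * (β - α)), sq_nonneg ((1 + K) * ‖w Q‖ - I * (β - α))]
    _ = 3 * (1 + K) ^ 2 * (‖w P‖ ^ 2 + ‖w Q‖ ^ 2) + 3 * (β - α) ^ 2 * I ^ 2 := by ring
    _ ≤ 3 * (1 + K) ^ 2 * (‖w P‖ ^ 2 + ‖w Q‖ ^ 2) +
          3 * (β - α) ^ 2 * ((β - α) * ∫ r in α..β, ‖w₂ r‖ ^ 2) := by
        gcongr
        exact sq_intervalIntegral_le hw₂.norm hαβ
    _ = _ := by ring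

end TwoPoints

/-! ### Logarithmic coordinates -/

/-- The function `w = x ^ (-3/2) u` in the variable `s = log x`. -/
def logProfile (u : ℝ → ℂ) (s : ℝ) : ℂ := Real.exp (-(3 / 2) * s) • u (Real.exp s)

theorem hasDerivAt_exp_mul_smul_comp_exp {F : Type*} [NormedAddCommGroup F] [NormedSpace ℝ F]
    {f : ℝ → F} {f' : F} (c : ℝ) {s : ℝ} (hf : HasDerivAt f f' (Real.exp s)) :
    HasDerivAt (fun s => Real.exp (c * s) • f (Real.exp s))
      (Real.exp (c * s) • (c • f (Real.exp s) + Real.exp s • f')) s := by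
  have hexp : HasDerivAt (fun s => Real.exp (c * s)) (Real.exp (c * s) * c) s := by
    simpa using ((hasDerivAt_id s).const_mul c).exp
  convert! hexp.smul (hf.scomp s (Real.hasDerivAt_exp s)) using 1
  simp only [Function.comp_apply, smul_add, smul_smul]
  exact add_comm _ _

theorem norm_sq_eq_logProfile (u : ℝ → ℂ) {x : ℝ} (hx : 0 < x) :
    ‖u x‖ ^ 2 = x ^ 3 * ‖logProfile u (Real.log x)‖ ^ 2 := by
  have hcancel : x ^ 3 * Real.exp (-(3 / 2) * Real.log x) ^ 2 = 1 := by
    nth_rw 1 [← Real.exp_log hx]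
    rw [← Real.exp_nat_mul, ← Real.exp_nat_mul, ← Real.exp_add, Real.exp_eq_one_iff]
    push_cast
    ring
  rw [logProfile, Real.exp_log hx, norm_smul, mul_pow, Real.norm_eq_abs, sq_abs, ← mul_assoc,
    hcancel, one_mul]

theorem intervalIntegral_norm_sq_comp_exp {F : Type*} [NormedAddCommGroup F] [NormedSpace ℝ F]
    {f : ℝ → F} (hf : Continuous f) {a b : ℝ} (ha : 0 < a) (hb : 0 < b) :
    ∫ s in Real.log a..Real.log b, ‖Real.exp (1 / 2 * s) • f (Real.exp s)‖ ^ 2 =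
      ∫ x in a..b, ‖f x‖ ^ 2 := by
  have hchange := intervalIntegral.integral_comp_mul_deriv (a := Real.log a) (b := Real.log b)
    (f := Real.exp) (f' := Real.exp) (g := fun x => ‖f x‖ ^ 2)
    (fun s _ => Real.hasDerivAt_exp s) Real.continuous_exp.continuousOn (by fun_prop)
  rw [Real.exp_log ha, Real.exp_log hb] at hchange
  rw [← hchange]
  refine intervalIntegral.integral_congr fun s _ => ?_
  have hsq : Real.exp (1 / 2 * s) ^ 2 = Real.exp s := by
    rw [← Real.exp_nat_mul]
    congr 1
    push_cast
    ring
  simp only [Function.comp_apply, norm_smul, mul_pow, Real.norm_eq_abs, sq_abs, hsq]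
  exact mul_comm _ _

section LogProfile

variable (u : 𝓓(halfLine, ℂ))

theorem hasDerivAt_logProfile (s : ℝ) :
    HasDerivAt (logProfile u) (Real.exp (1 / 2 * s) • firstOrder u (Real.exp s)) s := by
  convert! hasDerivAt_exp_mul_smul_comp_exp (-(3 / 2)) (hasDerivAt_test u (Real.exp s)) using 1
  have hexp : Real.exp (1 / 2 * s) = Real.exp (-(3 / 2) * s) * Real.exp s ^ 2 := by
    rw [← Real.exp_nat_mul, ← Real.exp_add]
    congr 1
    push_cast
    ring
  have hne : ((Real.exp s : ℝ) : ℂ) ≠ 0 := Complex.ofReal_ne_zero.2 (Real.exp_pos s).ne'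
  rw [firstOrder, eulerOp_test, hexp]
  simp only [Complex.real_smul]
  generalize Real.exp s = y at *
  push_cast
  field_simp
  ring

theorem hasDerivAt_firstOrder {x : ℝ} (hx : x ≠ 0) :
    HasDerivAt (firstOrder u) ((1 / x) • testDeriv (testDeriv u) x
      - (5 / 2 / x ^ 2) • testDeriv u x + (3 / x ^ 3) • u x) x := by
  have hfirst := ((hasDerivAt_const x (1 : ℝ)).div (hasDerivAt_id x) hx).smul
    (hasDerivAt_test (testDeriv u) x)
  have hzeroth := ((hasDerivAt_const x (-(3 / 2) : ℝ)).div ((hasDerivAt_id x).pow 2)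
    (pow_ne_zero 2 hx)).smul (hasDerivAt_test u x)
  convert! hfirst.add hzeroth using 1
  · ext y
    simp [firstOrder, eulerOp_test]
  · have hne : (x : ℂ) ≠ 0 := Complex.ofReal_ne_zero.2 hx
    simp only [Complex.real_smul, id, Pi.pow_apply, Pi.div_apply]
    push_cast
    field_simp
    ring

theorem hasDerivAt_deriv_logProfile (s : ℝ) :
    HasDerivAt (fun s => Real.exp (1 / 2 * s) • firstOrder u (Real.exp s))
      (Real.exp (1 / 2 * s) • secondOrder u (Real.exp s)) s := by
  convert! hasDerivAt_exp_mul_smul_comp_exp (1 / 2)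
    (hasDerivAt_firstOrder u (Real.exp_pos s).ne') using 1
  have hne : ((Real.exp s : ℝ) : ℂ) ≠ 0 := Complex.ofReal_ne_zero.2 (Real.exp_pos s).ne'
  rw [secondOrder, firstOrder, eulerOp_test, eulerOp_test]
  simp only [Complex.real_smul]
  generalize Real.exp s = y at *
  push_cast
  field_simp
  ring

theorem norm_sq_firstOrder_le (u : ℝ → ℂ) (x : ℝ) : ‖firstOrder u x‖ ^ 2 ≤ hardyDensity u x := by
  rw [hardyDensity]
  nlinarith [sq_nonneg ‖firstOrder u x‖, sq_nonneg ‖secondOrder u x‖]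

theorem norm_sq_secondOrder_le (u : ℝ → ℂ) (x : ℝ) :
    ‖secondOrder u x‖ ^ 2 ≤ hardyDensity u x := by
  rw [hardyDensity]
  nlinarith [sq_nonneg ‖firstOrder u x‖]

theorem intervalIntegral_hardyDensity_nonneg (u : ℝ → ℂ) {a b : ℝ} (hab : a ≤ b) :
    0 ≤ ∫ t in a..b, hardyDensity u t :=
  intervalIntegral.integral_nonneg hab fun t _ => hardyDensity_nonneg u t

theorem intervalIntegral_le_intervalIntegral_hardyDensity {f : ℝ → ℝ} (hf : Continuous f)
    (hfu : ∀ t, f t ≤ hardyDensity u t) {a b p q : ℝ} (hap : a ≤ p) (hpq : p ≤ q) (hqb : q ≤ b) :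
    ∫ t in p..q, f t ≤ ∫ t in a..b, hardyDensity u t :=
  (intervalIntegral.integral_mono hpq (hf.intervalIntegrable _ _)
    ((continuous_hardyDensity u).intervalIntegrable _ _) hfu).trans
    (intervalIntegral.integral_mono_interval hap hpq hqb
      (Eventually.of_forall (hardyDensity_nonneg u))
      ((continuous_hardyDensity u).intervalIntegrable _ _))

theorem norm_sq_logProfile_sub_le {a b x q : ℝ} (ha : 0 ≤ a) (hx : x ∈ Ioc a b)
    (hq : q ∈ Ioc a b) :
    ‖logProfile u (Real.log x) - logProfile u (Real.log q)‖ ^ 2 ≤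
      |Real.log x - Real.log q| * ∫ t in a..b, hardyDensity u t := by
  wlog hqx : q ≤ x generalizing x q
  · rw [norm_sub_rev, abs_sub_comm]
    exact this hq hx (le_of_not_ge hqx)
  have hq0 : 0 < q := ha.trans_lt hq.1
  have hlog : Real.log q ≤ Real.log x := Real.log_le_log hq0 hqx
  have hfirst := continuous_firstOrder u
  have hderiv : Continuous fun s => Real.exp (1 / 2 * s) • firstOrder u (Real.exp s) := by
    fun_prop
  rw [abs_of_nonneg (sub_nonneg.2 hlog)]
  calc ‖logProfile u (Real.log x) - logProfile u (Real.log q)‖ ^ 2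
      ≤ (∫ s in Real.log q..Real.log x,
          ‖Real.exp (1 / 2 * s) • firstOrder u (Real.exp s)‖) ^ 2 := by
        gcongr
        exact norm_sub_le_intervalIntegral (hasDerivAt_logProfile u) hderiv
          (left_mem_Icc.2 hlog) (right_mem_Icc.2 hlog)
    _ ≤ (Real.log x - Real.log q) * ∫ t in q..x, ‖firstOrder u t‖ ^ 2 := by
        rw [← intervalIntegral_norm_sq_comp_exp hfirst hq0 (ha.trans_lt hx.1)]
        exact sq_intervalIntegral_le hderiv.norm hlog
    _ ≤ _ := by
        gcongr
        exact intervalIntegral_le_intervalIntegral_hardyDensity u (hfirst.norm.pow 2)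
          (norm_sq_firstOrder_le u) hq.1.le hqx hx.2

end LogProfile

/-! ### Pointwise bounds on an interval -/

/-- The constant of the pointwise bound `norm_sq_le_on_interval`, coming from
`1176 = 8 * 3 * (1 + 6) ^ 2` on short intervals and from `8 * (2 + 2 / (3 - ν))` on long ones. -/
def boundConst (ν : ℝ) : ℝ := 1176 + 16 / (3 - ν)

theorem boundConst_pos {ν : ℝ} (hν₃ : ν < 3) : 0 < boundConst ν := by
  have : 0 < 3 - ν := by linarith
  rw [boundConst]
  positivity

theorem mul_log_sub_log_le {a b : ℝ} (ha : 0 < a) (hb : 0 < b) :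
    a * (Real.log b - Real.log a) ≤ b - a := by
  rw [← Real.log_div hb.ne' ha.ne']
  calc a * Real.log (b / a) ≤ a * (b / a - 1) := by
        gcongr
        exact Real.log_le_sub_one_of_pos (by positivity)
    _ = b - a := by field_simp

theorem log_sub_log_le_of_thirds {a b p q : ℝ} (ha : 0 < a) (hab : a ≤ b) (hshort : b - a ≤ a)
    (hp : p ∈ Icc a (a + (b - a) / 3)) (hq : q ∈ Icc (b - (b - a) / 3) b) :
    Real.log b - Real.log a ≤ 6 * (Real.log q - Real.log p) := by
  have hp0 : 0 < p := ha.trans_le hp.1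
  have hpq : p ≤ q := by linarith [hp.2, hq.1]
  have hlog : 0 ≤ Real.log q - Real.log p := sub_nonneg.2 (Real.log_le_log hp0 hpq)
  refine le_of_mul_le_mul_left ?_ ha
  calc a * (Real.log b - Real.log a) ≤ b - a := mul_log_sub_log_le ha (ha.trans_le hab)
    _ ≤ 3 * (q - p) := by linarith [hp.2, hq.1]
    _ ≤ 3 * (q * (Real.log q - Real.log p)) := by
        linarith [mul_log_sub_log_le (hp0.trans_le hpq) hp0]
    _ ≤ 3 * (2 * a * (Real.log q - Real.log p)) := by
        gcongr
        linarith [hq.2]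
    _ = a * (6 * (Real.log q - Real.log p)) := by ring

theorem abs_log_sub_log_le {b x q : ℝ} (hx : x ∈ Ioc 0 b) (hq : q ∈ Icc (b / 2) b) :
    |Real.log x - Real.log q| ≤ 1 + Real.log (b / x) := by
  have hb : 0 < b := hx.1.trans_le hx.2
  have hqb : Real.log q ≤ Real.log b := Real.log_le_log (by linarith [hq.1]) hq.2
  have hxb : Real.log x ≤ Real.log b := Real.log_le_log hx.1 hx.2
  have hbq : Real.log b - Real.log 2 ≤ Real.log q := by
    rw [← Real.log_div hb.ne' two_ne_zero]
    exact Real.log_le_log (by positivity) hq.1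
  rw [Real.log_div hb.ne' hx.1.ne', abs_le]
  constructor <;> linarith [Real.log_two_lt_d9]

theorem rpow_mul_abs_log_sub_log_le {κ : ℝ} (hκ : 0 < κ) {b x q : ℝ} (hx : x ∈ Ioc 0 b)
    (hq : q ∈ Icc (b / 2) b) : x ^ κ * |Real.log x - Real.log q| ≤ b ^ κ * (1 + 1 / κ) := by
  have hx0 : 0 < x := hx.1
  have hbx : 0 < b / x := div_pos (hx0.trans_le hx.2) hx0
  calc x ^ κ * |Real.log x - Real.log q| ≤ x ^ κ * (1 + Real.log (b / x)) := by
        gcongr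
        exact abs_log_sub_log_le hx hq
    _ ≤ x ^ κ * (1 + (b / x) ^ κ / κ) := by
        gcongr
        exact Real.log_le_rpow_div hbx.le hκ
    _ = x ^ κ + (x * (b / x)) ^ κ / κ := by
        rw [Real.mul_rpow hx0.le hbx.le]
        ring
    _ ≤ b ^ κ + b ^ κ / κ := by
        rw [mul_div_cancel₀ _ hx0.ne']
        gcongr
        exact hx.2
    _ = b ^ κ * (1 + 1 / κ) := by ring

section PointwiseBound

variable (u : 𝓓(halfLine, ℂ)) {a b x p q : ℝ}

theorem norm_sq_logProfile_le_of_short (hab : a < b) (hshort : b - a ≤ a) (hx : x ∈ Ioc a b)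
    (hp : p ∈ Icc a (a + (b - a) / 3)) (hq : q ∈ Icc (b - (b - a) / 3) b) :
    ‖logProfile u (Real.log x)‖ ^ 2 ≤
      147 * (‖logProfile u (Real.log p)‖ ^ 2 + ‖logProfile u (Real.log q)‖ ^ 2) +
        3 * (Real.log b - Real.log a) ^ 3 * ∫ t in a..b, hardyDensity u t := by
  have ha : 0 < a := by linarith
  have hpq : p < q := by linarith [hp.2, hq.1]
  have hlog {t : ℝ} (hat : a ≤ t) (htb : t ≤ b) : Real.log t ∈ Icc (Real.log a) (Real.log b) :=
    ⟨Real.log_le_log ha hat, Real.log_le_log (ha.trans_le hat) htb⟩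
  have hsecond := continuous_secondOrder u
  have htwo := norm_sq_le_of_two_points (hasDerivAt_logProfile u) (hasDerivAt_deriv_logProfile u)
    (by fun_prop) (hlog hp.1 (by linarith [hp.2])) (hlog (by linarith [hq.1]) hq.2)
    (Real.log_lt_log (ha.trans_le hp.1) hpq) (log_sub_log_le_of_thirds ha hab.le hshort hp hq)
    (hlog hx.1.le hx.2)
  rw [intervalIntegral_norm_sq_comp_exp hsecond ha (ha.trans hab)] at htwo
  refine htwo.trans (add_le_add (by norm_num) ?_)
  have hlen : 0 ≤ Real.log b - Real.log a := sub_nonneg.2 (Real.log_le_log ha hab.le)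
  gcongr
  exact intervalIntegral_le_intervalIntegral_hardyDensity u (hsecond.norm.pow 2)
    (norm_sq_secondOrder_le u) le_rfl hab.le le_rfl

theorem norm_sq_le_of_short (hab : a < b) (hshort : b - a ≤ a) (hx : x ∈ Ioc a b)
    (hp : p ∈ Icc a (a + (b - a) / 3)) (hq : q ∈ Icc (b - (b - a) / 3) b) :
    ‖u x‖ ^ 2 ≤ 1176 * (‖u p‖ ^ 2 + ‖u q‖ ^ 2) +
      24 * (b - a) ^ 3 * ∫ t in a..b, hardyDensity u t := by
  have ha : 0 < a := by linarith
  have haq : a ≤ q := by linarith [hq.1]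
  have hD : 0 ≤ ∫ t in a..b, hardyDensity u t := intervalIntegral_hardyDensity_nonneg _ hab.le
  set D := ∫ t in a..b, hardyDensity u t
  set σ := Real.log b - Real.log a
  have hσ : 0 ≤ σ := sub_nonneg.2 (Real.log_le_log ha hab.le)
  have profile_le {t : ℝ} (hat : a ≤ t) : a ^ 3 * ‖logProfile u (Real.log t)‖ ^ 2 ≤ ‖u t‖ ^ 2 := by
    rw [norm_sq_eq_logProfile u (ha.trans_le hat)]
    gcongr
  calc ‖u x‖ ^ 2 = x ^ 3 * ‖logProfile u (Real.log x)‖ ^ 2 :=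
        norm_sq_eq_logProfile u (ha.trans hx.1)
    _ ≤ (2 * a) ^ 3 * (147 * (‖logProfile u (Real.log p)‖ ^ 2 +
          ‖logProfile u (Real.log q)‖ ^ 2) + 3 * σ ^ 3 * D) := by
        gcongr
        · exact (ha.trans hx.1).le
        · linarith [hx.2]
        · exact norm_sq_logProfile_le_of_short u hab hshort hx hp hq
    _ = 1176 * (a ^ 3 * ‖logProfile u (Real.log p)‖ ^ 2 +
          a ^ 3 * ‖logProfile u (Real.log q)‖ ^ 2) + 24 * (a * σ) ^ 3 * D := by ring
    _ ≤ 1176 * (‖u p‖ ^ 2 + ‖u q‖ ^ 2) + 24 * (b - a) ^ 3 * D := by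
        gcongr
        · exact profile_le hp.1
        · exact profile_le haq
        · exact mul_log_sub_log_le ha (ha.trans hab)

theorem norm_sq_logProfile_le_of_mem_last_third (ha : 0 ≤ a) (hab : a < b)
    (hq : q ∈ Icc (b - (b - a) / 3) b) :
    ‖logProfile u (Real.log q)‖ ^ 2 ≤ 8 * ((b - a)⁻¹ ^ 3 * ‖u q‖ ^ 2) := by
  have hlen : 0 < b - a := sub_pos.2 hab
  have hq0 : 0 < q := by linarith [hq.1]
  have hone : (1 : ℝ) ≤ 2 * (b - a)⁻¹ * q := by
    rw [mul_right_comm, ← div_eq_mul_inv, le_div_iff₀ hlen]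
    linarith [hq.1]
  calc ‖logProfile u (Real.log q)‖ ^ 2
      ≤ (2 * (b - a)⁻¹ * q) ^ 3 * ‖logProfile u (Real.log q)‖ ^ 2 :=
        le_mul_of_one_le_left (sq_nonneg _) (one_le_pow₀ hone)
    _ = 8 * ((b - a)⁻¹ ^ 3 * ‖u q‖ ^ 2) := by
        rw [norm_sq_eq_logProfile u hq0]
        ring

theorem rpow_mul_norm_sq_logProfile_le {κ : ℝ} (hκ : 0 < κ) (ha : 0 ≤ a) (hab : a < b)
    (hx : x ∈ Ioc a b) (hq : q ∈ Icc (b - (b - a) / 3) b) :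
    x ^ κ * ‖logProfile u (Real.log x)‖ ^ 2 ≤ b ^ κ * (16 * ((b - a)⁻¹ ^ 3 * ‖u q‖ ^ 2) +
      (2 + 2 / κ) * ∫ t in a..b, hardyDensity u t) := by
  have hx0 : 0 < x := ha.trans_lt hx.1
  have hb0 : 0 < b := ha.trans_lt hab
  have hD : 0 ≤ ∫ t in a..b, hardyDensity u t := intervalIntegral_hardyDensity_nonneg _ hab.le
  have hdiff := norm_sq_logProfile_sub_le u ha hx (q := q) ⟨by linarith [hq.1], hq.2⟩
  set D := ∫ t in a..b, hardyDensity u t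
  set W := logProfile u (Real.log x)
  set Wq := logProfile u (Real.log q)
  have rpow_mul_log_le : x ^ κ * |Real.log x - Real.log q| ≤ b ^ κ * (1 + 1 / κ) :=
    rpow_mul_abs_log_sub_log_le hκ ⟨hx0, hx.2⟩ ⟨by linarith [hq.1], hq.2⟩
  have split_sq : ‖W‖ ^ 2 ≤ 2 * ‖Wq‖ ^ 2 + 2 * ‖W - Wq‖ ^ 2 := by
    nlinarith [norm_le_norm_add_norm_sub' W Wq, norm_nonneg W, sq_nonneg (‖Wq‖ - ‖W - Wq‖)]
  calc x ^ κ * ‖W‖ ^ 2 ≤ x ^ κ * (2 * ‖Wq‖ ^ 2 + 2 * (|Real.log x - Real.log q| * D)) := by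
        gcongr
        linarith
    _ = 2 * (x ^ κ * ‖Wq‖ ^ 2) + 2 * ((x ^ κ * |Real.log x - Real.log q|) * D) := by ring
    _ ≤ 2 * (b ^ κ * (8 * ((b - a)⁻¹ ^ 3 * ‖u q‖ ^ 2))) + 2 * ((b ^ κ * (1 + 1 / κ)) * D) := by
        gcongr
        · exact hx.2
        · exact norm_sq_logProfile_le_of_mem_last_third u ha hab hq
    _ = _ := by ring

variable {ν : ℝ}

theorem norm_sq_le_on_short_interval (hν₀ : 0 ≤ ν) (hν₃ : ν < 3) (hab : a < b)
    (hshort : b - a ≤ a) (hx : x ∈ Ioc a b) (hp : p ∈ Icc a (a + (b - a) / 3))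
    (hq : q ∈ Icc (b - (b - a) / 3) b) :
    ‖u x‖ ^ 2 ≤ boundConst ν * (x ^ ν * (b - a) ^ (3 - ν) *
      ((∫ t in a..b, hardyDensity u t) + (b - a)⁻¹ ^ 3 * (‖u p‖ ^ 2 + ‖u q‖ ^ 2))) := by
  have : 0 < 3 - ν := by linarith
  have hlen : 0 < b - a := sub_pos.2 hab
  have hD : 0 ≤ ∫ t in a..b, hardyDensity u t := intervalIntegral_hardyDensity_nonneg _ hab.le
  have hle := norm_sq_le_of_short u hab hshort hx hp hq
  set D := ∫ t in a..b, hardyDensity u t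
  set S := ‖u p‖ ^ 2 + ‖u q‖ ^ 2
  have : 0 ≤ (b - a)⁻¹ ^ 3 * S := by positivity
  have cube_le : (b - a) ^ 3 ≤ x ^ ν * (b - a) ^ (3 - ν) := by
    calc (b - a) ^ 3 = (b - a) ^ ν * (b - a) ^ (3 - ν) := by
          rw [← Real.rpow_add hlen, ← Real.rpow_natCast]
          norm_num
      _ ≤ x ^ ν * (b - a) ^ (3 - ν) := by
          gcongr
          linarith [hx.1]
  calc ‖u x‖ ^ 2 ≤ 1176 * S + 24 * (b - a) ^ 3 * D := hle
    _ ≤ 1176 * S + 1176 * (b - a) ^ 3 * D := by gcongr; norm_num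
    _ = 1176 * ((b - a) ^ 3 * (D + (b - a)⁻¹ ^ 3 * S)) := by
        field_simp
        ring
    _ ≤ boundConst ν * (x ^ ν * (b - a) ^ (3 - ν) * (D + (b - a)⁻¹ ^ 3 * S)) := by
        rw [boundConst]
        gcongr
        exact le_add_of_nonneg_right (by positivity)

theorem norm_sq_le_on_long_interval (hν₀ : 0 ≤ ν) (hν₃ : ν < 3) (ha : 0 ≤ a) (hab : a < b)
    (hlong : a ≤ b - a) (hx : x ∈ Ioc a b) (hq : q ∈ Icc (b - (b - a) / 3) b) :
    ‖u x‖ ^ 2 ≤ boundConst ν * (x ^ ν * (b - a) ^ (3 - ν) *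
      ((∫ t in a..b, hardyDensity u t) + (b - a)⁻¹ ^ 3 * ‖u q‖ ^ 2)) := by
  have hκ : 0 < 3 - ν := by linarith
  have hlen : 0 < b - a := sub_pos.2 hab
  have hx0 : 0 < x := ha.trans_lt hx.1
  have hD : 0 ≤ ∫ t in a..b, hardyDensity u t := intervalIntegral_hardyDensity_nonneg _ hab.le
  have hprofile := rpow_mul_norm_sq_logProfile_le u hκ ha hab hx hq
  set D := ∫ t in a..b, hardyDensity u t
  set Y := (b - a)⁻¹ ^ 3 * ‖u q‖ ^ 2
  have hY : 0 ≤ Y := by positivity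
  have rpow_le : b ^ (3 - ν) ≤ 8 * (b - a) ^ (3 - ν) := by
    calc b ^ (3 - ν) ≤ (2 * (b - a)) ^ (3 - ν) :=
          Real.rpow_le_rpow (by linarith) (by linarith) hκ.le
      _ = 2 ^ (3 - ν) * (b - a) ^ (3 - ν) := Real.mul_rpow (by norm_num) hlen.le
      _ ≤ 2 ^ (3 : ℝ) * (b - a) ^ (3 - ν) := by
          gcongr
          · norm_num
          · linarith
      _ = 8 * (b - a) ^ (3 - ν) := by norm_num
  calc ‖u x‖ ^ 2 = x ^ ν * (x ^ (3 - ν) * ‖logProfile u (Real.log x)‖ ^ 2) := by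
        rw [norm_sq_eq_logProfile u hx0, ← mul_assoc, ← Real.rpow_add hx0, ← Real.rpow_natCast]
        norm_num
    _ ≤ x ^ ν * (b ^ (3 - ν) * (16 * Y + (2 + 2 / (3 - ν)) * D)) := by gcongr
    _ ≤ x ^ ν * (8 * (b - a) ^ (3 - ν) * (16 * Y + (2 + 2 / (3 - ν)) * D)) := by gcongr
    _ = x ^ ν * (b - a) ^ (3 - ν) * (128 * Y + (16 + 16 / (3 - ν)) * D) := by ring
    _ ≤ x ^ ν * (b - a) ^ (3 - ν) * (boundConst ν * (D + Y)) := by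
        have : 0 ≤ 16 / (3 - ν) * Y := by positivity
        rw [boundConst]
        gcongr
        linarith
    _ = _ := by ring

theorem norm_sq_le_on_interval (hν₀ : 0 ≤ ν) (hν₃ : ν < 3) (ha : 0 ≤ a) (hab : a < b)
    (hx : x ∈ Ioc a b) (hp : p ∈ Icc a (a + (b - a) / 3)) (hq : q ∈ Icc (b - (b - a) / 3) b) :
    ‖u x‖ ^ 2 ≤ boundConst ν * (x ^ ν * (b - a) ^ (3 - ν) *
      ((∫ t in a..b, hardyDensity u t) + (b - a)⁻¹ ^ 3 * (‖u p‖ ^ 2 + ‖u q‖ ^ 2))) := by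
  rcases le_total (b - a) a with hshort | hlong
  · exact norm_sq_le_on_short_interval u hν₀ hν₃ hab hshort hx hp hq
  · have : 0 < b - a := sub_pos.2 hab
    have hx0 : 0 < x := ha.trans_lt hx.1
    have hconst := boundConst_pos hν₃
    refine (norm_sq_le_on_long_interval u hν₀ hν₃ ha hab hlong hx hq).trans ?_
    gcongr
    exact le_add_of_nonneg_left (sq_nonneg _)

end PointwiseBound

/-! ### Partitions adapted to a density -/

section Partition

theorem exists_le_intervalIntegral {f : ℝ → ℝ} (hf : Continuous f) {a b : ℝ} (hab : a ≤ b) :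
    ∃ p ∈ Icc a b, (b - a) * f p ≤ ∫ x in a..b, f x := by
  obtain ⟨p, hp, hmin⟩ := isCompact_Icc.exists_isMinOn (nonempty_Icc.2 hab) hf.continuousOn
  have hconst : ∫ _ in a..b, f p ≤ ∫ x in a..b, f x :=
    intervalIntegral.integral_mono_on hab (by simp) (hf.intervalIntegrable _ _) fun x hx => hmin hx
  exact ⟨p, hp, by simpa using hconst⟩

theorem intervalIntegrable_of_integrableOn_Ioi {f : ℝ → ℝ} {a b c : ℝ}
    (hf : IntegrableOn f (Ioi c)) (hca : c ≤ a) (hab : a ≤ b) : IntervalIntegrable f volume a b :=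
  (intervalIntegrable_iff_integrableOn_Ioc_of_le hab).2
    (hf.mono_set (Ioc_subset_Ioi_self.trans (Ioi_subset_Ioi hca)))

theorem ae_restrict_Ioc_of_Ioi {P : ℝ → Prop} {a b c : ℝ}
    (hP : ∀ᵐ x ∂volume.restrict (Ioi c), P x) (hca : c ≤ a) :
    ∀ᵐ x ∂volume.restrict (Ioc a b), P x :=
  ae_restrict_of_ae_restrict_of_subset (Ioc_subset_Ioi_self.trans (Ioi_subset_Ioi hca)) hP

theorem intervalIntegral_le_integral_Ioi {f : ℝ → ℝ} {a b c : ℝ} (hf : IntegrableOn f (Ioi c))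
    (hf0 : ∀ᵐ x ∂volume.restrict (Ioi c), 0 ≤ f x) (hca : c ≤ a) (hab : a ≤ b) :
    ∫ x in a..b, f x ≤ ∫ x in Ioi c, f x := by
  rw [intervalIntegral.integral_of_le hab]
  exact setIntegral_mono_set hf hf0
    (Ioc_subset_Ioi_self.trans (Ioi_subset_Ioi hca)).eventuallyLE

/-- A partition `0 = b 0 < b 1 < ⋯ → ∞` of the half-line adapted to the density `g`: every interval
`I` of the partition satisfies `|I| ^ κ * ∫_I g = ε`. -/
structure IsAdaptedPartition (g : ℝ → ℝ) (κ ε : ℝ) (b : ℕ → ℝ) : Prop where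
  zero : b 0 = 0
  strictMono : StrictMono b
  tendsto_atTop : Tendsto b atTop atTop
  length_rpow_mul_integral (k : ℕ) :
    (b (k + 1) - b k) ^ κ * ∫ x in b k..b (k + 1), g x = ε

namespace IsAdaptedPartition

variable {g : ℝ → ℝ} {κ ε : ℝ} {b : ℕ → ℝ}

theorem nonneg (hb : IsAdaptedPartition g κ ε b) (k : ℕ) : 0 ≤ b k :=
  hb.zero ▸ hb.strictMono.monotone k.zero_le

theorem lt_succ (hb : IsAdaptedPartition g κ ε b) (k : ℕ) : b k < b (k + 1) :=
  hb.strictMono k.lt_succ_self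

theorem length_pos (hb : IsAdaptedPartition g κ ε b) (k : ℕ) : 0 < b (k + 1) - b k :=
  sub_pos.2 (hb.lt_succ k)

theorem sum_intervalIntegral (hb : IsAdaptedPartition g κ ε b) {f : ℝ → ℝ}
    (hf : IntegrableOn f (Ioi 0)) (n : ℕ) :
    ∑ k ∈ Finset.range n, ∫ x in b k..b (k + 1), f x = ∫ x in 0..b n, f x := by
  rw [intervalIntegral.sum_integral_adjacent_intervals fun k _ =>
    intervalIntegrable_of_integrableOn_Ioi hf (hb.nonneg k) (hb.lt_succ k).le, hb.zero]

theorem sum_intervalIntegral_le (hb : IsAdaptedPartition g κ ε b) {f : ℝ → ℝ}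
    (hf : IntegrableOn f (Ioi 0)) (hf0 : ∀ᵐ x ∂volume.restrict (Ioi 0), 0 ≤ f x) (n : ℕ) :
    ∑ k ∈ Finset.range n, ∫ x in b k..b (k + 1), f x ≤ ∫ x in Ioi 0, f x :=
  (hb.sum_intervalIntegral hf n).trans_le
    (intervalIntegral_le_integral_Ioi hf hf0 le_rfl (hb.nonneg n))

theorem sum_inv_length_rpow_le (hb : IsAdaptedPartition g κ ε b) (hε : 0 < ε)
    (hg : IntegrableOn g (Ioi 0)) (hg0 : ∀ᵐ x ∂volume.restrict (Ioi 0), 0 ≤ g x) (n : ℕ) :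
    ∑ k ∈ Finset.range n, ((b (k + 1) - b k) ^ κ)⁻¹ ≤ ε⁻¹ * ∫ x in Ioi 0, g x := by
  have hlength (k : ℕ) :
      ((b (k + 1) - b k) ^ κ)⁻¹ = ε⁻¹ * ∫ x in b k..b (k + 1), g x := by
    have hmass := hb.length_rpow_mul_integral k
    have : 0 < (b (k + 1) - b k) ^ κ := Real.rpow_pos_of_pos (hb.length_pos k) _
    field_simp
    linarith
  simp_rw [hlength]
  rw [← Finset.mul_sum]
  gcongr
  exact hb.sum_intervalIntegral_le hg hg0 n

end IsAdaptedPartition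

section Existence

variable {g : ℝ → ℝ} {κ ε : ℝ}

theorem exists_le_rpow_mul_intervalIntegral (hg : IntegrableOn g (Ioi 0))
    (hg0 : ∀ᵐ x ∂volume.restrict (Ioi 0), 0 ≤ g x)
    (hpos : ∀ a b, 0 ≤ a → a < b → 0 < ∫ x in a..b, g x) (hκ : 0 < κ) (hε : 0 < ε) {a : ℝ}
    (ha : 0 ≤ a) : ∃ b, a ≤ b ∧ ε ≤ (b - a) ^ κ * ∫ x in a..b, g x := by
  have hmass := hpos a (a + 1) ha (by linarith)
  set m := ∫ x in a..(a + 1), g x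
  set R := max 1 ((ε / m) ^ κ⁻¹)
  have hR : 1 ≤ R := le_max_left _ _
  refine ⟨a + R, by linarith, ?_⟩
  have mass_le : m ≤ ∫ x in a..(a + R), g x :=
    intervalIntegral.integral_mono_interval le_rfl (by linarith) (by linarith)
      (ae_restrict_Ioc_of_Ioi hg0 ha)
      (intervalIntegrable_of_integrableOn_Ioi hg ha (by linarith))
  have le_rpow : ε / m ≤ R ^ κ := by
    calc ε / m = ((ε / m) ^ κ⁻¹) ^ κ := (Real.rpow_inv_rpow (by positivity) hκ.ne').symm
      _ ≤ R ^ κ := Real.rpow_le_rpow (by positivity) (le_max_right _ _) hκ.le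
  calc ε ≤ R ^ κ * m := (div_le_iff₀ hmass).1 le_rpow
    _ ≤ (a + R - a) ^ κ * ∫ x in a..(a + R), g x := by
        rw [add_sub_cancel_left]
        gcongr

theorem exists_rpow_mul_intervalIntegral_eq (hg : IntegrableOn g (Ioi 0))
    (hg0 : ∀ᵐ x ∂volume.restrict (Ioi 0), 0 ≤ g x)
    (hpos : ∀ a b, 0 ≤ a → a < b → 0 < ∫ x in a..b, g x) (hκ : 0 < κ) (hε : 0 < ε) {a : ℝ}
    (ha : 0 ≤ a) : ∃ b, a < b ∧ (b - a) ^ κ * ∫ x in a..b, g x = ε := by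
  obtain ⟨c, hac, hc⟩ := exists_le_rpow_mul_intervalIntegral hg hg0 hpos hκ hε ha
  have hcont : ContinuousOn (fun b => (b - a) ^ κ * ∫ x in a..b, g x) (Icc a c) := by
    refine (Continuous.rpow_const (by fun_prop) fun _ => Or.inr hκ.le).continuousOn.mul ?_
    simpa only [uIcc_of_le hac] using
      intervalIntegral.continuousOn_primitive_interval'
        (intervalIntegrable_of_integrableOn_Ioi hg ha hac) left_mem_uIcc
  obtain ⟨b, hb, hbε⟩ := intermediate_value_Icc hac hcont
    (show ε ∈ Icc _ _ from ⟨by simpa using hε.le, hc⟩)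
  refine ⟨b, hb.1.lt_of_ne ?_, hbε⟩
  rintro rfl
  simp only [intervalIntegral.integral_same, mul_zero] at hbε
  exact hε.ne hbε

theorem tendsto_atTop_of_le_sub {b : ℕ → ℝ} {d : ℝ} (hd : 0 < d) (hb : ∀ k, d ≤ b (k + 1) - b k) :
    Tendsto b atTop atTop := by
  have hlinear (n : ℕ) : b 0 + n * d ≤ b n := by
    induction n with
    | zero => simp
    | succ n ih =>
      push_cast
      linarith [hb n]
  exact tendsto_atTop_mono hlinear
    (tendsto_atTop_add_const_left _ _ (tendsto_natCast_atTop_atTop.atTop_mul_const hd))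

theorem rpow_inv_div_integral_le_length (hg : IntegrableOn g (Ioi 0))
    (hg0 : ∀ᵐ x ∂volume.restrict (Ioi 0), 0 ≤ g x) (hmass : 0 < ∫ x in Ioi 0, g x) (hκ : 0 < κ)
    (hε : 0 < ε) {a b : ℝ} (ha : 0 ≤ a) (hab : a ≤ b)
    (hinterval : (b - a) ^ κ * ∫ x in a..b, g x = ε) :
    (ε / ∫ x in Ioi 0, g x) ^ κ⁻¹ ≤ b - a := by
  have hlen : 0 ≤ b - a := sub_nonneg.2 hab
  rw [Real.rpow_inv_le_iff_of_pos (by positivity) hlen hκ, div_le_iff₀ hmass, ← hinterval]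
  gcongr
  exact intervalIntegral_le_integral_Ioi hg hg0 ha hab

theorem exists_isAdaptedPartition (hg : IntegrableOn g (Ioi 0))
    (hg0 : ∀ᵐ x ∂volume.restrict (Ioi 0), 0 ≤ g x)
    (hpos : ∀ a b, 0 ≤ a → a < b → 0 < ∫ x in a..b, g x) (hκ : 0 < κ) (hε : 0 < ε) :
    ∃ b, IsAdaptedPartition g κ ε b := by
  choose! next lt_next mass_next using fun (a : ℝ) (ha : 0 ≤ a) =>
    exists_rpow_mul_intervalIntegral_eq hg hg0 hpos hκ hε ha
  let b : ℕ → ℝ := fun n => next^[n] 0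
  have b_succ (n : ℕ) : b (n + 1) = next (b n) := Function.iterate_succ_apply' next n 0
  have b_nonneg (n : ℕ) : 0 ≤ b n := by
    induction n with
    | zero => exact le_rfl
    | succ n ih => exact b_succ n ▸ ih.trans (lt_next _ ih).le
  have b_lt (n : ℕ) : b n < b (n + 1) := b_succ n ▸ lt_next _ (b_nonneg n)
  have b_mass (n : ℕ) : (b (n + 1) - b n) ^ κ * ∫ x in b n..b (n + 1), g x = ε :=
    b_succ n ▸ mass_next _ (b_nonneg n)
  have hmass : 0 < ∫ x in Ioi 0, g x := (hpos 0 1 le_rfl one_pos).trans_le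
    (intervalIntegral_le_integral_Ioi hg hg0 le_rfl zero_le_one)
  refine ⟨b, rfl, strictMono_nat_of_lt_succ b_lt, ?_, b_mass⟩
  exact tendsto_atTop_of_le_sub (Real.rpow_pos_of_pos (div_pos hε hmass) _) fun k =>
    rpow_inv_div_integral_le_length hg hg0 hmass hκ hε (b_nonneg k) (b_lt k).le (b_mass k)

end Existence

/-- The density `w` plus a strictly positive density of total mass `δ`, so that every interval of
the half-line gets positive mass. -/
def positiveDensity (w : ℝ → ℝ) (δ : ℝ) (x : ℝ) : ℝ := w x + δ * Real.exp (-x)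

section PositiveDensity

variable {w : ℝ → ℝ} {δ : ℝ}

theorem le_positiveDensity (w : ℝ → ℝ) (hδ : 0 ≤ δ) (x : ℝ) : w x ≤ positiveDensity w δ x :=
  le_add_of_nonneg_right (by positivity)

theorem integrableOn_positiveDensity (hw : IntegrableOn w (Ioi 0)) (δ : ℝ) :
    IntegrableOn (positiveDensity w δ) (Ioi 0) :=
  hw.add ((integrableOn_exp_neg_Ioi 0).const_mul δ)

theorem integral_positiveDensity (hw : IntegrableOn w (Ioi 0)) (δ : ℝ) :
    ∫ x in Ioi 0, positiveDensity w δ x = (∫ x in Ioi 0, w x) + δ := by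
  simp_rw [positiveDensity]
  rw [integral_add hw ((integrableOn_exp_neg_Ioi 0).const_mul δ), integral_const_mul,
    integral_exp_neg_Ioi_zero, mul_one]

theorem positiveDensity_nonneg_ae (hw0 : ∀ᵐ x ∂volume.restrict (Ioi 0), 0 ≤ w x) (hδ : 0 ≤ δ) :
    ∀ᵐ x ∂volume.restrict (Ioi 0), 0 ≤ positiveDensity w δ x :=
  hw0.mono fun x hx => hx.trans (le_positiveDensity w hδ x)

theorem intervalIntegral_positiveDensity_pos (hw : IntegrableOn w (Ioi 0))
    (hw0 : ∀ᵐ x ∂volume.restrict (Ioi 0), 0 ≤ w x) (hδ : 0 < δ) {a b : ℝ} (ha : 0 ≤ a)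
    (hab : a < b) : 0 < ∫ x in a..b, positiveDensity w δ x := by
  have hexp : 0 < ∫ x in a..b, δ * Real.exp (-x) :=
    intervalIntegral.intervalIntegral_pos_of_pos (Continuous.intervalIntegrable (by fun_prop) _ _)
      (fun x => by positivity) hab
  refine hexp.trans_le (intervalIntegral.integral_mono_ae_restrict hab.le
    (Continuous.intervalIntegrable (by fun_prop) _ _)
    (intervalIntegrable_of_integrableOn_Ioi (integrableOn_positiveDensity hw δ) ha hab.le) ?_)
  rw [← restrict_Ioc_eq_restrict_Icc]
  exact (ae_restrict_Ioc_of_Ioi hw0 ha).mono fun x hx => le_add_of_nonneg_left hx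

end PositiveDensity

end Partition

section EvaluationBound

variable {ν : ℝ}

theorem norm_sq_le_of_average (u : 𝓓(halfLine, ℂ)) (hν₀ : 0 ≤ ν) (hν₃ : ν < 3) {a b x : ℝ}
    (ha : 0 ≤ a) (hab : a < b) (hx : x ∈ Ioc a b) :
    ‖u x‖ ^ 2 ≤ boundConst ν * (x ^ ν * (b - a) ^ (3 - ν) *
      ((∫ t in a..b, hardyDensity u t) + 6 * (b - a)⁻¹ ^ 4 * ∫ t in a..b, ‖u t‖ ^ 2)) := by
  have hlen : 0 < b - a := sub_pos.2 hab
  have hcont : Continuous fun t => ‖u t‖ ^ 2 := by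
    have := u.continuous
    fun_prop
  obtain ⟨p, hp, hpi⟩ :=
    exists_le_intervalIntegral hcont (a := a) (b := a + (b - a) / 3) (by linarith)
  obtain ⟨q, hq, hqi⟩ :=
    exists_le_intervalIntegral hcont (a := b - (b - a) / 3) (b := b) (by linarith)
  have integral_sub_le {c d : ℝ} (hac : a ≤ c) (hcd : c ≤ d) (hdb : d ≤ b) :
      ∫ t in c..d, ‖u t‖ ^ 2 ≤ ∫ t in a..b, ‖u t‖ ^ 2 :=
    intervalIntegral.integral_mono_interval hac hcd hdb
      (Eventually.of_forall fun t => by positivity) (hcont.intervalIntegrable _ _)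
  have hpN := hpi.trans (integral_sub_le le_rfl (by linarith) (by linarith))
  have hqN := hqi.trans (integral_sub_le (by linarith) (by linarith) le_rfl)
  set N := ∫ t in a..b, ‖u t‖ ^ 2
  have endpoints_le : (b - a)⁻¹ ^ 3 * (‖u p‖ ^ 2 + ‖u q‖ ^ 2) ≤ 6 * (b - a)⁻¹ ^ 4 * N := by
    calc (b - a)⁻¹ ^ 3 * (‖u p‖ ^ 2 + ‖u q‖ ^ 2)
        = (b - a)⁻¹ ^ 4 * ((b - a) * (‖u p‖ ^ 2 + ‖u q‖ ^ 2)) := by field_simp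
      _ ≤ (b - a)⁻¹ ^ 4 * (6 * N) := mul_le_mul_of_nonneg_left (by linarith) (by positivity)
      _ = 6 * (b - a)⁻¹ ^ 4 * N := by ring
  have hx0 : 0 < x := ha.trans_lt hx.1
  have hconst := boundConst_pos hν₃
  refine (norm_sq_le_on_interval u hν₀ hν₃ ha hab hx hp hq).trans ?_
  gcongr

theorem intervalIntegral_hardyDensity_le (u : 𝓓(halfLine, ℂ)) {a b : ℝ} (ha : 0 ≤ a)
    (hab : a ≤ b) : ∫ t in a..b, hardyDensity u t ≤ ‖hardyOp u‖ ^ 2 :=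
  norm_sq_hardyOp u ▸ intervalIntegral_le_integral_Ioi (integrable_hardyDensity u).integrableOn
    (Eventually.of_forall fun t => hardyDensity_nonneg _ t) ha hab

theorem intervalIntegral_norm_sq_le (u : 𝓓(halfLine, ℂ)) {a b : ℝ} (ha : 0 ≤ a) (hab : a ≤ b) :
    ∫ t in a..b, ‖u t‖ ^ 2 ≤ ‖toL2 u‖ ^ 2 :=
  norm_sq_toL2 u ▸ intervalIntegral_le_integral_Ioi (integrable_norm_sq (memLp_test u))
    (Eventually.of_forall fun t => by positivity) ha hab

theorem exists_norm_sq_eval_le (x : ℝ) : ∃ C, ∀ u : 𝓓(halfLine, ℂ),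
    ‖u x‖ ^ 2 ≤ C * (‖toL2 u‖ ^ 2 + ‖hardyOp u‖ ^ 2) := by
  rcases le_or_gt x 0 with hx | hx
  · refine ⟨0, fun u => ?_⟩
    simp [test_eq_zero fun h => (u.tsupport_subset h : 0 < x).not_ge hx]
  refine ⟨boundConst 0 * x ^ (3 : ℝ) * (1 + 6 * x⁻¹ ^ 4), fun u => ?_⟩
  have hle := norm_sq_le_of_average u le_rfl zero_lt_three le_rfl hx (right_mem_Ioc.2 hx)
  simp only [sub_zero, Real.rpow_zero, one_mul] at hle
  have hconst := boundConst_pos zero_lt_three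
  have hD := intervalIntegral_hardyDensity_le u le_rfl hx.le
  have hN := intervalIntegral_norm_sq_le u le_rfl hx.le
  calc ‖u x‖ ^ 2 ≤ boundConst 0 * (x ^ (3 : ℝ) *
        (‖hardyOp u‖ ^ 2 + 6 * x⁻¹ ^ 4 * ‖toL2 u‖ ^ 2)) := hle.trans (by gcongr)
    _ ≤ boundConst 0 * (x ^ (3 : ℝ) *
        ((1 + 6 * x⁻¹ ^ 4) * (‖toL2 u‖ ^ 2 + ‖hardyOp u‖ ^ 2))) := by
        gcongr
        have : 0 ≤ 6 * x⁻¹ ^ 4 * ‖hardyOp u‖ ^ 2 := by positivity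
        linarith [sq_nonneg ‖toL2 u‖]
    _ = _ := by ring

end EvaluationBound

section PotentialBound

variable {ν : ℝ} {U : ℝ → ℝ}

theorem integrableOn_mul_norm_sq (hU : IntegrableOn (fun x => U x * x ^ ν) (Ioi 0))
    (u : 𝓓(halfLine, ℂ)) : IntegrableOn (fun x => U x * ‖u x‖ ^ 2) (Ioi 0) := by
  have hrpow : ContinuousOn (fun x : ℝ => x ^ (-ν)) (Ioi 0) :=
    continuousOn_id.rpow_const fun x hx => Or.inl (ne_of_gt hx)
  have hsupport : tsupport (fun x => ‖u x‖ ^ 2) ⊆ tsupport u :=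
    closure_mono fun x hx => by simpa using hx
  have hcont : Continuous fun x : ℝ => x ^ (-ν) • ‖u x‖ ^ 2 :=
    continuous_smul_of_tsupport_subset isOpen_Ioi hrpow (by have := u.continuous; fun_prop)
      (hsupport.trans u.tsupport_subset)
  obtain ⟨C, hC⟩ := hcont.bounded_above_of_compact_support
    (HasCompactSupport.intro u.hasCompactSupport fun x hx => by simp [test_eq_zero hx])
  refine (integrableOn_congr_fun (fun x hx => ?_) measurableSet_Ioi).1
    (hU.mul_bdd (c := C) hcont.aestronglyMeasurable (Eventually.of_forall hC))
  have hx0 : (0 : ℝ) < x := hx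
  rw [smul_eq_mul, mul_assoc, ← mul_assoc (x ^ ν), ← Real.rpow_add hx0, add_neg_cancel,
    Real.rpow_zero, one_mul]

theorem intervalIntegral_mul_le_mul_intervalIntegral {f h g : ℝ → ℝ} {a b c : ℝ} (hab : a ≤ b)
    (hc : 0 ≤ c) (hU0 : ∀ᵐ x ∂volume.restrict (Ioc a b), 0 ≤ U x)
    (hUf : IntervalIntegrable (fun x => U x * f x) volume a b)
    (hg : IntervalIntegrable g volume a b)
    (hfh : ∀ x ∈ Ioc a b, f x ≤ c * h x) (hUh : ∀ x, U x * h x ≤ g x) :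
    ∫ x in a..b, U x * f x ≤ c * ∫ x in a..b, g x := by
  rw [← intervalIntegral.integral_const_mul]
  refine intervalIntegral.integral_mono_ae_restrict hab hUf (hg.const_mul c) ?_
  rw [← restrict_Ioc_eq_restrict_Icc]
  filter_upwards [hU0, ae_restrict_mem measurableSet_Ioc] with x hx0 hx
  calc U x * f x ≤ U x * (c * h x) := by
        gcongr
        exact hfh x hx
    _ = c * (U x * h x) := by ring
    _ ≤ c * g x := by
        gcongr
        exact hUh x

theorem intervalIntegral_mul_le_of_mass_eq (hν₃ : ν < 3) {a b Y δ : ℝ} (ha : 0 ≤ a) (hab : a < b)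
    (hδ : 0 ≤ δ) (hY : 0 ≤ Y) {f : ℝ → ℝ} (hU0 : ∀ᵐ x ∂volume.restrict (Ioi 0), 0 ≤ U x)
    (hU : IntegrableOn (fun x => U x * x ^ ν) (Ioi 0))
    (hUf : IntegrableOn (fun x => U x * f x) (Ioi 0))
    (hmass : (b - a) ^ (3 - ν) * ∫ x in a..b, positiveDensity (fun x => U x * x ^ ν) δ x =
      (boundConst ν)⁻¹)
    (hf : ∀ x ∈ Ioc a b, f x ≤ boundConst ν * (x ^ ν * (b - a) ^ (3 - ν) * Y)) :
    ∫ x in a..b, U x * f x ≤ Y := by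
  have : 0 < b - a := sub_pos.2 hab
  have hconst := boundConst_pos hν₃
  calc ∫ x in a..b, U x * f x
      ≤ boundConst ν * (b - a) ^ (3 - ν) * Y *
          ∫ x in a..b, positiveDensity (fun x => U x * x ^ ν) δ x :=
        intervalIntegral_mul_le_mul_intervalIntegral (h := fun x => x ^ ν) hab.le (by positivity)
          (ae_restrict_Ioc_of_Ioi hU0 ha) (intervalIntegrable_of_integrableOn_Ioi hUf ha hab.le)
          (intervalIntegrable_of_integrableOn_Ioi (integrableOn_positiveDensity hU δ) ha hab.le)
          (fun x hx => (hf x hx).trans_eq (by ring))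
          fun x => le_positiveDensity (fun x => U x * x ^ ν) hδ x
    _ = boundConst ν * ((b - a) ^ (3 - ν) *
          ∫ x in a..b, positiveDensity (fun x => U x * x ^ ν) δ x) * Y := by ring
    _ = Y := by rw [hmass, mul_inv_cancel₀ hconst.ne', one_mul]

theorem setIntegral_Ioi_eq_intervalIntegral_of_tsupport {u : 𝓓(halfLine, ℂ)} {f : ℝ → ℝ} {R : ℝ}
    (hR : 0 ≤ R) (hu : ∀ x ∈ tsupport u, x ≤ R) (hf : ∀ x, u x = 0 → f x = 0) :
    ∫ x in Ioi 0, f x = ∫ x in 0..R, f x := by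
  rw [intervalIntegral.integral_of_le hR]
  refine setIntegral_eq_of_subset_of_forall_sdiff_eq_zero measurableSet_Ioi Ioc_subset_Ioi_self
    fun x hx => hf x (test_eq_zero fun hxu => hx.2 ⟨hx.1, hu x hxu⟩)

section

variable {δ : ℝ} {b : ℕ → ℝ}

theorem intervalIntegral_mul_norm_sq_le (hν₀ : 0 ≤ ν) (hν₃ : ν < 3) (hδ : 0 ≤ δ)
    (hU0 : ∀ᵐ x ∂volume.restrict (Ioi 0), 0 ≤ U x)
    (hU : IntegrableOn (fun x => U x * x ^ ν) (Ioi 0))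
    (hb : IsAdaptedPartition (positiveDensity (fun x => U x * x ^ ν) δ) (3 - ν) (boundConst ν)⁻¹ b)
    {τ : ℝ} (hτ : 0 ≤ τ) {S : Finset ℕ} (hS : ∀ k ∉ S, 6 * (b (k + 1) - b k)⁻¹ ^ 4 ≤ τ)
    (u : 𝓓(halfLine, ℂ)) (k : ℕ) :
    ∫ x in b k..b (k + 1), U x * ‖u x‖ ^ 2 ≤
      (∫ x in b k..b (k + 1), hardyDensity u x) + τ * (∫ x in b k..b (k + 1), ‖u x‖ ^ 2) +
        if k ∈ S then (b (k + 1) - b k)⁻¹ ^ 3 * (‖u (b k)‖ ^ 2 + ‖u (b (k + 1))‖ ^ 2) else 0 := by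
  have hlen := hb.length_pos k
  have hD : 0 ≤ ∫ x in b k..b (k + 1), hardyDensity u x :=
    intervalIntegral_hardyDensity_nonneg _ (hb.lt_succ k).le
  have hN : 0 ≤ ∫ x in b k..b (k + 1), ‖u x‖ ^ 2 :=
    intervalIntegral.integral_nonneg (hb.lt_succ k).le fun t _ => by positivity
  have bound_of_pointwise {Y : ℝ} (hY : 0 ≤ Y) (hu : ∀ x ∈ Ioc (b k) (b (k + 1)),
      ‖u x‖ ^ 2 ≤ boundConst ν * (x ^ ν * (b (k + 1) - b k) ^ (3 - ν) * Y)) :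
      ∫ x in b k..b (k + 1), U x * ‖u x‖ ^ 2 ≤ Y :=
    intervalIntegral_mul_le_of_mass_eq hν₃ (hb.nonneg k) (hb.lt_succ k) hδ hY hU0 hU
      (integrableOn_mul_norm_sq hU u) (hb.length_rpow_mul_integral k) hu
  split_ifs with hk
  · have hle := bound_of_pointwise (add_nonneg hD (by positivity)) fun x hx =>
      norm_sq_le_on_interval u hν₀ hν₃ (hb.nonneg k) (hb.lt_succ k) hx (p := b k) (q := b (k + 1))
        ⟨le_rfl, by linarith⟩ ⟨by linarith, le_rfl⟩
    linarith [mul_nonneg hτ hN]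
  · have hle := bound_of_pointwise (add_nonneg hD (by positivity)) fun x hx =>
      norm_sq_le_of_average u hν₀ hν₃ (hb.nonneg k) (hb.lt_succ k) hx
    linarith [mul_le_mul_of_nonneg_right (hS k hk) hN]

theorem integral_mul_norm_sq_le (hν₀ : 0 ≤ ν) (hν₃ : ν < 3) (hδ : 0 ≤ δ)
    (hU0 : ∀ᵐ x ∂volume.restrict (Ioi 0), 0 ≤ U x)
    (hU : IntegrableOn (fun x => U x * x ^ ν) (Ioi 0))
    (hb : IsAdaptedPartition (positiveDensity (fun x => U x * x ^ ν) δ) (3 - ν) (boundConst ν)⁻¹ b)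
    {τ : ℝ} (hτ : 0 ≤ τ) {S : Finset ℕ} (hS : ∀ k ∉ S, 6 * (b (k + 1) - b k)⁻¹ ^ 4 ≤ τ)
    (u : 𝓓(halfLine, ℂ)) :
    ∫ x in Ioi 0, U x * ‖u x‖ ^ 2 ≤ ‖hardyOp u‖ ^ 2 + τ * ‖toL2 u‖ ^ 2 +
      ∑ k ∈ S, (b (k + 1) - b k)⁻¹ ^ 3 * (‖u (b k)‖ ^ 2 + ‖u (b (k + 1))‖ ^ 2) := by
  obtain ⟨R, hR⟩ := u.hasCompactSupport.isCompact.bddAbove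
  obtain ⟨n, hn⟩ := (hb.tendsto_atTop.eventually_ge_atTop R).exists
  rw [setIntegral_Ioi_eq_intervalIntegral_of_tsupport (hb.nonneg n) (fun x hx => (hR hx).trans hn)
      fun x hx => by simp [hx], ← hb.sum_intervalIntegral (integrableOn_mul_norm_sq hU u)]
  refine (Finset.sum_le_sum fun k _ =>
    intervalIntegral_mul_norm_sq_le hν₀ hν₃ hδ hU0 hU hb hτ hS u k).trans ?_
  rw [Finset.sum_add_distrib, Finset.sum_add_distrib, ← Finset.mul_sum, norm_sq_hardyOp,
    norm_sq_toL2, ← Finset.sum_filter]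
  gcongr
  · exact hb.sum_intervalIntegral_le (integrable_hardyDensity u).integrableOn
      (Eventually.of_forall fun t => hardyDensity_nonneg _ t) n
  · exact hb.sum_intervalIntegral_le (integrable_norm_sq (memLp_test u))
      (Eventually.of_forall fun t => by positivity) n
  · intro k _ _
    have := hb.length_pos k
    positivity
  · exact fun k hk => (Finset.mem_filter.1 hk).2

end

theorem exists_partition_bound (hν₀ : 0 ≤ ν) (hν₃ : ν < 3)
    (hU0 : ∀ᵐ x ∂volume.restrict (Ioi 0), 0 ≤ U x)
    (hU : IntegrableOn (fun x => U x * x ^ ν) (Ioi 0)) {δ : ℝ} (hδ : 0 < δ) :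
    ∃ b : ℕ → ℝ, StrictMono b ∧
      (∀ n, ∑ k ∈ Finset.range n, ((b (k + 1) - b k) ^ (3 - ν))⁻¹ ≤
        boundConst ν * ((∫ x in Ioi 0, U x * x ^ ν) + δ)) ∧
      ∀ (τ : ℝ) (S : Finset ℕ), 0 ≤ τ → (∀ k ∉ S, 6 * (b (k + 1) - b k)⁻¹ ^ 4 ≤ τ) →
        ∀ u : 𝓓(halfLine, ℂ), ∫ x in Ioi 0, U x * ‖u x‖ ^ 2 ≤
          ‖hardyOp u‖ ^ 2 + τ * ‖toL2 u‖ ^ 2 +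
            ∑ k ∈ S, (b (k + 1) - b k)⁻¹ ^ 3 * (‖u (b k)‖ ^ 2 + ‖u (b (k + 1))‖ ^ 2) := by
  have hconst : 0 < (boundConst ν)⁻¹ := inv_pos.2 (boundConst_pos hν₃)
  have hw0 : ∀ᵐ x ∂volume.restrict (Ioi 0), 0 ≤ U x * x ^ ν := by
    filter_upwards [hU0, ae_restrict_mem measurableSet_Ioi] with x hx hx0
    exact mul_nonneg hx (Real.rpow_nonneg (le_of_lt hx0) _)
  have hg := integrableOn_positiveDensity hU δ
  have hg0 := positiveDensity_nonneg_ae hw0 hδ.le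
  obtain ⟨b, hb⟩ := exists_isAdaptedPartition hg hg0
    (fun _ _ ha hab => intervalIntegral_positiveDensity_pos hU hw0 hδ ha hab)
    (sub_pos.2 hν₃) hconst
  refine ⟨b, hb.strictMono, fun n => ?_, fun τ S hτ hS u =>
    integral_mul_norm_sq_le hν₀ hν₃ hδ.le hU0 hU hb hτ hS u⟩
  simpa only [inv_inv, integral_positiveDensity hU] using
    hb.sum_inv_length_rpow_le hconst hg hg0 n

end PotentialBound

/-! ### The form of the potential -/

section Potential

/-- The non-negative potentials `V` for which `∫ V |u|²` is finite for every `u ∈ C₀^∞(0, ∞)`. -/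
structure IsAdmissible (V : ℝ → ℝ) : Prop where
  aemeasurable : AEMeasurable V (volume.restrict (Ioi 0))
  nonneg : ∀ᵐ x ∂volume.restrict (Ioi 0), 0 ≤ V x
  integrable : ∀ u : 𝓓(halfLine, ℂ), IntegrableOn (fun x => V x * ‖u x‖ ^ 2) (Ioi 0)

section Admissible

variable {ν : ℝ} {V U : ℝ → ℝ}

theorem IsAdmissible.memLp_sqrt_mul (hV : IsAdmissible V) (u : 𝓓(halfLine, ℂ)) :
    MemLp (fun x => (√(V x) : ℂ) * u x) 2 (volume.restrict (Ioi 0)) := by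
  have hmeas : AEStronglyMeasurable (fun x => (√(V x) : ℂ) * u x) (volume.restrict (Ioi 0)) :=
    (Complex.measurable_ofReal.comp_aemeasurable
      hV.aemeasurable.sqrt).aestronglyMeasurable.mul u.continuous.aestronglyMeasurable
  rw [memLp_two_iff_integrable_sq_norm hmeas]
  exact (hV.integrable u).congr (hV.nonneg.mono fun _ hx => (norm_sq_sqrt_mul hx _).symm)

/-- Multiplication by `√V`, from `C₀^∞(0, ∞)` to `L²(0, ∞)`. -/
def sqrtPotential (hV : IsAdmissible V) : 𝓓(halfLine, ℂ) →ₗ[ℂ] L2 :=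
  lpMap
    { toFun := fun u x => (√(V x) : ℂ) * u x
      map_add' := fun _ _ => funext fun _ => mul_add _ _ _
      map_smul' := fun _ _ => funext fun _ => mul_left_comm _ _ _ }
    hV.memLp_sqrt_mul

theorem norm_sq_sqrtPotential (hV : IsAdmissible V) (u : 𝓓(halfLine, ℂ)) :
    ‖sqrtPotential hV u‖ ^ 2 = ∫ x in Ioi 0, V x * ‖u x‖ ^ 2 :=
  (norm_sq_toLp (hV.memLp_sqrt_mul u)).trans
    (integral_congr_ae (hV.nonneg.mono fun _ hx => norm_sq_sqrt_mul hx _))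

theorem IsAdmissible.integrableOn_energyDensity (hV : IsAdmissible V) (u : 𝓓(halfLine, ℂ)) :
    IntegrableOn (energyDensity V u) (Ioi 0) :=
  (integrable_hardyRellich u).integrableOn.sub (hV.integrable u)

theorem IsAdmissible.energy_eq (hV : IsAdmissible V) (u : 𝓓(halfLine, ℂ)) :
    energy V u = ‖hardyOp u‖ ^ 2 - ‖sqrtPotential hV u‖ ^ 2 := by
  rw [norm_sq_hardyOp, norm_sq_sqrtPotential, ← integral_hardyRellich]
  exact integral_sub (integrable_hardyRellich u).integrableOn (hV.integrable u)

theorem norm_sq_sqrtPotential_le (hV : IsAdmissible V) {σ : ℝ}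
    (hVU : ∀ᵐ x ∂volume.restrict (Ioi 0), V x ≤ U x + σ)
    (hU : IntegrableOn (fun x => U x * x ^ ν) (Ioi 0)) (u : 𝓓(halfLine, ℂ)) :
    ‖sqrtPotential hV u‖ ^ 2 ≤ (∫ x in Ioi 0, U x * ‖u x‖ ^ 2) + σ * ‖toL2 u‖ ^ 2 := by
  have hUu := integrableOn_mul_norm_sq hU u
  have hσu := (integrable_norm_sq (memLp_test u)).const_mul σ
  rw [norm_sq_sqrtPotential, norm_sq_toL2, ← integral_const_mul, ← integral_add hUu hσu]
  refine integral_mono_ae (hV.integrable u) (hUu.add hσu) ?_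
  filter_upwards [hVU] with x hx
  rw [← add_mul]
  gcongr

/-- Point evaluation, as a linear functional on `C₀^∞(0, ∞)`. -/
def evalTest (x : ℝ) : 𝓓(halfLine, ℂ) →ₗ[ℂ] ℂ where
  toFun u := u x
  map_add' _ _ := rfl
  map_smul' _ _ := rfl

theorem exists_partition_boundedBelowUpToRank {hV : IsAdmissible V}
    (h : IsFormPerturbation toL2 hardyOp (sqrtPotential hV)) (hν₀ : 0 ≤ ν) (hν₃ : ν < 3) {σ : ℝ}
    (hVU : ∀ᵐ x ∂volume.restrict (Ioi 0), V x ≤ U x + σ)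
    (hU0 : ∀ᵐ x ∂volume.restrict (Ioi 0), 0 ≤ U x)
    (hU : IntegrableOn (fun x => U x * x ^ ν) (Ioi 0)) {δ : ℝ} (hδ : 0 < δ) :
    ∃ b : ℕ → ℝ, StrictMono b ∧
      (∀ n, ∑ k ∈ Finset.range n, ((b (k + 1) - b k) ^ (3 - ν))⁻¹ ≤
        boundConst ν * ((∫ x in Ioi 0, U x * x ^ ν) + δ)) ∧
      ∀ (τ : ℝ) (S : Finset ℕ), 0 ≤ τ → (∀ k ∉ S, 6 * (b (k + 1) - b k)⁻¹ ^ 4 ≤ τ) →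
        h.closure.BoundedBelowUpToRank (σ + τ) (2 * S.card) := by
  obtain ⟨b, hmono, hsum, hb⟩ := exists_partition_bound hν₀ hν₃ hU0 hU hδ
  refine ⟨b, hmono, hsum, fun τ S hτ hS => ?_⟩
  let weight (k : S) : ℝ := (b (k + 1) - b k)⁻¹ ^ 3
  have hweight (k : S) : 0 ≤ weight k :=
    pow_nonneg (inv_nonneg.2 (sub_nonneg.2 (hmono.monotone (Nat.le_succ _)))) 3
  have hcard : Fintype.card (S ⊕ S) = 2 * S.card := by
    rw [Fintype.card_sum, Fintype.card_coe, two_mul]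
  rw [← hcard]
  refine h.boundedBelowUpToRank_closure_of_weighted_sum
    (Sum.elim (fun k : S => evalTest (b k)) fun k : S => evalTest (b (k + 1)))
    (c := Sum.elim weight weight) (Sum.forall.2 ⟨hweight, hweight⟩)
    (Sum.forall.2 ⟨fun k => exists_norm_sq_eval_le (b k),
      fun k => exists_norm_sq_eval_le (b (k + 1))⟩) fun u => ?_
  have hendpoints : ∑ i : S ⊕ S, Sum.elim weight weight i *
      ‖Sum.elim (fun k : S => evalTest (b k)) (fun k : S => evalTest (b (k + 1))) i u‖ ^ 2 =
      ∑ k ∈ S, (b (k + 1) - b k)⁻¹ ^ 3 * (‖u (b k)‖ ^ 2 + ‖u (b (k + 1))‖ ^ 2) := by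
    rw [Fintype.sum_sum_type, ← Finset.sum_coe_sort S, ← Finset.sum_add_distrib]
    exact Finset.sum_congr rfl fun k _ => (mul_add _ _ _).symm
  rw [hendpoints]
  linarith [hb τ S hτ hS u, norm_sq_sqrtPotential_le hV hVU hU u]

end Admissible

section PowerIntegrable

theorem max_sub_zero_le {v σ p : ℝ} (hv : 0 ≤ v) (hσ : 0 < σ) (hp : 1 ≤ p) :
    max (v - σ) 0 ≤ σ ^ (1 - p) * v ^ p := by
  have hnonneg : 0 ≤ σ ^ (1 - p) * v ^ p := by positivity
  refine max_le ?_ hnonneg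
  rcases le_or_gt v σ with hvσ | hσv
  · exact (sub_nonpos.2 hvσ).trans hnonneg
  · have hv0 : 0 < v := hσ.trans hσv
    calc v - σ ≤ v := by linarith
      _ = v ^ (1 - p) * v ^ p := by rw [← Real.rpow_add hv0]; simp
      _ ≤ σ ^ (1 - p) * v ^ p := by
          gcongr ?_ * _
          exact Real.rpow_le_rpow_of_nonpos hσ hσv.le (by linarith)

theorem le_max_sub_add (v σ : ℝ) : v ≤ max (v - σ) 0 + σ := by linarith [le_max_left (v - σ) 0]

theorem inv_pow_four_le {ℓ κ Q : ℝ} (hℓ : 0 < ℓ) (hκ : 0 < κ) (hQ : (ℓ ^ κ)⁻¹ ≤ Q) :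
    ℓ⁻¹ ^ 4 ≤ Q ^ (4 / κ) := by
  calc ℓ⁻¹ ^ 4 = ((ℓ ^ κ)⁻¹) ^ (4 / κ) := by
        rw [← Real.inv_rpow hℓ.le, ← Real.rpow_mul (by positivity), mul_div_cancel₀ _ hκ.ne',
          ← Real.rpow_natCast]
        norm_num
    _ ≤ Q ^ (4 / κ) := Real.rpow_le_rpow (by positivity) hQ (by positivity)

variable {ν p : ℝ} {V U : ℝ → ℝ}

theorem aemeasurable_of_rpow_mul_rpow (hp : p ≠ 0)
    (hV0 : ∀ᵐ x ∂volume.restrict (Ioi 0), 0 ≤ V x)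
    (hVp : AEMeasurable (fun x : ℝ => V x ^ p * x ^ ν) (volume.restrict (Ioi 0))) :
    AEMeasurable V (volume.restrict (Ioi 0)) := by
  have hroot : AEMeasurable (fun x : ℝ => ((V x ^ p * x ^ ν) * x ^ (-ν)) ^ p⁻¹)
      (volume.restrict (Ioi 0)) :=
    (hVp.mul (measurable_id.pow_const (-ν)).aemeasurable).pow_const _
  refine hroot.congr ?_
  filter_upwards [hV0, ae_restrict_mem measurableSet_Ioi] with x hx hx0
  rw [mul_assoc, ← Real.rpow_add hx0, add_neg_cancel, Real.rpow_zero, mul_one,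
    Real.rpow_rpow_inv hx hp]

theorem integrableOn_max_sub (hp : 1 ≤ p) (hV0 : ∀ᵐ x ∂volume.restrict (Ioi 0), 0 ≤ V x)
    (hVp : IntegrableOn (fun x : ℝ => V x ^ p * x ^ ν) (Ioi 0)) {σ : ℝ} (hσ : 0 < σ) :
    IntegrableOn (fun x => max (V x - σ) 0 * x ^ ν) (Ioi 0) := by
  have hmeas := aemeasurable_of_rpow_mul_rpow (by linarith) hV0
    hVp.aestronglyMeasurable.aemeasurable
  refine (hVp.const_mul (σ ^ (1 - p))).mono' (((hmeas.sub_const σ).max aemeasurable_const).mul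
    (measurable_id.pow_const ν).aemeasurable).aestronglyMeasurable ?_
  filter_upwards [hV0, ae_restrict_mem measurableSet_Ioi] with x hx hx0
  have hxν : 0 ≤ x ^ ν := Real.rpow_nonneg (le_of_lt hx0) ν
  rw [Real.norm_of_nonneg (by positivity), ← mul_assoc]
  gcongr
  exact max_sub_zero_le hx hσ hp

theorem isAdmissible_of_integrableOn_rpow (hp : 1 ≤ p)
    (hV0 : ∀ᵐ x ∂volume.restrict (Ioi 0), 0 ≤ V x)
    (hVp : IntegrableOn (fun x : ℝ => V x ^ p * x ^ ν) (Ioi 0)) : IsAdmissible V := by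
  have hmeas := aemeasurable_of_rpow_mul_rpow (by linarith) hV0
    hVp.aestronglyMeasurable.aemeasurable
  refine ⟨hmeas, hV0, fun u => ?_⟩
  have hcont : Continuous fun x => ‖u x‖ ^ 2 := by
    have := u.continuous
    fun_prop
  refine ((integrableOn_mul_norm_sq (integrableOn_max_sub hp hV0 hVp one_pos) u).add
    (integrable_norm_sq (memLp_test u))).mono'
      (hmeas.aestronglyMeasurable.mul hcont.aestronglyMeasurable) ?_
  filter_upwards [hV0] with x hx
  rw [Real.norm_of_nonneg (by positivity)]
  calc V x * ‖u x‖ ^ 2 ≤ (max (V x - 1) 0 + 1) * ‖u x‖ ^ 2 := by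
        gcongr
        exact le_max_sub_add _ _
    _ = max (V x - 1) 0 * ‖u x‖ ^ 2 + ‖u x‖ ^ 2 := by ring

theorem exists_integral_mul_norm_sq_le (hν₀ : 0 ≤ ν) (hν₃ : ν < 3)
    (hU0 : ∀ᵐ x ∂volume.restrict (Ioi 0), 0 ≤ U x)
    (hU : IntegrableOn (fun x => U x * x ^ ν) (Ioi 0)) :
    ∃ c, ∀ u : 𝓓(halfLine, ℂ),
      ∫ x in Ioi 0, U x * ‖u x‖ ^ 2 ≤ ‖hardyOp u‖ ^ 2 + c * ‖toL2 u‖ ^ 2 := by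
  obtain ⟨b, hmono, hsum, hb⟩ := exists_partition_bound hν₀ hν₃ hU0 hU one_pos
  have hlen (k : ℕ) : 0 < b (k + 1) - b k := sub_pos.2 (hmono k.lt_succ_self)
  set Q := boundConst ν * ((∫ x in Ioi 0, U x * x ^ ν) + 1)
  have inv_length_le (k : ℕ) : ((b (k + 1) - b k) ^ (3 - ν))⁻¹ ≤ Q :=
    (Finset.single_le_sum (f := fun k => ((b (k + 1) - b k) ^ (3 - ν))⁻¹)
      (fun i _ => inv_nonneg.2 (Real.rpow_nonneg (hlen i).le _))
      (Finset.self_mem_range_succ k)).trans (hsum (k + 1))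
  have hQ : 0 ≤ Q := by simpa using hsum 0
  refine ⟨6 * Q ^ (4 / (3 - ν)), fun u => ?_⟩
  simpa using hb (6 * Q ^ (4 / (3 - ν))) ∅ (by positivity) (fun k _ => by
    gcongr
    exact inv_pow_four_le (hlen k) (sub_pos.2 hν₃) (inv_length_le k)) u

theorem exists_norm_sq_sqrtPotential_le (hν₀ : 0 ≤ ν) (hν₃ : ν < 3) (hp : 1 ≤ p)
    (hV : IsAdmissible V) (hVp : IntegrableOn (fun x : ℝ => V x ^ p * x ^ ν) (Ioi 0))
    {θ : ℝ} (hθ : 0 < θ) :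
    ∃ c, ∀ u, ‖sqrtPotential hV u‖ ^ 2 ≤ θ * ‖hardyOp u‖ ^ 2 + c * ‖toL2 u‖ ^ 2 := by
  have hU := integrableOn_max_sub hp hV.nonneg hVp one_pos
  obtain ⟨c, hc⟩ := exists_integral_mul_norm_sq_le (U := fun x => θ⁻¹ * max (V x - 1) 0) hν₀ hν₃
    (Eventually.of_forall fun x => by positivity)
    (by simpa only [mul_assoc, IntegrableOn] using hU.const_mul θ⁻¹)
  refine ⟨θ * c + 1, fun u => ?_⟩
  have hscaled := hc u
  simp_rw [mul_assoc, integral_const_mul] at hscaled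
  rw [inv_mul_le_iff₀ hθ] at hscaled
  linarith [norm_sq_sqrtPotential_le hV
    (Eventually.of_forall fun x => le_max_sub_add (V x) 1) hU u]

theorem isFormPerturbation_sqrtPotential (hν₀ : 0 ≤ ν) (hν₃ : ν < 3) (hp : 1 ≤ p)
    (hV : IsAdmissible V) (hVp : IntegrableOn (fun x : ℝ => V x ^ p * x ^ ν) (Ioi 0)) :
    IsFormPerturbation toL2 hardyOp (sqrtPotential hV) where
  denseRange := denseRange_toL2
  closable := hardyOp_closable
  relative_bound := ⟨1 / 2, one_half_lt_one,
    exists_norm_sq_sqrtPotential_le hν₀ hν₃ hp hV hVp one_half_pos⟩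

end PowerIntegrable

end Potential

/-! ### Counting eigenvalues and summing their powers -/

section Thresholds

variable {ρ : ℕ → ℝ} {γ Q : ℝ}

theorem exists_finset_mem_iff_lt_of_sum_rpow_le (hγ : 0 ≤ γ) (hρ : ∀ k, 0 ≤ ρ k)
    (hsum : ∀ n, ∑ k ∈ Finset.range n, ρ k ^ γ ≤ Q) {τ : ℝ} (hτ : 0 < τ) :
    ∃ S : Finset ℕ, (∀ k, k ∈ S ↔ τ < ρ k) ∧ (S.card : ℝ) ≤ Q * τ ^ (-γ) := by
  have hnonneg (k : ℕ) : 0 ≤ ρ k ^ γ := Real.rpow_nonneg (hρ k) γ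
  have hsummable : Summable fun k => ρ k ^ γ := summable_of_sum_range_le hnonneg hsum
  have hlower (k : ℕ) (hk : τ < ρ k) : τ ^ γ ≤ ρ k ^ γ := Real.rpow_le_rpow hτ.le hk.le hγ
  have hτγ : 0 < τ ^ γ := Real.rpow_pos_of_pos hτ γ
  have hfinite : {k | τ < ρ k}.Finite :=
    (eventually_cofinite.1 (hsummable.tendsto_cofinite_zero.eventually_lt_const hτγ)).subset
      fun k hk => not_lt.2 (hlower k hk)
  refine ⟨hfinite.toFinset, fun k => by simp, ?_⟩
  rw [Real.rpow_neg hτ.le, ← div_eq_mul_inv, le_div_iff₀ hτγ]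
  calc (hfinite.toFinset.card : ℝ) * τ ^ γ = ∑ _k ∈ hfinite.toFinset, τ ^ γ := by simp
    _ ≤ ∑ k ∈ hfinite.toFinset, ρ k ^ γ :=
        Finset.sum_le_sum fun k hk => hlower k (by simpa using hk)
    _ ≤ ∑' k, ρ k ^ γ := hsummable.sum_le_tsum _ fun k _ => hnonneg k
    _ ≤ Q := Real.tsum_le_of_sum_range_le hnonneg hsum

theorem lintegral_mul_tsum_indicator_le (hγ : 0 < γ) (hρ : ∀ k, 0 ≤ ρ k)
    (hsum : ∀ n, ∑ k ∈ Finset.range n, ρ k ^ γ ≤ Q) (c : ℝ≥0∞) :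
    ∫⁻ τ in Ioi (0 : ℝ), ENNReal.ofReal (γ * τ ^ (γ - 1)) *
      ∑' k, (Iio (ρ k)).indicator (fun _ => c) τ ≤ c * ENNReal.ofReal Q := by
  have hnonneg (k : ℕ) : 0 ≤ ρ k ^ γ := Real.rpow_nonneg (hρ k) γ
  have hsummable : Summable fun k => ρ k ^ γ := summable_of_sum_range_le hnonneg hsum
  simp_rw [← ENNReal.tsum_mul_left]
  have hmeas (k : ℕ) : Measurable fun τ =>
      ENNReal.ofReal (γ * τ ^ (γ - 1)) * (Iio (ρ k)).indicator (fun _ => c) τ :=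
    (measurable_ofReal_mul_rpow γ (γ - 1)).mul (measurable_const.indicator measurableSet_Iio)
  rw [lintegral_tsum fun k => (hmeas k).aemeasurable]
  simp_rw [lintegral_Ioi_mul_rpow_mul_indicator hγ (hρ _)]
  rw [ENNReal.tsum_mul_left, ← ENNReal.ofReal_tsum_of_nonneg hnonneg hsummable]
  gcongr
  exact Real.tsum_le_of_sum_range_le hnonneg hsum

end Thresholds

section SlicedIntegral

variable {α : ℝ}

theorem lintegral_mul_max_sub_half_le (hα : 0 < α) {v : ℝ} (hv : 0 ≤ v) :
    ∫⁻ τ in Ioi (0 : ℝ), ENNReal.ofReal (α * τ ^ (α - 1)) * ENNReal.ofReal (max (v - τ / 2) 0) ≤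
      ENNReal.ofReal (2 ^ α) * ENNReal.ofReal (v ^ (1 + α)) := by
  have max_le_indicator (τ : ℝ) (hτ : τ ∈ Ioi 0) : ENNReal.ofReal (max (v - τ / 2) 0) ≤
      (Iio (2 * v)).indicator (fun _ => ENNReal.ofReal v) τ := by
    by_cases hτv : τ < 2 * v
    · rw [indicator_of_mem (mem_Iio.2 hτv)]
      exact ENNReal.ofReal_le_ofReal (max_le (by linarith [mem_Ioi.1 hτ]) hv)
    · rw [max_eq_right (by linarith), ENNReal.ofReal_zero]
      exact zero_le
  calc ∫⁻ τ in Ioi (0 : ℝ), ENNReal.ofReal (α * τ ^ (α - 1)) * ENNReal.ofReal (max (v - τ / 2) 0)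
      ≤ ∫⁻ τ in Ioi (0 : ℝ), ENNReal.ofReal (α * τ ^ (α - 1)) *
          (Iio (2 * v)).indicator (fun _ => ENNReal.ofReal v) τ :=
        setLIntegral_mono' measurableSet_Ioi fun τ hτ => by
          gcongr
          exact max_le_indicator τ hτ
    _ = ENNReal.ofReal v * ENNReal.ofReal ((2 * v) ^ α) :=
        lintegral_Ioi_mul_rpow_mul_indicator hα (by positivity) _
    _ = ENNReal.ofReal (2 ^ α) * ENNReal.ofReal (v ^ (1 + α)) := by
        rw [← ENNReal.ofReal_mul hv, ← ENNReal.ofReal_mul (by positivity),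
          Real.mul_rpow zero_le_two hv, Real.rpow_add_of_nonneg hv zero_le_one hα.le,
          Real.rpow_one, mul_left_comm]

theorem lintegral_mul_lintegral_max_sub_half_le {X : Type*} [MeasurableSpace X] {μ : Measure X}
    [SFinite μ] {V : X → ℝ} {w : X → ℝ≥0∞} (hα : 0 < α) (hV : AEMeasurable V μ)
    (hV0 : ∀ᵐ x ∂μ, 0 ≤ V x) (hw : AEMeasurable w μ) :
    ∫⁻ τ in Ioi (0 : ℝ), ENNReal.ofReal (α * τ ^ (α - 1)) *
        ∫⁻ x, ENNReal.ofReal (max (V x - τ / 2) 0) * w x ∂μ ≤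
      ENNReal.ofReal (2 ^ α) * ∫⁻ x, ENNReal.ofReal (V x ^ (1 + α)) * w x ∂μ := by
  have hjoint : AEMeasurable (Function.uncurry fun (τ : ℝ) x => ENNReal.ofReal (α * τ ^ (α - 1)) *
      (ENNReal.ofReal (max (V x - τ / 2) 0) * w x)) ((volume.restrict (Ioi 0)).prod μ) :=
    ((measurable_ofReal_mul_rpow α (α - 1)).comp measurable_fst).aemeasurable.mul
      (((hV.comp_snd.sub (measurable_fst.div_const 2).aemeasurable).max
        aemeasurable_const).ennreal_ofReal.mul hw.comp_snd)
  simp_rw [← lintegral_const_mul' _ _ ENNReal.ofReal_ne_top]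
  rw [lintegral_lintegral_swap hjoint]
  refine lintegral_mono_ae (hV0.mono fun x hx => ?_)
  have hmeas : Measurable fun τ : ℝ =>
      ENNReal.ofReal (α * τ ^ (α - 1)) * ENNReal.ofReal (max (V x - τ / 2) 0) :=
    (measurable_ofReal_mul_rpow α (α - 1)).mul (by fun_prop)
  simp_rw [← mul_assoc]
  rw [lintegral_mul_const _ hmeas]
  gcongr
  exact lintegral_mul_max_sub_half_le hα hx

end SlicedIntegral

section Moments

/-- The constant in the bound on the thresholds `6 ℓ⁻⁴` of the intervals of length `ℓ` of an
adapted partition; it enters the bound on the number of eigenvalues. -/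
def countConst (ν : ℝ) : ℝ := 6 ^ ((3 - ν) / 4) * boundConst ν

variable {ν : ℝ} {V U : ℝ → ℝ}

theorem countConst_pos (hν₃ : ν < 3) : 0 < countConst ν :=
  mul_pos (by positivity) (boundConst_pos hν₃)

theorem six_mul_inv_pow_four_rpow {x : ℝ} (hx : 0 < x) (κ : ℝ) :
    (6 * x⁻¹ ^ 4) ^ (κ / 4) = 6 ^ (κ / 4) * (x ^ κ)⁻¹ := by
  rw [Real.mul_rpow (by norm_num) (by positivity), ← Real.rpow_natCast x⁻¹ 4,
    ← Real.rpow_mul (by positivity), Real.inv_rpow hx.le]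
  congr 3
  push_cast
  ring

theorem integral_mul_rpow_nonneg {f : ℝ → ℝ} (hf : ∀ᵐ x ∂volume.restrict (Ioi 0), 0 ≤ f x) :
    0 ≤ ∫ x in Ioi 0, f x * x ^ ν := by
  refine integral_nonneg_of_ae ?_
  filter_upwards [hf, ae_restrict_mem measurableSet_Ioi] with x hx hx0
  exact mul_nonneg hx (Real.rpow_nonneg (le_of_lt hx0) ν)

theorem lintegral_ofReal_mul_ofReal_rpow {f : ℝ → ℝ}
    (hf : ∀ᵐ x ∂volume.restrict (Ioi 0), 0 ≤ f x)
    (hint : IntegrableOn (fun x => f x * x ^ ν) (Ioi 0)) :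
    ∫⁻ x in Ioi 0, ENNReal.ofReal (f x) * ENNReal.ofReal (x ^ ν) =
      ENNReal.ofReal (∫ x in Ioi 0, f x * x ^ ν) := by
  rw [ofReal_integral_eq_lintegral_ofReal hint]
  · exact lintegral_congr_ae (hf.mono fun x hx => (ENNReal.ofReal_mul hx).symm)
  · filter_upwards [hf, ae_restrict_mem measurableSet_Ioi] with x hx hx0
    exact mul_nonneg hx (Real.rpow_nonneg (le_of_lt hx0) ν)

theorem exists_thresholds_boundedBelowUpToRank {hV : IsAdmissible V}
    (h : IsFormPerturbation toL2 hardyOp (sqrtPotential hV)) (hν₀ : 0 ≤ ν) (hν₃ : ν < 3) {σ : ℝ}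
    (hVU : ∀ᵐ x ∂volume.restrict (Ioi 0), V x ≤ U x + σ)
    (hU0 : ∀ᵐ x ∂volume.restrict (Ioi 0), 0 ≤ U x)
    (hU : IntegrableOn (fun x => U x * x ^ ν) (Ioi 0)) {δ : ℝ} (hδ : 0 < δ) :
    ∃ ρ : ℕ → ℝ, (∀ k, 0 ≤ ρ k) ∧
      (∀ n, ∑ k ∈ Finset.range n, ρ k ^ ((3 - ν) / 4) ≤
        countConst ν * ((∫ x in Ioi 0, U x * x ^ ν) + δ)) ∧
      ∀ (τ : ℝ) (S : Finset ℕ), 0 ≤ τ → (∀ k ∉ S, ρ k ≤ τ) →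
        h.closure.BoundedBelowUpToRank (σ + τ) (2 * S.card) := by
  obtain ⟨b, hmono, hsum, hb⟩ := exists_partition_boundedBelowUpToRank h hν₀ hν₃ hVU hU0 hU hδ
  refine ⟨fun k => 6 * (b (k + 1) - b k)⁻¹ ^ 4, fun k => by positivity, fun n => ?_, hb⟩
  rw [Finset.sum_congr rfl fun k _ =>
    six_mul_inv_pow_four_rpow (sub_pos.2 (hmono k.lt_succ_self)) (3 - ν), ← Finset.mul_sum,
    countConst, mul_assoc]
  gcongr
  exact hsum n

theorem exists_boundedBelowUpToRank_card_le {p : ℝ} {hV : IsAdmissible V}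
    (h : IsFormPerturbation toL2 hardyOp (sqrtPotential hV)) (hν₀ : 0 ≤ ν) (hν₃ : ν < 3)
    (hp : 1 ≤ p) (hVp : IntegrableOn (fun x : ℝ => V x ^ p * x ^ ν) (Ioi 0))
    {τ δ : ℝ} (hτ : 0 < τ) (hδ : 0 < δ) :
    ∃ n : ℕ, h.closure.BoundedBelowUpToRank τ n ∧
      (n : ℝ) ≤ 2 * countConst ν * (τ / 2) ^ (-((3 - ν) / 4)) *
        ((∫ x in Ioi 0, max (V x - τ / 2) 0 * x ^ ν) + δ) := by
  obtain ⟨ρ, hρ, hsum, hb⟩ := exists_thresholds_boundedBelowUpToRank h hν₀ hν₃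
    (Eventually.of_forall fun x => le_max_sub_add (V x) (τ / 2))
    (Eventually.of_forall fun x => le_max_right _ _)
    (integrableOn_max_sub hp hV.nonneg hVp (half_pos hτ)) hδ
  obtain ⟨S, hS, hcard⟩ :=
    exists_finset_mem_iff_lt_of_sum_rpow_le (by linarith) hρ hsum (half_pos hτ)
  refine ⟨2 * S.card, ?_, ?_⟩
  · simpa only [add_halves] using
      hb (τ / 2) S (half_pos hτ).le fun k hk => not_lt.1 (mt (hS k).2 hk)
  · push_cast
    linarith

theorem eigenvalueCount_closure_op_le {p : ℝ} {hV : IsAdmissible V}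
    (h : IsFormPerturbation toL2 hardyOp (sqrtPotential hV)) (hν₀ : 0 ≤ ν) (hν₃ : ν < 3)
    (hp : 1 ≤ p) (hVp : IntegrableOn (fun x : ℝ => V x ^ p * x ^ ν) (Ioi 0))
    {τ : ℝ} (hτ : 0 < τ) :
    eigenvalueCount h.closure.op (-τ) ≤
      ENNReal.ofReal (2 * countConst ν * (τ / 2) ^ (-((3 - ν) / 4))) *
        ∫⁻ x in Ioi 0, ENNReal.ofReal (max (V x - τ / 2) 0) * ENNReal.ofReal (x ^ ν) := by
  have hconst := countConst_pos hν₃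
  set c := 2 * countConst ν * (τ / 2) ^ (-((3 - ν) / 4))
  have hc : 0 < c := by positivity
  have hnonneg : ∀ᵐ x ∂volume.restrict (Ioi 0), 0 ≤ max (V x - τ / 2) 0 :=
    Eventually.of_forall fun x => le_max_right _ _
  rw [lintegral_ofReal_mul_ofReal_rpow hnonneg
    (integrableOn_max_sub hp hV.nonneg hVp (half_pos hτ)), ← ENNReal.ofReal_mul hc.le]
  refine ENNReal.le_of_forall_pos_le_add fun ε hε _ => ?_
  obtain ⟨n, hn, hle⟩ :=
    exists_boundedBelowUpToRank_card_le h hν₀ hν₃ hp hVp hτ (div_pos (NNReal.coe_pos.2 hε) hc)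
  rw [mul_add, mul_div_cancel₀ _ hc.ne'] at hle
  calc eigenvalueCount h.closure.op (-τ) ≤ n := hn.eigenvalueCount_le
    _ = ENNReal.ofReal n := (ENNReal.ofReal_natCast n).symm
    _ ≤ _ := ENNReal.ofReal_le_ofReal hle
    _ = _ := by
        rw [ENNReal.ofReal_add (mul_nonneg hc.le (integral_mul_rpow_nonneg hnonneg)) ε.coe_nonneg,
          ENNReal.ofReal_coe_nnreal]

theorem negTrace_closure_op_le_add {hV : IsAdmissible V}
    (h : IsFormPerturbation toL2 hardyOp (sqrtPotential hV)) (hν₀ : 0 ≤ ν) (hν₃ : ν < 3)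
    (hVi : IntegrableOn (fun x : ℝ => V x * x ^ ν) (Ioi 0)) {δ : ℝ} (hδ : 0 < δ) :
    negTrace h.closure.op ((3 - ν) / 4) ≤
      2 * ENNReal.ofReal (countConst ν * ((∫ x in Ioi 0, V x * x ^ ν) + δ)) := by
  have hγ : 0 < (3 - ν) / 4 := by linarith
  obtain ⟨ρ, hρ, hsum, hb⟩ := exists_thresholds_boundedBelowUpToRank h hν₀ hν₃ (U := V) (σ := 0)
    (Eventually.of_forall fun x => (add_zero _).ge) hV.nonneg hVi hδ
  have count_le (τ : ℝ) (hτ : τ ∈ Ioi 0) : eigenvalueCount h.closure.op (-τ) ≤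
      ∑' k, (Iio (ρ k)).indicator (fun _ => (2 : ℝ≥0∞)) τ := by
    obtain ⟨S, hS, -⟩ := exists_finset_mem_iff_lt_of_sum_rpow_le hγ.le hρ hsum hτ
    have hrank := hb τ S (le_of_lt hτ) fun k hk => not_lt.1 (mt (hS k).2 hk)
    rw [zero_add] at hrank
    calc eigenvalueCount h.closure.op (-τ) ≤ (2 * S.card : ℕ) := hrank.eigenvalueCount_le
      _ = ∑ _k ∈ S, (2 : ℝ≥0∞) := by
          rw [Finset.sum_const, nsmul_eq_mul, Nat.cast_mul, Nat.cast_ofNat, mul_comm]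
      _ = ∑ k ∈ S, (Iio (ρ k)).indicator (fun _ => (2 : ℝ≥0∞)) τ :=
          Finset.sum_congr rfl fun k hk => 
            (indicator_of_mem (mem_Iio.2 ((hS k).1 hk)) fun _ => (2 : ℝ≥0∞)).symm
      _ ≤ _ := ENNReal.sum_le_tsum S
  calc negTrace h.closure.op ((3 - ν) / 4) ≤ _ := negTrace_le_lintegral_eigenvalueCount _ hγ
    _ ≤ ∫⁻ τ in Ioi (0 : ℝ), ENNReal.ofReal ((3 - ν) / 4 * τ ^ ((3 - ν) / 4 - 1)) *
          ∑' k, (Iio (ρ k)).indicator (fun _ => (2 : ℝ≥0∞)) τ :=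
        setLIntegral_mono' measurableSet_Ioi fun τ hτ => by
          gcongr
          exact count_le τ hτ
    _ ≤ _ := lintegral_mul_tsum_indicator_le hγ hρ hsum 2

theorem negTrace_closure_op_critical_le {hV : IsAdmissible V}
    (h : IsFormPerturbation toL2 hardyOp (sqrtPotential hV)) (hν₀ : 0 ≤ ν) (hν₃ : ν < 3)
    (hVi : IntegrableOn (fun x : ℝ => V x * x ^ ν) (Ioi 0)) :
    negTrace h.closure.op ((3 - ν) / 4) ≤
      ENNReal.ofReal (2 * countConst ν * ∫ x in Ioi 0, V x * x ^ ν) := by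
  have hconst : 0 < 2 * countConst ν := mul_pos two_pos (countConst_pos hν₃)
  have : 0 ≤ ∫ x in Ioi 0, V x * x ^ ν := integral_mul_rpow_nonneg hV.nonneg
  refine ENNReal.le_of_forall_pos_le_add fun ε hε _ => ?_
  refine (negTrace_closure_op_le_add h hν₀ hν₃ hVi
    (div_pos (NNReal.coe_pos.2 hε) hconst)).trans_eq ?_
  rw [← ENNReal.ofReal_ofNat 2, ← ENNReal.ofReal_mul zero_le_two, ← mul_assoc, mul_add,
    mul_div_cancel₀ _ hconst.ne', ENNReal.ofReal_add (by positivity) ε.coe_nonneg,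
    ENNReal.ofReal_coe_nnreal]

theorem mul_rpow_mul_half_rpow {γ γ₀ τ : ℝ} (hγ : γ₀ < γ) (c : ℝ) (hτ : 0 < τ) :
    γ * τ ^ (γ - 1) * (c * (τ / 2) ^ (-γ₀)) =
      c * (γ * 2 ^ γ₀) / (γ - γ₀) * ((γ - γ₀) * τ ^ (γ - γ₀ - 1)) := by
  have hhalf : (τ / 2) ^ (-γ₀) = 2 ^ γ₀ * τ ^ (-γ₀) := by
    rw [Real.div_rpow hτ.le zero_le_two, Real.rpow_neg zero_le_two, div_inv_eq_mul, mul_comm]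
  have hexp : τ ^ (γ - γ₀ - 1) = τ ^ (γ - 1) * τ ^ (-γ₀) := by
    rw [← Real.rpow_add hτ]
    ring_nf
  have : γ - γ₀ ≠ 0 := (sub_pos.2 hγ).ne'
  rw [hhalf, hexp]
  field_simp

theorem negTrace_closure_op_supercritical_le {γ : ℝ} {hV : IsAdmissible V}
    (h : IsFormPerturbation toL2 hardyOp (sqrtPotential hV)) (hν₀ : 0 ≤ ν) (hν₃ : ν < 3)
    (hγ : (3 - ν) / 4 < γ)
    (hVp : IntegrableOn (fun x : ℝ => V x ^ (γ + (1 + ν) / 4) * x ^ ν) (Ioi 0)) :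
    negTrace h.closure.op γ ≤
      ENNReal.ofReal (2 * countConst ν * (γ * 2 ^ γ) / (γ - (3 - ν) / 4) *
        ∫ x in Ioi 0, V x ^ (γ + (1 + ν) / 4) * x ^ ν) := by
  have hγpos : 0 < γ := by linarith
  have hconst := countConst_pos hν₃
  have hp : γ + (1 + ν) / 4 = 1 + (γ - (3 - ν) / 4) := by ring
  rw [hp] at hVp ⊢
  set γ₀ := (3 - ν) / 4
  set α := γ - γ₀
  have hα : 0 < α := sub_pos.2 hγ
  set K := 2 * countConst ν * (γ * 2 ^ γ₀) / α
  have hK : 0 ≤ K := by positivity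
  let sliced (τ : ℝ) : ℝ≥0∞ :=
    ∫⁻ x in Ioi 0, ENNReal.ofReal (max (V x - τ / 2) 0) * ENNReal.ofReal (x ^ ν)
  calc negTrace h.closure.op γ
      ≤ ∫⁻ τ in Ioi (0 : ℝ), ENNReal.ofReal (γ * τ ^ (γ - 1)) *
          eigenvalueCount h.closure.op (-τ) := negTrace_le_lintegral_eigenvalueCount _ hγpos
    _ ≤ ∫⁻ τ in Ioi (0 : ℝ), ENNReal.ofReal K *
          (ENNReal.ofReal (α * τ ^ (α - 1)) * sliced τ) :=
        setLIntegral_mono' measurableSet_Ioi fun τ (hτ : 0 < τ) => by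
          rw [← mul_assoc, ← ENNReal.ofReal_mul hK,
            ← mul_rpow_mul_half_rpow hγ (2 * countConst ν) hτ,
            ENNReal.ofReal_mul (p := γ * τ ^ (γ - 1)) (by positivity), mul_assoc]
          gcongr
          exact eigenvalueCount_closure_op_le h hν₀ hν₃ (by linarith) hVp hτ
    _ ≤ ENNReal.ofReal K * (ENNReal.ofReal (2 ^ α) *
          ∫⁻ x in Ioi 0, ENNReal.ofReal (V x ^ (1 + α)) * ENNReal.ofReal (x ^ ν)) := by
        rw [lintegral_const_mul' _ _ ENNReal.ofReal_ne_top]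
        gcongr
        exact lintegral_mul_lintegral_max_sub_half_le hα hV.aemeasurable hV.nonneg
          (measurable_id.pow_const ν).ennreal_ofReal.aemeasurable
    _ = _ := by
        have hKα : 2 * countConst ν * (γ * 2 ^ γ) / α = K * 2 ^ α := by
          rw [show γ = γ₀ + α by ring, Real.rpow_add two_pos]
          ring
        rw [lintegral_ofReal_mul_ofReal_rpow
          (hV.nonneg.mono fun x hx => Real.rpow_nonneg hx (1 + α)) hVp, ← mul_assoc,
          ← ENNReal.ofReal_mul hK, ← ENNReal.ofReal_mul (by positivity), hKα]

theorem exists_negTrace_closure_op_le {γ : ℝ} (hν₀ : 0 ≤ ν) (hν₃ : ν < 3) (hγ : (3 - ν) / 4 ≤ γ) :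
    ∃ C : ℝ, 0 < C ∧ ∀ {V : ℝ → ℝ} {hV : IsAdmissible V}
      (h : IsFormPerturbation toL2 hardyOp (sqrtPotential hV)),
      IntegrableOn (fun x : ℝ => V x ^ (γ + (1 + ν) / 4) * x ^ ν) (Ioi 0) →
      negTrace h.closure.op γ ≤
        ENNReal.ofReal (C * ∫ x in Ioi 0, V x ^ (γ + (1 + ν) / 4) * x ^ ν) := by
  have hconst := countConst_pos hν₃
  rcases hγ.eq_or_lt with rfl | hlt
  · have hp : (3 - ν) / 4 + (1 + ν) / 4 = 1 := by ring
    simp only [hp, Real.rpow_one]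
    exact ⟨2 * countConst ν, by positivity,
      fun h hVi => negTrace_closure_op_critical_le h hν₀ hν₃ hVi⟩
  · have : 0 < γ := by linarith
    have : 0 < γ - (3 - ν) / 4 := sub_pos.2 hlt
    exact ⟨2 * countConst ν * (γ * 2 ^ γ) / (γ - (3 - ν) / 4), by positivity,
      fun h hVp => negTrace_closure_op_supercritical_le h hν₀ hν₃ hlt hVp⟩

theorem hasDiscreteNegSpectrum_closure_op {p : ℝ} {hV : IsAdmissible V}
    (h : IsFormPerturbation toL2 hardyOp (sqrtPotential hV)) (hν₀ : 0 ≤ ν) (hν₃ : ν < 3)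
    (hp : 1 ≤ p) (hVp : IntegrableOn (fun x : ℝ => V x ^ p * x ^ ν) (Ioi 0)) :
    HasDiscreteNegSpectrum h.closure.op :=
  h.closure.op_hasDiscreteNegSpectrum fun _ hτ =>
    (exists_boundedBelowUpToRank_card_le h hν₀ hν₃ hp hVp hτ one_pos).imp fun _ hn => hn.1

theorem exists_mul_integral_le_energy {p : ℝ} (hν₀ : 0 ≤ ν) (hν₃ : ν < 3) (hp : 1 ≤ p)
    (hV : IsAdmissible V) (hVp : IntegrableOn (fun x : ℝ => V x ^ p * x ^ ν) (Ioi 0)) :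
    ∃ c : ℝ, ∀ u : 𝓓(halfLine, ℂ), c * ∫ x in Ioi (0 : ℝ), ‖u x‖ ^ 2 ≤ energy V u := by
  obtain ⟨c, hc⟩ := exists_norm_sq_sqrtPotential_le hν₀ hν₃ hp hV hVp one_pos
  refine ⟨-c, fun u => ?_⟩
  rw [hV.energy_eq, ← norm_sq_toL2]
  linarith [hc u]

end Moments

end

end LiebThirring

theorem theorem1 (ν γ : ℝ) (hν₀ : 0 ≤ ν) (hν₃ : ν < 3) (hγ : (3 - ν) / 4 ≤ γ) :
    ∃ C : ℝ, 0 < C ∧ ∀ V : ℝ → ℝ,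
      (∀ᵐ x ∂(volume : Measure ℝ).restrict (Ioi 0), 0 ≤ V x) →
      IntegrableOn (fun x : ℝ => V x ^ (γ + (1 + ν) / 4) * x ^ ν) (Ioi 0) volume →
      -- the form is well defined and lower semi-bounded on the test functions
      (∀ u : 𝓓(LiebThirring.halfLine, ℂ),
        IntegrableOn (LiebThirring.energyDensity V u) (Ioi 0) volume) ∧
      (∃ c : ℝ, ∀ u : 𝓓(LiebThirring.halfLine, ℂ),
        c * ∫ x in Ioi (0 : ℝ), ‖u x‖ ^ 2 ≤ LiebThirring.energy V u) ∧
      -- it has a closure `h`, which is the form of a self-adjoint operator `T`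
      ∃ (h : LiebThirring.Form LiebThirring.L2)
        (T : LiebThirring.L2 →ₗ.[ℂ] LiebThirring.L2),
        h.IsClosureOf LiebThirring.toL2 (LiebThirring.energy V) ∧
        LiebThirring.IsAssociated T h ∧
        IsSelfAdjoint T ∧
        LiebThirring.HasDiscreteNegSpectrum T ∧
        LiebThirring.negTrace T γ ≤
          ENNReal.ofReal (C * ∫ x in Ioi (0 : ℝ), V x ^ (γ + (1 + ν) / 4) * x ^ ν) := by
  have hp : 1 ≤ γ + (1 + ν) / 4 := by linarith
  obtain ⟨C, hC, htrace⟩ := LiebThirring.exists_negTrace_closure_op_le hν₀ hν₃ hγ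
  refine ⟨C, hC, fun V hV0 hVp => ?_⟩
  have hV := LiebThirring.isAdmissible_of_integrableOn_rpow hp hV0 hVp
  have h := LiebThirring.isFormPerturbation_sqrtPotential hν₀ hν₃ hp hV hVp
  refine ⟨hV.integrableOn_energyDensity,
    LiebThirring.exists_mul_integral_le_energy hν₀ hν₃ hp hV hVp,
    h.closure.form, h.closure.op, ?_, h.closure.op_isAssociated, h.closure.op_isSelfAdjoint,
    LiebThirring.hasDiscreteNegSpectrum_closure_op h hν₀ hν₃ hp hVp, htrace h hVp⟩
  rw [funext hV.energy_eq]
  exact h.isClosureOf
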